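/- **Theorem 1 (consistency of the drop-and-relearn importance of Distributional Random Forests).** *Setting.* Let $k:\mathbb{R}^d\times\mathbb{R}^d\to\mathbb{R}$ be a positive definite kernel that is bounded and jointly continuous, with reproducing kernel Hilbert space $\mathcal{H}$. Let $(\mathbf{X},\mathbf{Y})$ be a random pair with values in $\mathbb{R}^p\times\mathbb{R}^d$, where $p\ge 1$, let $j\in\{1,\dots,p\}$, and write $\mathbf{x}^{(-j)}$ for $\mathbf{x}$ with its $j$-th coordinate removed. Put $\mu(\mathbf{x})=\mathbb{E}[k(\mathbf{Y},\cdot)\mid\mathbf{X}=\mathbf{x}]\in\mathcal{H}$, the kernel mean embedding of the conditional distribution of $\mathbf{Y}$ given $\mathbf{X}=\mathbf{x}$. For an $\mathcal{H}$-valued random element $\xi$ put $\mathbb{V}_{\mathcal{H}}[\xi]=\mathbb{E}\|\xi-\mathbb{E}\xi\|_{\mathcal{H}}^2$ and $\mathbb{V}_{\mathcal{H}}[\xi\mid\cdot]=\mathbb{E}[\|\xi-\mathbb{E}[\xi\mid\cdot]\|_{\mathcal{H}}^2\mid\cdot]$. Assume $\mathbb{V}_{\mathcal{H}}[\mu(\mathbf{X})]>0$;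 the MMD-based generalized total Sobol index is $$\mathrm{I}^{(j)}=\frac{\mathbb{E}\big[\mathbb{V}_{\mathcal{H}}[\mu(\mathbf{X})\mid\mathbf{X}^{(-j)}]\big]}{\mathbb{V}_{\mathcal{H}}[\mu(\mathbf{X})]} .$$ Let $(\mathbf{X}_i,\mathbf{Y}_i)_{i\ge1}$ be i.i.d. copies of $(\mathbf{X},\mathbf{Y})$, and let $(\mathbf{X}'_i)_{i\ge1}$ be i.i.d. copies of $\mathbf{X}$, independent of them. *Data assumptions.* (D1) $\mathbf{X}$ takes values in $[0,1]^p$ and has a density there that is bounded from below and above by strictly positive constants. (D2) $\mathbf{x}\mapsto\mu(\mathbf{x})$ has a Lipschitz version on $[0,1]^p$. (D3) $\mathbf{x}^{(-j)}\mapsto\mathbb{E}[k(\mathbf{Y},\cdot)\mid\mathbf{X}^{(-j)}=\mathbf{x}^{(-j)}]\in\mathcal{H}$ has a Lipschitz version on $[0,1]^{p-1}$. *Forests.* A randomized tree procedure receives a sample $z=(z_1,\dots,z_s)$ of observations $z_i=(\mathbf{x}_i,\mathbf{y}_i)$ and an independent random element $\varepsilon$, and returns (measurably) a finite binary tree of axis-aligned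 splits of the input space, together with a set of sample indices, determined by $\varepsilon$, whose observations populate the leaves. The tree estimate $T(\mathbf{x};\varepsilon,z)$ is the average of $k(\mathbf{y}_i,\cdot)$ over the observations that populate the leaf in which $\mathbf{x}$ falls. The infinite forest is $$\mu_n(\mathbf{x})=\binom{n}{s_n}^{-1}\sum_{i_1<\dots<i_{s_n}}\mathbb{E}_\varepsilon\big[T(\mathbf{x};\varepsilon,(z_{i_1},\dots,z_{i_{s_n}}))\big],\qquad z_i=(\mathbf{X}_i,\mathbf{Y}_i),$$ and $\mu_n(\mathbf{x}^{(-j)})$ denotes the infinite forest retrained in the same way on the data $(\mathbf{X}_i^{(-j)},\mathbf{Y}_i)$ with the $j$-th input removed. Let $0<\alpha\le0.2$, $\pi>0$, $0<\beta<1$ and an integer $\kappa\ge1$ be fixed. The procedures of both forests are assumed to satisfy the following for every $n$ (F2–F4 for all samples whose inputs lie in the unit cube and have no ties in any coordinate). - (F1, honesty) The sample is split into two halves (of sizes that differ by at most one); the second one populates the leaves, and the tree does not depend on its responses (it may depend on its inputs). - (F2, random split) Given the sample and the splits made above a node, if this node is split then each feature has probability (over $\varepsilon$) at least $\pi/p'$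 of being the one along which it is split, $p'$ being the number of features ($p$, or $p-1$ for the retrained forest). - (F3, symmetry) The law of $T(\mathbf{x};\varepsilon,z)$ does not depend on the ordering of the sample. - (F4, $\alpha$-regularity) Almost surely, as soon as the second half has at least $\kappa$ observations, and counting the observations of the second half: each child node contains at least a fraction $\alpha$ of the observations of its parent, and each leaf contains between $\kappa$ and $2\kappa-1$ observations (for a forest without any input, i.e. the retrained forest when $p=1$, the tree is a single leaf and only the lower bound is required). - (F5, subsampling) $s_n=n^\beta$ up to rounding, i.e. $s_n$ is an integer with $|s_n-n^\beta|<1$. *Conclusion.* Put $$\mathrm{I}_n^{(j)}=\frac{\sum_{i=1}^n\big\|\mu_n(\mathbf{X}'_i)-\mu_n(\mathbf{X}_i'^{(-j)})\big\|_{\mathcal{H}}^2}{\sum_{i=1}^n\big\|\mu_n(\mathbf{X}'_i)-\frac1n\sum_{l=1}^n\mu_n(\mathbf{X}'_l)\big\|_{\mathcal{H}}^2}-\mathrm{I}_n^{(0)},$$ where $\mathrm{I}_n^{(0)}$ is the same ratio with $\mu_n(\mathbf{X}_i'^{(-j)})$ replaced by the infinite forest retrained with all inputs (which is again $\mu_n(\mathbf{X}'_i)$,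 so that $\mathrm{I}_n^{(0)}=0$). Then, as $n\to\infty$, $$\mathrm{I}_n^{(j)}\xrightarrow{\ \mathbb{P}\ }\mathrm{I}^{(j)} .$$ -/

import Mathlib

open MeasureTheory ProbabilityTheory Filter Topology

noncomputable section

/-! ### Kernel mean embeddings -/

/-- The feature `k(y, ·)`, as an element of the reproducing kernel Hilbert space `H` of real
functions on `𝒴`. -/
def kernelFeature {𝒴 : Type*} (H : Type*) [NormedAddCommGroup H] [InnerProductSpace ℝ H]
    [CompleteSpace H] [RKHS ℝ H 𝒴 ℝ] (y : 𝒴) : H :=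
  RKHS.kerFun H y (1 : ℝ)

/-- `H` is the reproducing kernel Hilbert space of the real-valued kernel `k`. -/
def IsRKHSOf {𝒴 : Type*} (H : Type*) [NormedAddCommGroup H] [InnerProductSpace ℝ H]
    [CompleteSpace H] [RKHS ℝ H 𝒴 ℝ] (k : 𝒴 → 𝒴 → ℝ) : Prop :=
  ∀ y y', RKHS.kernel H y y' (1 : ℝ) = k y y'

/-- The kernel embedding `Φ(Q) = E[k(Z, ·)]`, `Z ∼ Q`. -/
def kernelEmbedding {𝒴 : Type*} [MeasurableSpace 𝒴] (H : Type*) [NormedAddCommGroup H]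
    [InnerProductSpace ℝ H] [CompleteSpace H] [RKHS ℝ H 𝒴 ℝ] (Q : Measure 𝒴) : H :=
  ∫ y, kernelFeature H y ∂Q

/-- The embedding `μ(x) = Φ(P_{Y ∣ X = x})` of the conditional distribution of `Y` given
`X = x`. -/
def condEmbedding {Ω 𝒳 : Type*} {d : ℕ} [MeasurableSpace Ω] [MeasurableSpace 𝒳] (H : Type*)
    [NormedAddCommGroup H] [InnerProductSpace ℝ H] [CompleteSpace H] [RKHS ℝ H (Fin d → ℝ) ℝ]
    (P : Measure Ω) [IsFiniteMeasure P] (X : Ω → 𝒳) (Y : Ω → Fin d → ℝ) (x : 𝒳) : H :=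
  kernelEmbedding H (condDistrib Y X P x)

/-! ### The generalized total Sobol index -/

/-- The variance `V_H[ξ] = E[‖ξ - E[ξ]‖²]` of an `H`-valued random element. -/
def hVar {Ω H : Type*} [MeasurableSpace Ω] [NormedAddCommGroup H] [InnerProductSpace ℝ H]
    (P : Measure Ω) (ξ : Ω → H) : ℝ :=
  ∫ ω, ‖ξ ω - ∫ ω', ξ ω' ∂P‖ ^ 2 ∂P

/-- The conditional variance `V_H[ξ ∣ m] = E[‖ξ - E[ξ ∣ m]‖² ∣ m]` of an `H`-valued random
element given a σ-algebra `m`. -/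
def hCondVar {Ω H : Type*} [MeasurableSpace Ω] [NormedAddCommGroup H] [InnerProductSpace ℝ H]
    [CompleteSpace H] (P : Measure Ω) (m : MeasurableSpace Ω) (ξ : Ω → H) : Ω → ℝ :=
  P[fun ω => ‖ξ ω - (P[ξ | m]) ω‖ ^ 2 | m]

/-- The input vector `x⁽⁻ʲ⁾`: the `j`-th coordinate is removed. -/
def dropVar {p : ℕ} (j : Fin p) (x : Fin p → ℝ) : {l : Fin p // l ≠ j} → ℝ :=
  fun l => x l

/-- The generalized total Sobol index
`I⁽ʲ⁾ = E[V_H[μ(X) ∣ X⁽⁻ʲ⁾]] / V_H[μ(X)]`. -/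
def totalSobolMMD {Ω : Type*} {p d : ℕ} [MeasurableSpace Ω] (H : Type*)
    [NormedAddCommGroup H] [InnerProductSpace ℝ H] [CompleteSpace H] [RKHS ℝ H (Fin d → ℝ) ℝ]
    (P : Measure Ω) [IsFiniteMeasure P] (X : Ω → Fin p → ℝ) (Y : Ω → Fin d → ℝ)
    (j : Fin p) : ℝ :=
  (∫ ω, hCondVar P (MeasurableSpace.comap (fun ω' => dropVar j (X ω')) inferInstance)
      (fun ω' => condEmbedding H P X Y (X ω')) ω ∂P) /
    hVar P (fun ω => condEmbedding H P X Y (X ω))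

/-! ### Assumptions on the data -/

/-- `Q` is supported on the unit cube, where it has a density bounded from below and above by
strictly positive constants. -/
def HasBoundedDensityOnCube {ι : Type*} [Fintype ι] (Q : Measure (ι → ℝ)) : Prop :=
  ∃ f : (ι → ℝ) → ℝ, Measurable f ∧
    (∃ c C : ℝ, 0 < c ∧ ∀ x ∈ Set.Icc (0 : ι → ℝ) 1, c ≤ f x ∧ f x ≤ C) ∧
    Q = (volume.restrict (Set.Icc (0 : ι → ℝ) 1)).withDensity (fun x => ENNReal.ofReal (f x))

/-- The mapping `x ↦ E[k(Y, ·) ∣ X = x] ∈ H` is Lipschitz on the unit cube. Conditional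
distributions are determined only up to null sets, so this asks for a Lipschitz version. (All
norms on `ℝ^ι` are equivalent, so the choice of the norm on the inputs is immaterial.) -/
def LipschitzCondEmbedding {Ω ι : Type*} {d : ℕ} [Fintype ι] [MeasurableSpace Ω] (H : Type*)
    [NormedAddCommGroup H] [InnerProductSpace ℝ H] [CompleteSpace H] [RKHS ℝ H (Fin d → ℝ) ℝ]
    (P : Measure Ω) [IsFiniteMeasure P] (X : Ω → ι → ℝ) (Y : Ω → Fin d → ℝ) : Prop :=
  ∃ (L : NNReal) (g : (ι → ℝ) → H), LipschitzOnWith L g (Set.Icc (0 : ι → ℝ) 1) ∧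
    ∀ᵐ x ∂(P.map X), condEmbedding H P X Y x = g x

/-! ### Trees -/

/-- Binary trees of axis-aligned splits of `ℝ^ι`: `node l t L R` sends the points with
`x l ≤ t` to `L` and the points with `t < x l` to `R`. -/
inductive SplitTree (ι : Type*) where
  | leaf : SplitTree ι
  | node (l : ι) (t : ℝ) (L R : SplitTree ι) : SplitTree ι

namespace SplitTree

/-- The leaf cell that contains the query point `x`. -/
def cell {ι : Type*} : SplitTree ι → (ι → ℝ) → Set (ι → ℝ)
  | leaf, _ => Set.univ
  | node l t L R, x =>
      {y | (x l ≤ t ∧ y l ≤ t ∧ y ∈ L.cell x) ∨ (t < x l ∧ t < y l ∧ y ∈ R.cell x)}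

/-- The split made at the node with the given address (from the root, `true` for the left child
and `false` for the right child), if there is an internal node at this address. -/
def label {ι : Type*} : SplitTree ι → List Bool → Option (ι × ℝ)
  | leaf, _ => none
  | node l t _ _, [] => some (l, t)
  | node _ _ L _, true :: a => L.label a
  | node _ _ _ R, false :: a => R.label a

/-- The node at the address `a` is split. -/
def IsSplit {ι : Type*} (T : SplitTree ι) (a : List Bool) : Prop :=
  ∃ l t, T.label a = some (l, t)

/-- The node at the address `a` is split along the feature `l`. -/
def SplitsAlong {ι : Type*} (T : SplitTree ι) (a : List Bool) (l : ι) : Prop :=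
  ∃ t, T.label a = some (l, t)

/-- The elementary event that the node at the address `a` is split along the feature `l`, at a
threshold at most `t`. -/
def splitEvent {ι : Type*} (a : List Bool) (l : ι) (t : ℝ) : Set (SplitTree ι) :=
  {T | ∃ u ≤ t, T.label a = some (l, u)}

/-- The σ-algebra on trees generated by all the splits. -/
instance {ι : Type*} : MeasurableSpace (SplitTree ι) :=
  MeasurableSpace.generateFrom {S | ∃ a l t, S = splitEvent a l t}

/-- The σ-algebra generated by the splits at the proper ancestors of the address `a`. -/
abbrev history {ι : Type*} (a : List Bool) : MeasurableSpace (SplitTree ι) :=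
  MeasurableSpace.generateFrom {S | ∃ b l t, b <+: a ∧ b ≠ a ∧ S = splitEvent b l t}

/-- The tree, with the points `x i`, `i ∈ A`, in its root, is regular: each child contains at
least a fraction `α` of the points of its parent, and each leaf contains between `κ` and
`2 * κ - 1` points. (Without any feature, no split is possible, and the upper bound on the size
of the leaf is void.) -/
def IsRegular {ι : Type*} {s : ℕ} (α : ℝ) (κ : ℕ) (x : Fin s → ι → ℝ) :
    SplitTree ι → Finset (Fin s) → Prop
  | leaf, A => κ ≤ A.card ∧ (Nonempty ι → A.card ≤ 2 * κ - 1)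
  | node l t L R, A =>
      α * A.card ≤ (A.filter fun i => x i l ≤ t).card ∧
      α * A.card ≤ (A.filter fun i => t < x i l).card ∧
      L.IsRegular α κ x (A.filter fun i => x i l ≤ t) ∧
      R.IsRegular α κ x (A.filter fun i => t < x i l)

end SplitTree

/-! ### Randomized tree procedures and forests -/

/-- A randomized procedure that grows a tree from `s` observations `zᵢ = (xᵢ, yᵢ)` with
`xᵢ ∈ ℝ^ι`, `yᵢ ∈ ℝ^d`. The tree randomness `ε` takes values in `E` and has the law `law`. The
randomness determines which observations populate the leaves (`est ε`); the tree may depend on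
`ε` and on the observations. -/
structure TreeProcedure (E : Type*) [MeasurableSpace E] (ι : Type*) (d s : ℕ) where
  /-- the law of the tree randomness -/
  law : Measure E
  /-- the indices of the observations that populate the leaves -/
  est : E → Finset (Fin s)
  /-- the tree -/
  grow : E → (Fin s → (ι → ℝ) × (Fin d → ℝ)) → SplitTree ι
  isProb : IsProbabilityMeasure law
  measurable_est : ∀ A, MeasurableSet (est ⁻¹' {A})
  measurable_grow : Measurable fun q : E × (Fin s → (ι → ℝ) × (Fin d → ℝ)) => grow q.1 q.2

/-- The inputs lie in the unit cube and have no ties in any coordinate (this holds almost surely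
if they are sampled from a density on the cube). -/
def GeneralPosition {ι : Type*} {s : ℕ} (x : Fin s → ι → ℝ) : Prop :=
  (∀ i l, x i l ∈ Set.Icc (0 : ℝ) 1) ∧ ∀ l, Function.Injective fun i => x i l

namespace TreeProcedure

variable {E : Type*} [MeasurableSpace E] {ι : Type*} {d s : ℕ}

open Classical in
/-- The observations that populate the leaf in which `x` falls. -/
def leafPoints (A : TreeProcedure E ι d s) (x : ι → ℝ) (e : E)
    (z : Fin s → (ι → ℝ) × (Fin d → ℝ)) : Finset (Fin s) :=
  (A.est e).filter fun i => (z i).1 ∈ (A.grow e z).cell x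

/-- The tree estimate `T(x; ε, z)`: the average of `k(yᵢ, ·)` over the observations that populate
the leaf in which `x` falls. -/
def output (H : Type*) [NormedAddCommGroup H] [InnerProductSpace ℝ H] [CompleteSpace H]
    [RKHS ℝ H (Fin d → ℝ) ℝ] (A : TreeProcedure E ι d s) (x : ι → ℝ) (e : E)
    (z : Fin s → (ι → ℝ) × (Fin d → ℝ)) : H :=
  ∑ i ∈ A.leafPoints x e z, ((A.leafPoints x e z).card : ℝ)⁻¹ • kernelFeature H (z i).2

/-- Honesty: the data are split into two halves, of which the second populates the leaves; the
responses of the second half are not used for the splits (their inputs may be). -/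
def Honest (A : TreeProcedure E ι d s) : Prop :=
  ∀ e, (s / 2 ≤ (A.est e).card ∧ (A.est e).card ≤ (s + 1) / 2) ∧
    ∀ z z' : Fin s → (ι → ℝ) × (Fin d → ℝ), (∀ i, (z i).1 = (z' i).1) →
      (∀ i, i ∉ A.est e → (z i).2 = (z' i).2) → A.grow e z = A.grow e z'

/-- Random split: given the data and the splits made above a node, and if the node is split, the
probability (over the tree randomness) that it is split along any given feature is at least
`π / p`, with `p` the number of features. -/
def RandomSplit [Fintype ι] (A : TreeProcedure E ι d s) (π : ℝ) : Prop :=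
  ∀ z : Fin s → (ι → ℝ) × (Fin d → ℝ), GeneralPosition (fun i => (z i).1) →
    ∀ (a : List Bool) (l : ι) (B : Set (SplitTree ι)), MeasurableSet[SplitTree.history a] B →
      ENNReal.ofReal (π / Fintype.card ι) *
          A.law {e | A.grow e z ∈ B ∧ (A.grow e z).IsSplit a} ≤
        A.law {e | A.grow e z ∈ B ∧ (A.grow e z).SplitsAlong a l}

/-- Symmetry: the law of the randomized output of the tree does not depend on the ordering of the
observations. -/
def Symmetric (H : Type*) [NormedAddCommGroup H] [InnerProductSpace ℝ H] [CompleteSpace H]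
    [RKHS ℝ H (Fin d → ℝ) ℝ] (A : TreeProcedure E ι d s) : Prop :=
  ∀ z : Fin s → (ι → ℝ) × (Fin d → ℝ), GeneralPosition (fun i => (z i).1) →
    ∀ (σ : Equiv.Perm (Fin s)) (x : ι → ℝ) (S : Set H), MeasurableSet[borel H] S →
      A.law {e | A.output H x e (fun i => z (σ i)) ∈ S} = A.law {e | A.output H x e z ∈ S}

/-- `α`-regularity with leaf size `κ`, with respect to the observations that populate the
leaves (as soon as there are at least `κ` of them). -/
def AlphaRegular (A : TreeProcedure E ι d s) (α : ℝ) (κ : ℕ) : Prop :=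
  ∀ z : Fin s → (ι → ℝ) × (Fin d → ℝ), GeneralPosition (fun i => (z i).1) →
    ∀ᵐ e ∂A.law, κ ≤ (A.est e).card →
      (A.grow e z).IsRegular α κ (fun i => (z i).1) (A.est e)

/-- The trees are honest, random-split, symmetric and `α`-regular. -/
structure ForestConditions [Fintype ι] (H : Type*) [NormedAddCommGroup H]
    [InnerProductSpace ℝ H] [CompleteSpace H] [RKHS ℝ H (Fin d → ℝ) ℝ]
    (A : TreeProcedure E ι d s) (α π : ℝ) (κ : ℕ) : Prop where
  honest : A.Honest
  randomSplit : A.RandomSplit π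
  symm : A.Symmetric H
  regular : A.AlphaRegular α κ

/-- The infinite forest: the average over all the subsamples `i₁ < ⋯ < i_s` of `z` of the
expectation, over the tree randomness, of the tree estimate. -/
def forest (H : Type*) [NormedAddCommGroup H] [InnerProductSpace ℝ H] [CompleteSpace H]
    [RKHS ℝ H (Fin d → ℝ) ℝ] (A : TreeProcedure E ι d s) {n : ℕ}
    (z : Fin n → (ι → ℝ) × (Fin d → ℝ)) (x : ι → ℝ) : H :=
  ((n.choose s : ℕ) : ℝ)⁻¹ •
    ∑ i : Fin s ↪o Fin n, ∫ e, A.output H x e (fun r => z (i r)) ∂A.law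

end TreeProcedure

/-! ### The importance estimator -/

/-- `∑ᵢ ‖fᵢ - gᵢ‖² / ∑ᵢ ‖fᵢ - f̄‖²`, with `f̄` the mean of the `fᵢ`. -/
def relativeDiscrepancy {H : Type*} [NormedAddCommGroup H] [InnerProductSpace ℝ H] {n : ℕ}
    (f g : Fin n → H) : ℝ :=
  (∑ i, ‖f i - g i‖ ^ 2) / ∑ i, ‖f i - (n : ℝ)⁻¹ • ∑ i', f i'‖ ^ 2

/-- The drop-and-relearn importance `I_n⁽ʲ⁾` built from infinite forests: `A` grows the trees with
all the inputs, `A'` those retrained without the `j`-th input, `z` is the training sample and `x'`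
the independent sample of inputs. The subtracted term is `I_n⁽⁰⁾`, for which the forest is
retrained with all the inputs. -/
def dropRelearnImportance {E E' : Type*} [MeasurableSpace E] [MeasurableSpace E'] {p d s n : ℕ}
    (H : Type*) [NormedAddCommGroup H] [InnerProductSpace ℝ H] [CompleteSpace H]
    [RKHS ℝ H (Fin d → ℝ) ℝ] (j : Fin p) (A : TreeProcedure E (Fin p) d s)
    (A' : TreeProcedure E' {l : Fin p // l ≠ j} d s)
    (z : Fin n → (Fin p → ℝ) × (Fin d → ℝ)) (x' : Fin n → Fin p → ℝ) : ℝ :=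
  relativeDiscrepancy (fun i => A.forest H z (x' i))
      (fun i => A'.forest H (fun r => (dropVar j (z r).1, (z r).2)) (dropVar j (x' i))) -
    relativeDiscrepancy (fun i => A.forest H z (x' i)) (fun i => A.forest H z (x' i))

end

/-!
Both forests are consistent in `L¹`, uniformly in the index of the new input: the mean of
`‖μₙ(X'ᵢ) - μ(X'ᵢ)‖` is a number that does not depend on `i` and tends to zero
(`tendsto_integral_norm_forest_sub`). As everything is bounded by `√(sup k)`, the numerator and the
denominator of the importance then differ, by an amount that vanishes in `L¹`, from the empirical
means built from the conditional mean embeddings `u(X'ᵢ)` and `v(X'ᵢ⁽⁻ʲ⁾)` themselves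
(`abs_average_norm_sub_sq_sub_le`, `abs_empirical_variance_sub_le`). The strong law of large numbers
gives the limits `E‖u(X) - v(X⁽⁻ʲ⁾)‖²` and `E‖u(X)‖² - ‖E u(X)‖²` of these; by the tower property
`v(X⁽⁻ʲ⁾)` is the conditional expectation of `u(X)`, so that they are the numerator and the
denominator of the index (`totalSobolMMD_eq`), and the latter is positive.

The error of a forest has two parts.

* The fluctuation. A forest is a complete U-statistic. By symmetry it is the average, over all the
  permutations of the sample, of averages over `⌊n / s⌋` disjoint, hence independent, subsamples
  (`average_orderEmb_eq_average_perm`), so that its `L¹` distance to its mean is at most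
  `2 B / √⌊n / s⌋` (`integral_norm_ustat_sub_le`), which vanishes since `s` is about `n ^ β`
  with `β < 1`.

* The bias of one tree. By honesty, the responses in a leaf can be replaced by their conditional
  means (`TreeProcedure.Honest.integral_output`). These are a Lipschitz function of the inputs, so
  the bias is at most a multiple of the width of the leaf, hence of the cell at any fixed depth `M`
  (`TreeProcedure.norm_integral_treeMean_sub_le`): by `α`-regularity, all the nodes of depth less
  than `M` are split as soon as the sample is large enough. For each feature `l`, consider the sum
  over the nodes of a given depth of the mass of the cell times its width along `l`. A split along
  another feature does not increase it, and a split along `l` that leaves a fraction `α` of the mass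
  on each side reduces the contribution of its node by the factor `1 - α`. As the feature is `l`
  with probability at least `r = min (π / p') 1` given the splits above the node, the mean
  contracts by the factor `1 - α * r` from one depth to the next (`integral_cellWidth_le`).

The regularity of the trees only concerns the balance of the splits for the empirical measure of the
observations that populate the leaves, and the tree may depend on the inputs of these observations.
The passage to the law of the inputs therefore has to be uniform over the cells. A cell at depth at
most `M` is bracketed by two unions of cells of a grid of width `1 / G`, whose difference meets at
most `M` slabs (`SplitTree.exists_bracket`); the slabs have a mass of order `1 / G` because the
density is bounded, and for a fixed grid the empirical masses converge in `L¹`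
(`integral_gridDiscrepancy_le`). Choosing `M`, then `G`, then `n` makes the error small.
-/

noncomputable section

/-! ### The nodes of a tree and the points that pass through them -/

namespace SplitTree

variable {ι : Type*}

/-- `T.Reach a x`: the node at the address `a` exists in `T` and the point `x` passes through it. -/
def Reach : SplitTree ι → List Bool → (ι → ℝ) → Prop
  | _, [], _ => True
  | leaf, _ :: _, _ => False
  | node l t L _, true :: a, x => x l ≤ t ∧ L.Reach a x
  | node l t _ R, false :: a, x => t < x l ∧ R.Reach a x

/-- `T.Admits l a u`: the real number `u` satisfies all the constraints that the splits along the
feature `l` at the proper ancestors of the address `a` put on the `l`-th coordinate. -/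
def Admits (l : ι) : SplitTree ι → List Bool → ℝ → Prop
  | _, [], _ => True
  | leaf, _ :: _, _ => False
  | node l' t L _, true :: a, u => (l' = l → u ≤ t) ∧ L.Admits l a u
  | node l' t _ R, false :: a, u => (l' = l → t < u) ∧ R.Admits l a u

@[simp] lemma reach_nil (T : SplitTree ι) (x : ι → ℝ) : T.Reach [] x := by
  cases T <;> trivial

@[simp] lemma admits_nil (l : ι) (T : SplitTree ι) (u : ℝ) : T.Admits l [] u := by
  cases T <;> trivial

lemma reach_append_true (T : SplitTree ι) (a : List Bool) (x : ι → ℝ) :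
    T.Reach (a ++ [true]) x ↔ T.Reach a x ∧ ∃ l t, T.label a = some (l, t) ∧ x l ≤ t := by
  induction a generalizing T with
  | nil => cases T <;> simp [Reach, label]
  | cons c a ih => cases T <;> cases c <;> simp [Reach, label, ih, and_assoc]

lemma reach_append_false (T : SplitTree ι) (a : List Bool) (x : ι → ℝ) :
    T.Reach (a ++ [false]) x ↔ T.Reach a x ∧ ∃ l t, T.label a = some (l, t) ∧ t < x l := by
  induction a generalizing T with
  | nil => cases T <;> simp [Reach, label]
  | cons c a ih => cases T <;> cases c <;> simp [Reach, label, ih, and_assoc]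

lemma admits_append_true (l : ι) (T : SplitTree ι) (a : List Bool) (u : ℝ) :
    T.Admits l (a ++ [true]) u ↔
      T.Admits l a u ∧ ∃ l' t, T.label a = some (l', t) ∧ (l' = l → u ≤ t) := by
  induction a generalizing T with
  | nil => cases T <;> simp [Admits, label]
  | cons c a ih => cases T <;> cases c <;> simp [Admits, label, ih, and_assoc]

lemma admits_append_false (l : ι) (T : SplitTree ι) (a : List Bool) (u : ℝ) :
    T.Admits l (a ++ [false]) u ↔
      T.Admits l a u ∧ ∃ l' t, T.label a = some (l', t) ∧ (l' = l → t < u) := by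
  induction a generalizing T with
  | nil => cases T <;> simp [Admits, label]
  | cons c a ih => cases T <;> cases c <;> simp [Admits, label, ih, and_assoc]

section Label

variable {T : SplitTree ι} {a : List Bool} {l' : ι} {t : ℝ}

lemma reach_append_true_of_label (h : T.label a = some (l', t))
    (x : ι → ℝ) :
    T.Reach (a ++ [true]) x ↔ T.Reach a x ∧ x l' ≤ t := by
  simp [reach_append_true, h]

lemma reach_append_false_of_label (h : T.label a = some (l', t))
    (x : ι → ℝ) :
    T.Reach (a ++ [false]) x ↔ T.Reach a x ∧ t < x l' := by
  simp [reach_append_false, h]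

lemma admits_append_true_of_label (h : T.label a = some (l', t))
    (l : ι) (u : ℝ) :
    T.Admits l (a ++ [true]) u ↔ T.Admits l a u ∧ (l' = l → u ≤ t) := by
  simp [admits_append_true, h]

lemma admits_append_false_of_label (h : T.label a = some (l', t))
    (l : ι) (u : ℝ) :
    T.Admits l (a ++ [false]) u ↔ T.Admits l a u ∧ (l' = l → t < u) := by
  simp [admits_append_false, h]

end Label

lemma Reach.admits {T : SplitTree ι} {a : List Bool} {x : ι → ℝ} (h : T.Reach a x) (l : ι) :
    T.Admits l a (x l) := by
  induction a generalizing T with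
  | nil => simp
  | cons c a ih =>
    cases T <;> cases c <;> simp only [Reach, Admits] at h ⊢
    · exact ⟨fun e => e ▸ h.1, ih h.2⟩
    · exact ⟨fun e => e ▸ h.1, ih h.2⟩

/-- The real numbers admitted along one feature form an interval. -/
lemma Admits.between {l : ι} {T : SplitTree ι} {a : List Bool} {u v w : ℝ} (hu : T.Admits l a u)
    (hv : T.Admits l a v) (huw : u ≤ w) (hwv : w ≤ v) : T.Admits l a w := by
  induction a generalizing T with
  | nil => simp
  | cons c a ih =>
    cases T <;> cases c <;> simp only [Admits] at hu hv ⊢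
    · exact ⟨fun e => (hu.1 e).trans_le huw, ih hu.2 hv.2⟩
    · exact ⟨fun e => hwv.trans (hv.1 e), ih hu.2 hv.2⟩

/-- Two points lie in the same leaf cell if and only if they pass through the same nodes. -/
lemma mem_cell_iff (T : SplitTree ι) (x y : ι → ℝ) :
    y ∈ T.cell x ↔ ∀ a, T.Reach a x ↔ T.Reach a y := by
  induction T with
  | leaf =>
    simp only [cell, Set.mem_univ, true_iff]
    rintro (_ | ⟨c, a⟩) <;> simp [Reach]
  | node l t L R ihL ihR =>
    simp only [cell, Set.mem_ofPred_eq, ihL, ihR]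
    constructor
    · rintro (⟨hx, hy, h⟩ | ⟨hx, hy, h⟩) (_ | ⟨c, a⟩)
      · simp
      · cases c <;> simp [Reach, hx, hy, h, hx.not_gt, hy.not_gt]
      · simp
      · cases c <;> simp [Reach, hx, hy, h, hx.not_ge, hy.not_ge]
    · intro h
      rcases le_or_gt (x l) t with hx | hx
      · have hy : y l ≤ t := by simpa [Reach, hx] using h [true]
        exact Or.inl ⟨hx, hy, fun a => by simpa [Reach, hx, hy] using h (true :: a)⟩
      · have hy : t < y l := by simpa [Reach, hx] using h [false]
        exact Or.inr ⟨hx, hy, fun a => by simpa [Reach, hx, hy] using h (false :: a)⟩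

/-! ### Measurability of trees -/

lemma history_mono {a b : List Bool} (h : a <+: b) : history (ι := ι) a ≤ history b := by
  refine MeasurableSpace.generateFrom_mono ?_
  rintro S ⟨c, l, t, hc, hne, rfl⟩
  refine ⟨c, l, t, hc.trans h, ?_, rfl⟩
  rintro rfl
  exact hne (hc.eq_of_length (le_antisymm hc.length_le h.length_le))

lemma history_le (a : List Bool) :
    history (ι := ι) a ≤ (inferInstance : MeasurableSpace (SplitTree ι)) := by
  refine MeasurableSpace.generateFrom_mono ?_
  rintro S ⟨b, l, t, -, -, rfl⟩
  exact ⟨b, l, t, rfl⟩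

lemma measurableSet_splitEvent {a b : List Bool} (h : b <+: a) (hne : b ≠ a) (l : ι) (t : ℝ) :
    MeasurableSet[history a] (splitEvent b l t) :=
  MeasurableSpace.measurableSet_generateFrom ⟨b, l, t, h, hne, rfl⟩

lemma setOf_splitsAlong (a : List Bool) (l : ι) :
    {T : SplitTree ι | T.SplitsAlong a l} = ⋃ n : ℕ, splitEvent a l n := by
  ext T
  simp only [SplitsAlong, splitEvent, Set.mem_ofPred_eq, Set.mem_iUnion]
  exact ⟨fun ⟨t, ht⟩ => ⟨⌈t⌉₊, t, Nat.le_ceil t, ht⟩, fun ⟨_, u, _, hu⟩ => ⟨u, hu⟩⟩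

lemma measurableSet_splitsAlong_history {a b : List Bool} (h : b <+: a) (hne : b ≠ a) (l : ι) :
    MeasurableSet[history a] {T : SplitTree ι | T.SplitsAlong b l} := by
  rw [setOf_splitsAlong]
  exact MeasurableSet.iUnion fun n => measurableSet_splitEvent h hne l n

lemma measurableSet_splitsAlong (a : List Bool) (l : ι) :
    MeasurableSet {T : SplitTree ι | T.SplitsAlong a l} :=
  history_le (a ++ [true]) _
    (measurableSet_splitsAlong_history (List.prefix_append a [true]) (by simp) l)

section Joint

variable {β : Type*} [mβ : MeasurableSpace β] (m : MeasurableSpace (SplitTree ι))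

/-- A point and the threshold of a split can be compared measurably, and the σ-algebra on trees
only has to contain the events of this split. -/
lemma measurableSet_threshold_lt {a : List Bool} {l : ι}
    (hm : ∀ t, MeasurableSet[m] (splitEvent a l t)) {f : β → ℝ} (hf : Measurable f) :
    MeasurableSet[m.prod mβ]
      {q : SplitTree ι × β | ∃ t, q.1.label a = some (l, t) ∧ t < f q.2} := by
  have : {q : SplitTree ι × β | ∃ t, q.1.label a = some (l, t) ∧ t < f q.2} =
      ⋃ r : ℚ, splitEvent a l r ×ˢ {x | (r : ℝ) < f x} := by
    ext ⟨T, x⟩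
    simp only [Set.mem_ofPred_eq, Set.mem_iUnion, Set.mem_prod, splitEvent]
    constructor
    · rintro ⟨t, ht, hlt⟩
      obtain ⟨r, hr1, hr2⟩ := exists_rat_btwn hlt
      exact ⟨r, ⟨t, hr1.le, ht⟩, hr2⟩
    · rintro ⟨r, ⟨t, htr, ht⟩, hr⟩
      exact ⟨t, ht, htr.trans_lt hr⟩
  rw [this]
  exact MeasurableSet.iUnion fun r =>
    @MeasurableSet.prod _ _ m mβ _ _ (hm r) (measurableSet_lt measurable_const hf)

lemma measurableSet_le_threshold {a : List Bool} {l : ι}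
    (hm : ∀ t, MeasurableSet[m] (splitEvent a l t)) {f : β → ℝ} (hf : Measurable f) :
    MeasurableSet[m.prod mβ]
      {q : SplitTree ι × β | ∃ t, q.1.label a = some (l, t) ∧ f q.2 ≤ t} := by
  have : {q : SplitTree ι × β | ∃ t, q.1.label a = some (l, t) ∧ f q.2 ≤ t} =
      ({T : SplitTree ι | T.SplitsAlong a l} ×ˢ Set.univ) \
        {q : SplitTree ι × β | ∃ t, q.1.label a = some (l, t) ∧ t < f q.2} := by
    ext ⟨T, x⟩
    simp only [Set.mem_ofPred_eq, Set.mem_sdiff, Set.mem_prod, SplitsAlong, Set.mem_univ, and_true]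
    constructor
    · rintro ⟨t, ht, hle⟩
      refine ⟨⟨t, ht⟩, ?_⟩
      rintro ⟨t', ht', hlt⟩
      rw [ht] at ht'
      simp only [Option.some.injEq, Prod.mk.injEq, true_and] at ht'
      exact absurd hlt (ht' ▸ hle.not_gt)
    · rintro ⟨⟨t, ht⟩, hn⟩
      exact ⟨t, ht, not_lt.1 fun hlt => hn ⟨t, ht, hlt⟩⟩
  rw [this]
  refine MeasurableSet.diff (@MeasurableSet.prod _ _ m mβ _ _ ?_ MeasurableSet.univ)
    (measurableSet_threshold_lt m hm hf)
  rw [setOf_splitsAlong]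
  exact MeasurableSet.iUnion fun n => hm n

lemma measurableSet_label_prod {a : List Bool} {l : ι}
    (hm : ∀ t, MeasurableSet[m] (splitEvent a l t)) :
    MeasurableSet[m.prod mβ] {q : SplitTree ι × β | ∃ t, q.1.label a = some (l, t)} := by
  have : {q : SplitTree ι × β | ∃ t, q.1.label a = some (l, t)} =
      {T : SplitTree ι | T.SplitsAlong a l} ×ˢ Set.univ := by
    ext ⟨T, x⟩
    simp [SplitsAlong]
  rw [this]
  refine @MeasurableSet.prod _ _ m mβ _ _ ?_ MeasurableSet.univ
  rw [setOf_splitsAlong]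
  exact MeasurableSet.iUnion fun n => hm n

end Joint

/-- Whether a point passes through a node is determined by the splits at the proper ancestors of
this node. -/
lemma measurableSet_reach_history [Countable ι] (a : List Bool) :
    MeasurableSet[(history a).prod MeasurableSpace.pi]
      {q : SplitTree ι × (ι → ℝ) | q.1.Reach a q.2} := by
  induction a using List.reverseRecOn with
  | nil => simp
  | append_singleton a c ih =>
    have ih' : MeasurableSet[(history (a ++ [c])).prod MeasurableSpace.pi]
        {q : SplitTree ι × (ι → ℝ) | q.1.Reach a q.2} :=
      (sup_le_sup (MeasurableSpace.comap_mono (history_mono (List.prefix_append a [c]))) le_rfl)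
        _ ih
    have hm (l : ι) (t : ℝ) : MeasurableSet[history (a ++ [c])] (splitEvent a l t) :=
      measurableSet_splitEvent (List.prefix_append a [c]) (by simp) l t
    cases c
    · simp only [reach_append_false, Set.ofPred_and, Set.ofPred_exists]
      refine ih'.inter (MeasurableSet.iUnion fun l => ?_)
      simpa only [Set.ofPred_and, Set.ofPred_exists] using
        measurableSet_threshold_lt (β := ι → ℝ) _ (hm l) (measurable_pi_apply l)
    · simp only [reach_append_true, Set.ofPred_and, Set.ofPred_exists]
      refine ih'.inter (MeasurableSet.iUnion fun l => ?_)
      simpa only [Set.ofPred_and, Set.ofPred_exists] using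
        measurableSet_le_threshold (β := ι → ℝ) _ (hm l) (measurable_pi_apply l)

lemma measurableSet_admits_history [Countable ι] (l : ι) (a : List Bool) :
    MeasurableSet[(history a).prod (borel ℝ)]
      {q : SplitTree ι × ℝ | q.1.Admits l a q.2} := by
  rw [← BorelSpace.measurable_eq (α := ℝ)]
  induction a using List.reverseRecOn with
  | nil => simp
  | append_singleton a c ih =>
    have ih' : MeasurableSet[(history (a ++ [c])).prod inferInstance]
        {q : SplitTree ι × ℝ | q.1.Admits l a q.2} :=
      (sup_le_sup (MeasurableSpace.comap_mono (history_mono (List.prefix_append a [c]))) le_rfl)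
        _ ih
    have hm (l : ι) (t : ℝ) : MeasurableSet[history (a ++ [c])] (splitEvent a l t) :=
      measurableSet_splitEvent (List.prefix_append a [c]) (by simp) l t
    cases c
    · simp only [admits_append_false, Set.ofPred_and, Set.ofPred_exists]
      refine ih'.inter (MeasurableSet.iUnion fun l' => ?_)
      by_cases h : l' = l
      · simpa only [Set.ofPred_and, Set.ofPred_exists, h, true_imp_iff] using
          measurableSet_threshold_lt _ (hm l) (measurable_id' (α := ℝ))
      · simpa only [Set.ofPred_exists, h, false_imp_iff, Set.ofPred_true, Set.inter_univ] using
          measurableSet_label_prod (β := ℝ) _ (hm l')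
    · simp only [admits_append_true, Set.ofPred_and, Set.ofPred_exists]
      refine ih'.inter (MeasurableSet.iUnion fun l' => ?_)
      by_cases h : l' = l
      · simpa only [Set.ofPred_and, Set.ofPred_exists, h, true_imp_iff] using
          measurableSet_le_threshold _ (hm l) (measurable_id' (α := ℝ))
      · simpa only [Set.ofPred_exists, h, false_imp_iff, Set.ofPred_true, Set.inter_univ] using
          measurableSet_label_prod (β := ℝ) _ (hm l')

lemma measurableSet_reach [Countable ι] (a : List Bool) :
    MeasurableSet {q : SplitTree ι × (ι → ℝ) | q.1.Reach a q.2} :=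
  (sup_le_sup (MeasurableSpace.comap_mono (history_le a)) le_rfl) _ (measurableSet_reach_history a)

lemma measurableSet_mem_cell [Countable ι] :
    MeasurableSet {q : SplitTree ι × (ι → ℝ) × (ι → ℝ) | q.2.2 ∈ q.1.cell q.2.1} := by
  simp only [mem_cell_iff, Set.ofPred_forall]
  refine MeasurableSet.iInter fun a => ?_
  have h1 : MeasurableSet {q : SplitTree ι × (ι → ℝ) × (ι → ℝ) | q.1.Reach a q.2.1} :=
    (measurable_fst.prodMk (measurable_fst.comp measurable_snd)) (measurableSet_reach a)
  have h2 : MeasurableSet {q : SplitTree ι × (ι → ℝ) × (ι → ℝ) | q.1.Reach a q.2.2} :=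
    (measurable_fst.prodMk (measurable_snd.comp measurable_snd)) (measurableSet_reach a)
  exact MeasurableSet.iff h1 h2

/-! ### Regular trees -/

open Classical in
/-- Regularity at an inner node, given by its address. -/
lemma IsRegular.children {s : ℕ} {α : ℝ} {κ : ℕ} {x : Fin s → ι → ℝ} {T : SplitTree ι}
    {A : Finset (Fin s)} (hT : T.IsRegular α κ x A) {a : List Bool} (ha : T.IsSplit a) (c : Bool) :
    α * (A.filter fun i => T.Reach a (x i)).card ≤
      (A.filter fun i => T.Reach (a ++ [c]) (x i)).card := by
  induction a generalizing T A with
  | nil =>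
    cases T with
    | leaf => simp [IsSplit, label] at ha
    | node l t L R =>
      cases c
      · convert hT.2.1 using 3
        · simp
        · simp [Reach]
      · convert hT.1 using 3
        · simp
        · simp [Reach]
  | cons b a ih =>
    cases T with
    | leaf => simp [IsSplit, label] at ha
    | node l t L R =>
      cases b
      · have e (b : List Bool) : (A.filter fun i => (node l t L R).Reach (false :: b) (x i)) =
            (A.filter fun i => t < x i l).filter fun i => R.Reach b (x i) := by
          ext i
          rw [Finset.mem_filter, Finset.mem_filter, Finset.mem_filter, and_assoc]
          rfl
        rw [List.cons_append, e, e]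
        exact ih hT.2.2.2 ha
      · have e (b : List Bool) : (A.filter fun i => (node l t L R).Reach (true :: b) (x i)) =
            (A.filter fun i => x i l ≤ t).filter fun i => L.Reach b (x i) := by
          ext i
          rw [Finset.mem_filter, Finset.mem_filter, Finset.mem_filter, and_assoc]
          rfl
        rw [List.cons_append, e, e]
        exact ih hT.2.2.1 ha

/-- A node is split if the regularity of the splits above it forces it to contain at least `2 * κ`
points. -/
lemma IsRegular.isSplit [Nonempty ι] {s : ℕ} {α : ℝ} (hα0 : 0 ≤ α) (hα1 : α ≤ 1) {κ : ℕ}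
    (hκ : 1 ≤ κ) {x : Fin s → ι → ℝ} {T : SplitTree ι}
    {A : Finset (Fin s)} (hT : T.IsRegular α κ x A) {a : List Bool}
    (ha : 2 * κ ≤ α ^ a.length * A.card) : T.IsSplit a := by
  induction a generalizing T A with
  | nil =>
    cases T with
    | leaf =>
      have h1 := hT.2 inferInstance
      have h2 : 2 * κ ≤ A.card := by
        have : (2 * κ : ℝ) ≤ A.card := by simpa using ha
        exact_mod_cast this
      omega
    | node l t L R => exact ⟨l, t, rfl⟩
  | cons b a ih =>
    have hpow : α ^ a.length * (α * A.card) = α ^ (b :: a).length * A.card := by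
      rw [List.length_cons, pow_succ]; ring
    cases T with
    | leaf =>
      have h1 := hT.2 inferInstance
      have h2 : 2 * κ ≤ A.card := by
        have : (2 * κ : ℝ) ≤ A.card :=
          ha.trans (mul_le_of_le_one_left (Nat.cast_nonneg _) (pow_le_one₀ hα0 hα1))
        exact_mod_cast this
      omega
    | node l t L R =>
      cases b
      · exact ih hT.2.2.2 (ha.trans (hpow ▸ mul_le_mul_of_nonneg_left hT.2.1 (pow_nonneg hα0 _)))
      · exact ih hT.2.2.1 (ha.trans (hpow ▸ mul_le_mul_of_nonneg_left hT.1 (pow_nonneg hα0 _)))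

open Classical in
lemma IsRegular.le_card_cell {s : ℕ} {α : ℝ} {κ : ℕ} {x : Fin s → ι → ℝ} {T : SplitTree ι}
    {A : Finset (Fin s)} (hT : T.IsRegular α κ x A) (y : ι → ℝ) :
    κ ≤ (A.filter fun i => x i ∈ T.cell y).card := by
  induction T generalizing A with
  | leaf => simpa [cell] using hT.1
  | node l t L R ihL ihR =>
    rcases le_or_gt (y l) t with h | h
    · refine (ihL hT.2.2.1).trans (le_of_eq ?_)
      rw [Finset.filter_filter]
      congr 1; ext i; simp [cell, h, h.not_gt]
    · refine (ihR hT.2.2.2).trans (le_of_eq ?_)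
      rw [Finset.filter_filter]
      congr 1; ext i; simp [cell, h, h.not_ge]

/-! ### Bracketing the cells by a grid -/

/-- For a discretization `c` of the real line, the points that pass through a given node are
bracketed by two sets that only depend on the discretized coordinates. These sets differ only by
points in the slabs, one for each split above the node, that contain a threshold; each slab has a
mass of at most `η`. -/
lemma exists_bracket {K : Type*} [LinearOrder K] {c : ℝ → K} (hc : Monotone c)
    (Q : Measure (ι → ℝ)) {η : ENNReal} (hη : ∀ l k, Q {x | c (x l) = k} ≤ η) (T : SplitTree ι)
    (a : List Bool) :
    ∃ U V : Set (ι → K), U ⊆ V ∧ (∀ x, (fun l => c (x l)) ∈ U → T.Reach a x) ∧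
      (∀ x, T.Reach a x → (fun l => c (x l)) ∈ V) ∧
      Q {x | (fun l => c (x l)) ∈ V \ U} ≤ a.length * η := by
  induction a generalizing T with
  | nil => exact ⟨Set.univ, Set.univ, subset_rfl, by simp, by simp, by simp⟩
  | cons b a ih =>
    cases T with
    | leaf => exact ⟨∅, ∅, subset_rfl, by simp, by simp [Reach], by simp⟩
    | node l t L R =>
      have key (U V : Set (ι → K)) (S S' : Set (ι → K)) (hS : S' \ S ⊆ {k | k l = c t})
          (h : Q {x | (fun l => c (x l)) ∈ V \ U} ≤ a.length * η) :
          Q {x | (fun l => c (x l)) ∈ (V ∩ S') \ (U ∩ S)} ≤ (b :: a).length * η := by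
        calc Q {x | (fun l => c (x l)) ∈ (V ∩ S') \ (U ∩ S)}
            ≤ Q ({x | (fun l => c (x l)) ∈ V \ U} ∪ {x | c (x l) = c t}) := by
              refine measure_mono fun x hx => ?_
              by_cases hU : (fun l => c (x l)) ∈ U
              · exact Or.inr (hS ⟨hx.1.2, fun h' => hx.2 ⟨hU, h'⟩⟩)
              · exact Or.inl ⟨hx.1.1, hU⟩
          _ ≤ a.length * η + η := (measure_union_le _ _).trans (add_le_add h (hη l _))
          _ = (b :: a).length * η := by simp [add_mul]
      cases b
      · obtain ⟨U, V, hUV, hU, hV, h⟩ := ih R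
        refine ⟨U ∩ {k | c t < k l}, V ∩ {k | c t ≤ k l},
          Set.inter_subset_inter hUV fun k hk => le_of_lt hk, fun x hx => ⟨?_, hU x hx.1⟩,
          fun x hx => ⟨hV x hx.2, hc hx.1.le⟩, key U V _ _ ?_ h⟩
        · exact lt_of_not_ge fun h' => (hc h').not_gt hx.2
        · exact fun k hk => le_antisymm (not_lt.1 hk.2) hk.1
      · obtain ⟨U, V, hUV, hU, hV, h⟩ := ih L
        refine ⟨U ∩ {k | k l < c t}, V ∩ {k | k l ≤ c t},
          Set.inter_subset_inter hUV fun k hk => le_of_lt hk, fun x hx => ⟨?_, hU x hx.1⟩,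
          fun x hx => ⟨hV x hx.2, hc hx.1⟩, key U V _ _ ?_ h⟩
        · exact le_of_not_gt fun h' => (hc h'.le).not_gt hx.2
        · exact fun k hk => le_antisymm hk.1 (not_lt.1 hk.2)

end SplitTree

/-! ### Averages of pairwise independent bounded vectors -/

lemma sq_integral_le_integral_sq {Ω : Type*} [MeasurableSpace Ω] {P : Measure Ω}
    [IsProbabilityMeasure P] {X : Ω → ℝ} (hX : MemLp X 2 P) :
    (∫ ω, X ω ∂P) ^ 2 ≤ ∫ ω, X ω ^ 2 ∂P := by
  have h := variance_nonneg X P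
  rw [variance_eq_sub hX] at h
  simpa using h

/-- The `L¹` weak law of large numbers with its rate: the terms of the average are a bounded
function of pairwise independent random elements with the same law. -/
lemma integral_norm_average_sub_le {Ω 𝒯 J H : Type*} [MeasurableSpace Ω] [MeasurableSpace 𝒯]
    [NormedAddCommGroup H] [InnerProductSpace ℝ H] [CompleteSpace H] {P : Measure Ω}
    [IsProbabilityMeasure P] {ν : Measure 𝒯} {S : Finset J} (hS : S.Nonempty) {ζ : J → Ω → 𝒯}
    (hζ : ∀ i, Measurable (ζ i)) (hlaw : ∀ i, P.map (ζ i) = ν)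
    (hind : ∀ i ∈ S, ∀ j ∈ S, i ≠ j → IndepFun (ζ i) (ζ j) P) {h : 𝒯 → H}
    (hh : StronglyMeasurable h) {B : ℝ} (hB : ∀ t, ‖h t‖ ≤ B) :
    ∫ ω, ‖(S.card : ℝ)⁻¹ • ∑ i ∈ S, h (ζ i ω) - ∫ t, h t ∂ν‖ ∂P ≤ 2 * B / √S.card := by
  classical
  obtain ⟨i₀, hi₀⟩ := hS
  have hν : IsProbabilityMeasure ν :=
    hlaw i₀ ▸ Measure.isProbabilityMeasure_map (hζ i₀).aemeasurable
  have hB0 : 0 ≤ B := by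
    obtain ⟨t⟩ := nonempty_of_isProbabilityMeasure ν
    exact (norm_nonneg _).trans (hB t)
  have hN : (0 : ℝ) < S.card := by exact_mod_cast Finset.card_pos.2 ⟨i₀, hi₀⟩
  set c := ∫ t, h t ∂ν with hc
  have hhint : Integrable h ν :=
    Integrable.of_bound hh.aestronglyMeasurable B (ae_of_all _ hB)
  have hcB : ‖c‖ ≤ B := by
    simpa using norm_integral_le_of_norm_le_const (μ := ν) (ae_of_all _ hB)
  set g : 𝒯 → H := fun t => h t - c
  have hg : StronglyMeasurable g := hh.sub stronglyMeasurable_const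
  have hgB (t : 𝒯) : ‖g t‖ ≤ 2 * B := by
    have := norm_sub_le (h t) c
    linarith [hB t]
  have hgint : Integrable g ν :=
    Integrable.of_bound hg.aestronglyMeasurable _ (ae_of_all _ hgB)
  have hg0 : ∫ t, g t ∂ν = 0 := by
    simp only [g]
    rw [integral_sub hhint (integrable_const _)]
    simp [hc]
  have hgζ (i : J) : StronglyMeasurable fun ω => g (ζ i ω) := hg.comp_measurable (hζ i)
  have hg0' (i : J) : ∫ ω, g (ζ i ω) ∂P = 0 := by
    rw [← hg0, ← hlaw i, integral_map (hζ i).aemeasurable hg.aestronglyMeasurable]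
  -- the cross terms vanish by independence
  have hinner (i j : J) (hi : i ∈ S) (hj : j ∈ S) :
      ∫ ω, inner ℝ (g (ζ i ω)) (g (ζ j ω)) ∂P ≤ if i = j then (2 * B) ^ 2 else 0 := by
    split_ifs with hij
    · subst hij
      have : ∀ ω, inner ℝ (g (ζ i ω)) (g (ζ i ω)) ≤ (2 * B) ^ 2 := fun ω => by
        rw [real_inner_self_eq_norm_sq]
        exact pow_le_pow_left₀ (norm_nonneg _) (hgB _) 2
      calc ∫ ω, inner ℝ (g (ζ i ω)) (g (ζ i ω)) ∂P ≤ ∫ _, (2 * B) ^ 2 ∂P :=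
            integral_mono_of_nonneg (ae_of_all _ fun ω => real_inner_self_nonneg)
              (integrable_const _) (ae_of_all _ this)
        _ = (2 * B) ^ 2 := by simp
    · refine le_of_eq ?_
      have := (hind i hi j hj hij).integral_bilin_comp_comp (hζ i).aemeasurable (hζ j).aemeasurable
        (f := g) (g := g) (by rwa [hlaw i]) (by rwa [hlaw j]) (innerSL ℝ)
      exact this.trans (by simp [hg0'])
  have hinnerint (i j : J) : Integrable (fun ω => inner ℝ (g (ζ i ω)) (g (ζ j ω))) P := by
    refine Integrable.of_bound ((hgζ i).inner (hgζ j)).aestronglyMeasurable ((2 * B) * (2 * B))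
      (ae_of_all _ fun ω => ?_)
    exact (norm_inner_le_norm _ _).trans
      (mul_le_mul (hgB _) (hgB _) (norm_nonneg _) (by positivity))
  set f : Ω → H := fun ω => (S.card : ℝ)⁻¹ • ∑ i ∈ S, g (ζ i ω)
  have hf : StronglyMeasurable f :=
    (Finset.stronglyMeasurable_fun_sum S fun i _ => hgζ i).const_smul _
  have hfB (ω : Ω) : ‖f ω‖ ≤ 2 * B := by
    have : ‖∑ i ∈ S, g (ζ i ω)‖ ≤ S.card * (2 * B) := by
      simpa using norm_sum_le_of_le S fun i _ => hgB (ζ i ω)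
    simp only [f]
    rw [norm_smul, norm_inv, Real.norm_natCast, inv_mul_le_iff₀ hN]
    exact this
  have heq (ω : Ω) : (S.card : ℝ)⁻¹ • ∑ i ∈ S, h (ζ i ω) - c = f ω := by
    simp only [f, g, Finset.sum_sub_distrib, Finset.sum_const, smul_sub]
    rw [← Nat.cast_smul_eq_nsmul ℝ, smul_smul, inv_mul_cancel₀ hN.ne', one_smul]
  have hsq (ω : Ω) : ‖f ω‖ ^ 2 =
      ((S.card : ℝ)⁻¹) ^ 2 * ∑ i ∈ S, ∑ j ∈ S, inner ℝ (g (ζ i ω)) (g (ζ j ω)) := by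
    simp only [f]
    rw [norm_smul, mul_pow, ← real_inner_self_eq_norm_sq (∑ i ∈ S, g (ζ i ω)), sum_inner]
    simp only [inner_sum, norm_inv, Real.norm_natCast]
  have h2 : ∫ ω, ‖f ω‖ ^ 2 ∂P ≤ (2 * B / √S.card) ^ 2 := by
    simp only [hsq]
    rw [integral_const_mul, integral_finsetSum _ fun i _ =>
      integrable_finsetSum _ fun j _ => hinnerint i j]
    have : ∑ i ∈ S, ∫ ω, ∑ j ∈ S, inner ℝ (g (ζ i ω)) (g (ζ j ω)) ∂P ≤ S.card * (2 * B) ^ 2 := by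
      rw [← nsmul_eq_mul]
      refine Finset.sum_le_card_nsmul _ _ _ fun i hi => ?_
      rw [integral_finsetSum _ fun j _ => hinnerint i j]
      refine (Finset.sum_le_sum fun j hj => hinner i j hi hj).trans ?_
      simp [hi]
    calc ((S.card : ℝ)⁻¹) ^ 2 * _ ≤ ((S.card : ℝ)⁻¹) ^ 2 * (S.card * (2 * B) ^ 2) := by gcongr
      _ = (2 * B / √S.card) ^ 2 := by
        rw [div_pow, Real.sq_sqrt hN.le]; field_simp
  simp only [heq]
  have hL : MemLp (fun ω => ‖f ω‖) 2 P :=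
    MemLp.of_bound hf.norm.aestronglyMeasurable (2 * B) (ae_of_all _ fun ω => by simpa using hfB ω)
  exact abs_le_of_sq_le_sq' ((sq_integral_le_integral_sq hL).trans h2) (by positivity) |>.2

/-! ### Complete U-statistics -/

lemma card_orderEmb (s n : ℕ) : Fintype.card (Fin s ↪o Fin n) = n.choose s := by
  have h := Fintype.card_finset_len (α := Fin n) s
  rw [Fintype.card_fin] at h
  rw [← h]
  refine Fintype.card_congr
    { toFun := fun f => ⟨Finset.univ.map f.toEmbedding, by simp⟩
      invFun := fun S => S.1.orderEmbOfFin S.2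
      left_inv := fun f => ?_
      right_inv := fun S => ?_ }
  · ext1 i
    refine (congrFun (Finset.orderEmbOfFin_unique _ (f := f) (fun x => ?_) f.strictMono) i).symm
    simp
  · ext i
    simp

/-- The increasing enumeration of the range of an injective map, as a permuted version of it. -/
lemma exists_orderEmb_perm {s n : ℕ} (f : Fin s ↪ Fin n) :
    ∃ (g : Fin s ↪o Fin n) (σ : Equiv.Perm (Fin s)), ∀ i, f i = g (σ i) := by
  have hcard : (Finset.univ.map f).card = s := by simp
  let g := (Finset.univ.map f).orderEmbOfFin hcard
  have hmem (i : Fin s) : ∃ k, g k = f i := by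
    have : f i ∈ Set.range g := by
      rw [Finset.range_orderEmbOfFin]; simp
    exact this
  choose σ hσ using hmem
  have hinj : Function.Injective σ := fun i j hij => f.injective (by rw [← hσ, ← hσ, hij])
  exact ⟨g, Equiv.ofBijective σ (Finite.injective_iff_bijective.1 hinj), fun i => (hσ i).symm⟩

/-- Hoeffding's representation: a complete U-statistic is the average, over all the permutations
of the sample, of the kernel evaluated at one fixed subsample. -/
lemma average_orderEmb_eq_average_perm {V : Type*} [AddCommGroup V] [Module ℝ V] {s n : ℕ}
    (F : (Fin s ↪ Fin n) → V)
    (hF : ∀ (f : Fin s ↪ Fin n) (σ : Equiv.Perm (Fin s)), F (σ.toEmbedding.trans f) = F f)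
    (b : Fin s ↪ Fin n) :
    ((n.choose s : ℕ) : ℝ)⁻¹ • ∑ f : Fin s ↪o Fin n, F f.toEmbedding =
      ((n.factorial : ℕ) : ℝ)⁻¹ • ∑ τ : Equiv.Perm (Fin n), F (b.trans τ.toEmbedding) := by
  have hsn : s ≤ n := by simpa using Fintype.card_le_of_embedding b
  -- the sum over the permutations does not depend on the subsample
  have h1 (f : Fin s ↪o Fin n) : ∑ τ : Equiv.Perm (Fin n), F (f.toEmbedding.trans τ.toEmbedding) =
      ∑ τ : Equiv.Perm (Fin n), F (b.trans τ.toEmbedding) := by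
    obtain ⟨ρ, hρ⟩ : ∃ ρ : Equiv.Perm (Fin n), ∀ i, ρ (f i) = b i :=
      Equiv.Perm.exists_extending_pair f b f.injective b.injective
    rw [← Equiv.sum_comp (Equiv.mulRight ρ)]
    refine Finset.sum_congr rfl fun τ _ => congrArg F ?_
    ext i
    simp [hρ]
  -- a permutation of the sample permutes the subsamples
  have h2 (τ : Equiv.Perm (Fin n)) :
      ∑ f : Fin s ↪o Fin n, F (f.toEmbedding.trans τ.toEmbedding) =
        ∑ f : Fin s ↪o Fin n, F f.toEmbedding := by
    choose g σ hg using fun f : Fin s ↪o Fin n =>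
      exists_orderEmb_perm (f.toEmbedding.trans τ.toEmbedding)
    have hinj : Function.Injective g := by
      intro f f' hff
      have hr (f : Fin s ↪o Fin n) : Set.range (g f) = τ '' Set.range f := by
        ext y
        simp only [Set.mem_range, Set.mem_image, exists_exists_eq_and]
        constructor
        · rintro ⟨i, rfl⟩
          exact ⟨(σ f).symm i, by simpa using hg f ((σ f).symm i)⟩
        · rintro ⟨i, rfl⟩
          exact ⟨σ f i, (hg f i).symm⟩
      have : Set.range f = Set.range f' :=
        τ.injective.image_injective (by rw [← hr, ← hr, hff])
      exact OrderEmbedding.range_inj.1 this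
    rw [← Equiv.sum_comp (Equiv.ofBijective g (Finite.injective_iff_bijective.1 hinj))
      (fun f => F f.toEmbedding)]
    refine Finset.sum_congr rfl fun f _ => ?_
    rw [Equiv.ofBijective_apply, ← hF (g f).toEmbedding (σ f)]
    refine congrArg F ?_
    ext i
    exact congrArg Fin.val (hg f i)
  have h3 : (n.factorial : ℝ) • ∑ f : Fin s ↪o Fin n, F f.toEmbedding =
      (n.choose s : ℝ) • ∑ τ : Equiv.Perm (Fin n), F (b.trans τ.toEmbedding) := by
    calc (n.factorial : ℝ) • ∑ f : Fin s ↪o Fin n, F f.toEmbedding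
        = ∑ τ : Equiv.Perm (Fin n), ∑ f : Fin s ↪o Fin n,
            F (f.toEmbedding.trans τ.toEmbedding) := by
          simp only [h2, Finset.sum_const, Finset.card_univ, Fintype.card_perm, Fintype.card_fin,
            Nat.cast_smul_eq_nsmul]
      _ = ∑ f : Fin s ↪o Fin n, ∑ τ : Equiv.Perm (Fin n),
            F (f.toEmbedding.trans τ.toEmbedding) := Finset.sum_comm
      _ = (n.choose s : ℝ) • ∑ τ : Equiv.Perm (Fin n), F (b.trans τ.toEmbedding) := by
          simp only [h1, Finset.sum_const, Finset.card_univ, card_orderEmb,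
            Nat.cast_smul_eq_nsmul]
  have hn0 : (n.factorial : ℝ) ≠ 0 := by exact_mod_cast n.factorial_ne_zero
  have hc0 : (n.choose s : ℝ) ≠ 0 := by exact_mod_cast (Nat.choose_pos hsn).ne'
  rw [inv_smul_eq_iff₀ hc0, smul_comm, ← h3, inv_smul_smul₀ hn0]

/-! ### The tree estimate as a weighted mean -/

namespace TreeProcedure

variable {E : Type*} [MeasurableSpace E] {ι : Type*} {d s : ℕ}

instance (A : TreeProcedure E ι d s) : IsProbabilityMeasure A.law := A.isProb

open Classical in
/-- The weight of the observation `i` in the tree estimate at `x`. -/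
def leafWeight (A : TreeProcedure E ι d s) (x : ι → ℝ) (e : E)
    (z : Fin s → (ι → ℝ) × (Fin d → ℝ)) (i : Fin s) : ℝ :=
  if i ∈ A.leafPoints x e z then ((A.leafPoints x e z).card : ℝ)⁻¹ else 0

variable (A : TreeProcedure E ι d s)

lemma leafWeight_nonneg (x : ι → ℝ) (e : E) (z : Fin s → (ι → ℝ) × (Fin d → ℝ)) (i : Fin s) :
    0 ≤ A.leafWeight x e z i := by
  unfold leafWeight
  split_ifs <;> positivity

lemma sum_leafWeight {x : ι → ℝ} {e : E} {z : Fin s → (ι → ℝ) × (Fin d → ℝ)}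
    (h : (A.leafPoints x e z).Nonempty) : ∑ i, A.leafWeight x e z i = 1 := by
  have : ((A.leafPoints x e z).card : ℝ) ≠ 0 := by exact_mod_cast h.card_pos.ne'
  simp [leafWeight, this]

lemma sum_leafWeight_le (x : ι → ℝ) (e : E) (z : Fin s → (ι → ℝ) × (Fin d → ℝ)) :
    ∑ i, A.leafWeight x e z i ≤ 1 := by
  rcases (A.leafPoints x e z).eq_empty_or_nonempty with h | h
  · simp [leafWeight, h]
  · exact (A.sum_leafWeight h).le

lemma leafWeight_le_one (x : ι → ℝ) (e : E) (z : Fin s → (ι → ℝ) × (Fin d → ℝ)) (i : Fin s) :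
    A.leafWeight x e z i ≤ 1 :=
  (Finset.single_le_sum (fun j _ => A.leafWeight_nonneg x e z j) (Finset.mem_univ i)).trans
    (A.sum_leafWeight_le x e z)

lemma mem_est_of_leafWeight_ne_zero {x : ι → ℝ} {e : E} {z : Fin s → (ι → ℝ) × (Fin d → ℝ)}
    {i : Fin s} (h : A.leafWeight x e z i ≠ 0) :
    i ∈ A.est e ∧ (z i).1 ∈ (A.grow e z).cell x := by
  unfold leafWeight at h
  split_ifs at h with hi
  · simpa [leafPoints] using hi
  · exact absurd rfl h

/-- A weighted average of vectors of norm at most `B` has norm at most `B`. -/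
lemma norm_sum_leafWeight_smul_le {H : Type*} [NormedAddCommGroup H] [NormedSpace ℝ H] {B : ℝ}
    (x : ι → ℝ) (e : E) (z : Fin s → (ι → ℝ) × (Fin d → ℝ)) (hB0 : 0 ≤ B) {v : Fin s → H}
    (hv : ∀ i, A.leafWeight x e z i ≠ 0 → ‖v i‖ ≤ B) :
    ‖∑ i, A.leafWeight x e z i • v i‖ ≤ B := by
  calc ‖∑ i, A.leafWeight x e z i • v i‖ ≤ ∑ i, A.leafWeight x e z i * B := by
        refine norm_sum_le_of_le _ fun i _ => ?_
        rw [norm_smul, Real.norm_of_nonneg (A.leafWeight_nonneg x e z i)]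
        by_cases h : A.leafWeight x e z i = 0
        · simp [h]
        · exact mul_le_mul_of_nonneg_left (hv i h) (A.leafWeight_nonneg x e z i)
    _ ≤ B := by
        rw [← Finset.sum_mul]
        exact mul_le_of_le_one_left hB0 (A.sum_leafWeight_le x e z)

section Measurability

lemma measurableSet_mem_est (i : Fin s) : MeasurableSet {e | i ∈ A.est e} := by
  have : {e | i ∈ A.est e} = ⋃ S ∈ {S : Finset (Fin s) | i ∈ S}, A.est ⁻¹' {S} := by
    ext e; simp
  rw [this]
  exact MeasurableSet.biUnion (Set.to_countable _) fun S _ => A.measurable_est S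

variable [Countable ι]

lemma measurableSet_leafPoints_eq (S : Finset (Fin s)) :
    MeasurableSet {q : E × (Fin s → (ι → ℝ) × (Fin d → ℝ)) × (ι → ℝ) |
      A.leafPoints q.2.2 q.1 q.2.1 = S} := by
  have : {q : E × (Fin s → (ι → ℝ) × (Fin d → ℝ)) × (ι → ℝ) |
      A.leafPoints q.2.2 q.1 q.2.1 = S} = ⋂ i, {q | (i ∈ A.est q.1 ∧
        (q.2.1 i).1 ∈ (A.grow q.1 q.2.1).cell q.2.2) ↔ i ∈ S} := by
    ext q
    simp [Finset.ext_iff, leafPoints]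
  rw [this]
  refine MeasurableSet.iInter fun i => MeasurableSet.iff (MeasurableSet.inter ?_ ?_) (by simp)
  · exact measurable_fst (A.measurableSet_mem_est i)
  · have hm : Measurable fun q : E × (Fin s → (ι → ℝ) × (Fin d → ℝ)) × (ι → ℝ) =>
        (A.grow q.1 q.2.1, q.2.2, (q.2.1 i).1) :=
      (A.measurable_grow.comp (measurable_fst.prodMk (measurable_fst.comp measurable_snd))).prodMk
        (by fun_prop)
    exact hm SplitTree.measurableSet_mem_cell

lemma measurable_leafWeight (i : Fin s) :
    Measurable fun q : E × (Fin s → (ι → ℝ) × (Fin d → ℝ)) × (ι → ℝ) =>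
      A.leafWeight q.2.2 q.1 q.2.1 i := by
  let _ : MeasurableSpace (Finset (Fin s)) := ⊤
  have h : Measurable fun q : E × (Fin s → (ι → ℝ) × (Fin d → ℝ)) × (ι → ℝ) =>
      A.leafPoints q.2.2 q.1 q.2.1 :=
    measurable_to_countable' fun S => A.measurableSet_leafPoints_eq S
  classical
  exact (measurable_from_top (f := fun S : Finset (Fin s) =>
    if i ∈ S then ((S.card : ℕ) : ℝ)⁻¹ else 0)).comp h

end Measurability

variable {H : Type*} [NormedAddCommGroup H] [InnerProductSpace ℝ H] [CompleteSpace H]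
    [RKHS ℝ H (Fin d → ℝ) ℝ]

lemma output_eq_sum (x : ι → ℝ) (e : E) (z : Fin s → (ι → ℝ) × (Fin d → ℝ)) :
    A.output H x e z = ∑ i, A.leafWeight x e z i • kernelFeature H (z i).2 := by
  classical
  simp [output, leafWeight, ite_smul, Finset.sum_ite_mem]

lemma norm_output_le {B : ℝ} (hB0 : 0 ≤ B) (hB : ∀ y, ‖kernelFeature H (𝒴 := Fin d → ℝ) y‖ ≤ B)
    (x : ι → ℝ) (e : E) (z : Fin s → (ι → ℝ) × (Fin d → ℝ)) : ‖A.output H x e z‖ ≤ B := by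
  rw [output_eq_sum]
  exact A.norm_sum_leafWeight_smul_le x e z hB0 fun i _ => hB _

variable (H) in
/-- The expectation of the tree estimate over the tree randomness. -/
def treeMean (x : ι → ℝ) (z : Fin s → (ι → ℝ) × (Fin d → ℝ)) : H :=
  ∫ e, A.output H x e z ∂A.law

lemma norm_treeMean_le {B : ℝ} (hB0 : 0 ≤ B)
    (hB : ∀ y, ‖kernelFeature H (𝒴 := Fin d → ℝ) y‖ ≤ B)
    (x : ι → ℝ) (z : Fin s → (ι → ℝ) × (Fin d → ℝ)) : ‖A.treeMean H x z‖ ≤ B := by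
  simpa [treeMean] using norm_integral_le_of_norm_le_const (μ := A.law)
    (ae_of_all _ fun e => A.norm_output_le hB0 hB x e z)

lemma norm_forest_le {B : ℝ} (hB0 : 0 ≤ B)
    (hB : ∀ y, ‖kernelFeature H (𝒴 := Fin d → ℝ) y‖ ≤ B) {n : ℕ}
    (z : Fin n → (ι → ℝ) × (Fin d → ℝ)) (x : ι → ℝ) : ‖A.forest H z x‖ ≤ B := by
  have h : ‖∑ i : Fin s ↪o Fin n, ∫ e, A.output H x e (fun r => z (i r)) ∂A.law‖ ≤
      n.choose s * B := by
    refine (norm_sum_le_of_le _ fun i _ =>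
      A.norm_treeMean_le (H := H) hB0 hB x (fun r => z (i r))).trans ?_
    simp [card_orderEmb]
  rw [forest, norm_smul, norm_inv, Real.norm_natCast]
  rcases (n.choose s).eq_zero_or_pos with h0 | h0
  · simp [h0, hB0]
  · rw [inv_mul_le_iff₀ (by exact_mod_cast h0)]
    exact h

section Measurability

variable [Countable ι]

lemma stronglyMeasurable_output
    (hφ : StronglyMeasurable (kernelFeature H : (Fin d → ℝ) → H)) :
    StronglyMeasurable fun q : E × (Fin s → (ι → ℝ) × (Fin d → ℝ)) × (ι → ℝ) =>
      A.output H q.2.2 q.1 q.2.1 := by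
  simp only [output_eq_sum]
  refine Finset.stronglyMeasurable_fun_sum _ fun i _ => ?_
  exact (A.measurable_leafWeight i).stronglyMeasurable.smul (hφ.comp_measurable (by fun_prop))

lemma stronglyMeasurable_treeMean
    (hφ : StronglyMeasurable (kernelFeature H : (Fin d → ℝ) → H)) :
    StronglyMeasurable fun q : (Fin s → (ι → ℝ) × (Fin d → ℝ)) × (ι → ℝ) =>
      A.treeMean H q.2 q.1 := by
  have h : StronglyMeasurable
      fun q : ((Fin s → (ι → ℝ) × (Fin d → ℝ)) × (ι → ℝ)) × E => A.output H q.1.2 q.2 q.1.1 :=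
    (A.stronglyMeasurable_output hφ).comp_measurable
      (g := fun q : ((Fin s → (ι → ℝ) × (Fin d → ℝ)) × (ι → ℝ)) × E => (q.2, q.1)) (by fun_prop)
  exact h.integral_prod_right'

lemma stronglyMeasurable_forest (hφ : StronglyMeasurable (kernelFeature H : (Fin d → ℝ) → H))
    {n : ℕ} :
    StronglyMeasurable fun q : (Fin n → (ι → ℝ) × (Fin d → ℝ)) × (ι → ℝ) =>
      A.forest H q.1 q.2 := by
  refine StronglyMeasurable.const_smul (Finset.stronglyMeasurable_fun_sum _ fun i _ => ?_) _
  exact (A.stronglyMeasurable_treeMean hφ).comp_measurable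
    (g := fun q : (Fin n → (ι → ℝ) × (Fin d → ℝ)) × (ι → ℝ) => ((fun r => q.1 (i r)), q.2))
    (by fun_prop)

/-- The mean over the tree randomness inherits the symmetry of the law of the output. -/
lemma Symmetric.treeMean_comp (hA : A.Symmetric H)
    (hφ : StronglyMeasurable (kernelFeature H : (Fin d → ℝ) → H))
    {z : Fin s → (ι → ℝ) × (Fin d → ℝ)} (hz : GeneralPosition fun i => (z i).1)
    (σ : Equiv.Perm (Fin s)) (x : ι → ℝ) :
    A.treeMean H x (fun i => z (σ i)) = A.treeMean H x z := by
  borelize H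
  have hm (z : Fin s → (ι → ℝ) × (Fin d → ℝ)) :
      StronglyMeasurable fun e => A.output H x e z :=
    (A.stronglyMeasurable_output hφ).comp_measurable (g := fun e => (e, z, x)) (by fun_prop)
  have hint (z : Fin s → (ι → ℝ) × (Fin d → ℝ)) :
      Integrable (fun e => A.output H x e z) A.law := by
    refine ⟨(hm z).aestronglyMeasurable, ?_⟩
    refine HasFiniteIntegral.of_bounded (C := ∑ i, ‖kernelFeature H (z i).2‖)
      (ae_of_all _ fun e => ?_)
    rw [output_eq_sum]
    refine A.norm_sum_leafWeight_smul_le x e z (by positivity) fun i _ => ?_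
    exact Finset.single_le_sum (f := fun i => ‖kernelFeature H (z i).2‖)
      (fun j _ => norm_nonneg _) (Finset.mem_univ i)
  have hlaw : A.law.map (fun e => A.output H x e (fun i => z (σ i))) =
      A.law.map (fun e => A.output H x e z) := by
    ext S hS
    rw [Measure.map_apply (hm _).measurable hS, Measure.map_apply (hm _).measurable hS]
    exact hA z hz σ x S hS
  refine ext_inner_right ℝ fun v => ?_
  have hv (z : Fin s → (ι → ℝ) × (Fin d → ℝ)) : inner ℝ (A.treeMean H x z) v =
      ∫ w, inner ℝ w v ∂(A.law.map fun e => A.output H x e z) := by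
    have hc : Continuous fun w : H => inner ℝ w v := by fun_prop
    rw [integral_map (hm z).measurable.aemeasurable
      hc.measurable.stronglyMeasurable.aestronglyMeasurable, treeMean,
      real_inner_comm, ← integral_inner (hint z)]
    simp only [real_inner_comm]
  rw [hv, hv, hlaw]

end Measurability

end TreeProcedure

/-! ### Subsamples of an i.i.d. sample -/

section Subsamples

variable {𝒵 : Type*} [MeasurableSpace 𝒵] (Q : Measure 𝒵) [IsProbabilityMeasure Q] {s n : ℕ}

lemma map_eval_pi_const {J : Type*} [Fintype J] (i : J) :
    (Measure.pi fun _ : J => Q).map (fun z => z i) = Q :=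
  (measurePreserving_eval (fun _ : J => Q) i).map_eq

lemma iIndepFun_eval {J : Type*} [Fintype J] :
    iIndepFun (fun (i : J) (z : J → 𝒵) => z i) (Measure.pi fun _ : J => Q) :=
  iIndepFun_pi (X := fun _ => id) fun _ => aemeasurable_id

lemma map_subsample (f : Fin s ↪ Fin n) :
    (Measure.pi fun _ : Fin n => Q).map (fun z i => z (f i)) = Measure.pi fun _ : Fin s => Q := by
  have h := ((iIndepFun_eval Q (J := Fin n)).precomp f.injective)
  rw [iIndepFun_iff_map_fun_eq_pi_map fun i => (measurable_pi_apply _).aemeasurable] at h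
  rw [h]
  simp only [map_eval_pi_const]

lemma indepFun_subsample (f g : Fin s ↪ Fin n) (hfg : ∀ i j, f i ≠ g j) :
    IndepFun (fun (z : Fin n → 𝒵) i => z (f i)) (fun z i => z (g i))
      (Measure.pi fun _ : Fin n => Q) := by
  have hd : Disjoint (Finset.univ.map f) (Finset.univ.map g) := by
    rw [Finset.disjoint_left]
    simp only [Finset.mem_map, Finset.mem_univ, true_and]
    rintro _ ⟨i, rfl⟩ ⟨j, hj⟩
    exact hfg i j hj.symm
  have h := (iIndepFun_eval Q (J := Fin n)).indepFun_finset _ _ hd fun i => measurable_pi_apply i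
  exact h.comp (φ := fun w i => w ⟨f i, by simp⟩) (ψ := fun w i => w ⟨g i, by simp⟩)
    (measurable_pi_lambda _ fun i => measurable_pi_apply _)
    (measurable_pi_lambda _ fun i => measurable_pi_apply _)

/-- The `k`-th of `n / s` disjoint blocks of `s` consecutive indices. -/
def blockEmb (s n : ℕ) (k : Fin (n / s)) : Fin s ↪ Fin n where
  toFun i := ⟨k * s + i, by
    have h1 : (k + 1) * s ≤ n := (Nat.mul_le_mul_right s k.2).trans (Nat.div_mul_le_self n s)
    have h2 := i.2
    rw [add_mul, one_mul] at h1
    omega⟩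
  inj' i j h := by
    simp only [Fin.mk.injEq, Nat.add_left_cancel_iff] at h
    exact Fin.ext h

lemma blockEmb_ne {k k' : Fin (n / s)} (h : k ≠ k') (i j : Fin s) :
    blockEmb s n k i ≠ blockEmb s n k' j := by
  intro he
  have he' : (k : ℕ) * s + i = k' * s + j := congrArg Fin.val he
  have hs : 0 < s := i.pos
  apply h
  ext
  have h1 : ((k : ℕ) * s + i) / s = k := by
    rw [mul_comm, Nat.mul_add_div hs, Nat.div_eq_of_lt i.2, add_zero]
  have h2 : ((k' : ℕ) * s + j) / s = k' := by
    rw [mul_comm, Nat.mul_add_div hs, Nat.div_eq_of_lt j.2, add_zero]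
  rw [← h1, ← h2, he']

/-- The `L¹` concentration of a complete U-statistic, whose kernel `h` is symmetric and bounded by
`B`, around its mean: the effective sample size is the number `n / s` of disjoint subsamples. -/
lemma integral_norm_ustat_sub_le {H : Type*} [NormedAddCommGroup H] [InnerProductSpace ℝ H]
    [CompleteSpace H] {h : (Fin s → 𝒵) → H} (hh : StronglyMeasurable h) {B : ℝ}
    (hB : ∀ z, ‖h z‖ ≤ B)
    (hsymm : ∀ᵐ z ∂(Measure.pi fun _ : Fin n => Q), ∀ (f : Fin s ↪ Fin n)
      (σ : Equiv.Perm (Fin s)), h (fun i => z (f (σ i))) = h (fun i => z (f i)))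
    (hsn : 0 < n / s) :
    ∫ z, ‖((n.choose s : ℕ) : ℝ)⁻¹ • ∑ f : Fin s ↪o Fin n, h (fun i => z (f i)) -
        ∫ z', h z' ∂(Measure.pi fun _ : Fin s => Q)‖ ∂(Measure.pi fun _ : Fin n => Q) ≤
      2 * B / √(n / s : ℕ) := by
  set c := ∫ z', h z' ∂(Measure.pi fun _ : Fin s => Q)
  have hm0 : ((n / s : ℕ) : ℝ) ≠ 0 := by exact_mod_cast hsn.ne'
  have hn0 : ((n.factorial : ℕ) : ℝ) ≠ 0 := by exact_mod_cast n.factorial_ne_zero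
  have hB0 : 0 ≤ B := by
    obtain ⟨z⟩ := nonempty_of_isProbabilityMeasure (Measure.pi fun _ : Fin s => Q)
    exact (norm_nonneg _).trans (hB z)
  -- the average over the disjoint blocks, for the sample permuted by `τ`
  let W (τ : Equiv.Perm (Fin n)) (z : Fin n → 𝒵) : H :=
    (Finset.card (Finset.univ : Finset (Fin (n / s))) : ℝ)⁻¹ •
      ∑ k : Fin (n / s), h (fun i => z (τ (blockEmb s n k i)))
  have hW (τ : Equiv.Perm (Fin n)) : StronglyMeasurable (W τ) :=
    (Finset.stronglyMeasurable_fun_sum _ fun k _ =>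
      hh.comp_measurable (by fun_prop)).const_smul _
  have hWint (τ : Equiv.Perm (Fin n)) :
      Integrable (fun z => ‖W τ z - c‖) (Measure.pi fun _ : Fin n => Q) := by
    refine (Integrable.sub (Integrable.of_bound (hW τ).aestronglyMeasurable B
      (ae_of_all _ fun z => ?_)) (integrable_const c)).norm
    have : ‖∑ k : Fin (n / s), h (fun i => z (τ (blockEmb s n k i)))‖ ≤ (n / s : ℕ) * B := by
      simpa using norm_sum_le_of_le Finset.univ fun k (_ : k ∈ Finset.univ) =>
        hB (fun i => z (τ (blockEmb s n k i)))
    simp only [W, norm_smul, norm_inv, Real.norm_natCast, Finset.card_univ, Fintype.card_fin]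
    rw [inv_mul_le_iff₀ (by positivity)]
    exact this
  have hWle (τ : Equiv.Perm (Fin n)) :
      ∫ z, ‖W τ z - c‖ ∂(Measure.pi fun _ : Fin n => Q) ≤ 2 * B / √(n / s : ℕ) := by
    have := integral_norm_average_sub_le (P := Measure.pi fun _ : Fin n => Q)
      (S := (Finset.univ : Finset (Fin (n / s))))
      (ζ := fun k (z : Fin n → 𝒵) i => z (((blockEmb s n k).trans τ.toEmbedding) i))
      (ν := Measure.pi fun _ : Fin s => Q)
      ⟨⟨0, hsn⟩, Finset.mem_univ _⟩ (fun k => by fun_prop) (fun k => map_subsample Q _)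
      (fun k _ k' _ hk => indepFun_subsample Q _ _ fun i j => by
        simpa using blockEmb_ne hk i j) hh hB
    simpa [W] using this
  have hU : ∀ᵐ z ∂(Measure.pi fun _ : Fin n => Q),
      ‖((n.choose s : ℕ) : ℝ)⁻¹ • ∑ f : Fin s ↪o Fin n, h (fun i => z (f i)) - c‖ ≤
        (n.factorial : ℝ)⁻¹ * ∑ τ : Equiv.Perm (Fin n), ‖W τ z - c‖ := by
    filter_upwards [hsymm] with z hz
    have hrep (k : Fin (n / s)) :=
      average_orderEmb_eq_average_perm (fun f : Fin s ↪ Fin n => h (fun i => z (f i)))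
        (fun f σ => hz f σ) (blockEmb s n k)
    have hrep' : ((n.choose s : ℕ) : ℝ)⁻¹ • ∑ f : Fin s ↪o Fin n, h (fun i => z (f i)) =
        (n.factorial : ℝ)⁻¹ • ∑ τ : Equiv.Perm (Fin n), W τ z := by
      have := Finset.sum_congr rfl fun k (_ : k ∈ (Finset.univ : Finset (Fin (n / s)))) => hrep k
      rw [Finset.sum_const, Finset.card_univ, Fintype.card_fin, ← Nat.cast_smul_eq_nsmul ℝ,
        ← Finset.smul_sum, Finset.sum_comm] at this
      simp only [W, Finset.card_univ, Fintype.card_fin]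
      rw [← Finset.smul_sum, smul_comm]
      exact (eq_inv_smul_iff₀ hm0).2 this
    have hc : c = (n.factorial : ℝ)⁻¹ • ∑ τ : Equiv.Perm (Fin n), c := by
      rw [Finset.sum_const, Finset.card_univ, Fintype.card_perm, Fintype.card_fin,
        ← Nat.cast_smul_eq_nsmul ℝ, inv_smul_smul₀ hn0]
    rw [hrep']
    nth_rewrite 1 [hc]
    rw [← smul_sub, ← Finset.sum_sub_distrib, norm_smul, norm_inv, Real.norm_natCast]
    gcongr
    exact norm_sum_le _ _
  calc _ ≤ ∫ z, (n.factorial : ℝ)⁻¹ * ∑ τ : Equiv.Perm (Fin n), ‖W τ z - c‖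
        ∂(Measure.pi fun _ : Fin n => Q) :=
        integral_mono_of_nonneg (ae_of_all _ fun z => norm_nonneg _)
          ((integrable_finsetSum _ fun τ _ => hWint τ).const_mul _) hU
    _ = (n.factorial : ℝ)⁻¹ * ∑ τ : Equiv.Perm (Fin n),
          ∫ z, ‖W τ z - c‖ ∂(Measure.pi fun _ : Fin n => Q) := by
        rw [integral_const_mul, integral_finsetSum _ fun τ _ => hWint τ]
    _ ≤ (n.factorial : ℝ)⁻¹ * (n.factorial * (2 * B / √(n / s : ℕ))) := by
        gcongr
        refine (Finset.sum_le_card_nsmul _ _ _ fun τ _ => hWle τ).trans ?_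
        simp [Fintype.card_perm]
    _ = 2 * B / √(n / s : ℕ) := by field_simp

end Subsamples

/-! ### Input laws with bounded marginal densities -/

/-- `Q` is concentrated on the unit cube, and the slabs orthogonal to the coordinate axes have a
mass of at most `C` times their width. -/
structure SlabBounded {ι : Type*} (Q : Measure (ι → ℝ)) (C : ℝ) : Prop where
  nonneg : 0 ≤ C
  cube : ∀ᵐ x ∂Q, ∀ l, x l ∈ Set.Icc (0 : ℝ) 1
  slab : ∀ l a b, Q {x | x l ∈ Set.Icc a b} ≤ ENNReal.ofReal (C * (b - a))

lemma HasBoundedDensityOnCube.exists_slabBounded {ι : Type*} [Fintype ι] {Q : Measure (ι → ℝ)}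
    (hQ : HasBoundedDensityOnCube Q) : ∃ C, SlabBounded Q C := by
  classical
  obtain ⟨f, hf, ⟨c, C, hc, hcC⟩, rfl⟩ := hQ
  have hC : 0 ≤ C := by
    have h := hcC 0 ⟨le_rfl, zero_le_one⟩
    linarith
  refine ⟨C, hC, ?_, fun l a b => ?_⟩
  · refine (withDensity_absolutelyContinuous _ _).ae_le ?_
    filter_upwards [ae_restrict_mem measurableSet_Icc] with x hx l
    exact ⟨hx.1 l, hx.2 l⟩
  · have hS : MeasurableSet {x : ι → ℝ | x l ∈ Set.Icc a b} :=
      measurable_pi_apply l measurableSet_Icc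
    rw [withDensity_apply _ hS, Measure.restrict_restrict hS]
    calc ∫⁻ x in {x : ι → ℝ | x l ∈ Set.Icc a b} ∩ Set.Icc 0 1, ENNReal.ofReal (f x)
        ≤ ∫⁻ _ in {x : ι → ℝ | x l ∈ Set.Icc a b} ∩ Set.Icc 0 1, ENNReal.ofReal C := by
          refine setLIntegral_mono measurable_const fun x hx => ?_
          exact ENNReal.ofReal_le_ofReal (hcC x hx.2).2
      _ = ENNReal.ofReal C * volume ({x : ι → ℝ | x l ∈ Set.Icc a b} ∩ Set.Icc 0 1) := by
          rw [setLIntegral_const]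
      _ ≤ ENNReal.ofReal C *
          volume (Set.univ.pi fun k : ι => if k = l then Set.Icc a b else Set.Icc (0 : ℝ) 1) := by
          gcongr
          rintro x ⟨hx1, hx2⟩ k -
          by_cases h : k = l
          · subst h; simpa using hx1
          · simpa [h] using ⟨hx2.1 k, hx2.2 k⟩
      _ = ENNReal.ofReal (C * (b - a)) := by
          rw [volume_pi_pi, ENNReal.ofReal_mul hC]
          congr 1
          rw [Finset.prod_eq_single l (by intro k _ hk; simp [hk]) (by simp)]
          simp

/-- Dropping coordinates preserves the bound on the slabs. -/
lemma SlabBounded.map_dropVar {p : ℕ} {Q : Measure (Fin p → ℝ)} {C : ℝ} (hQ : SlabBounded Q C)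
    (j : Fin p) : SlabBounded (Q.map (dropVar j)) C := by
  have hm : Measurable (dropVar j) := measurable_pi_lambda _ fun l => measurable_pi_apply _
  refine ⟨hQ.nonneg, ?_, fun l a b => ?_⟩
  · refine (ae_map_iff hm.aemeasurable ?_).2 ?_
    · have : {x : {l : Fin p // l ≠ j} → ℝ | ∀ l, x l ∈ Set.Icc (0 : ℝ) 1} =
          ⋂ l, {x | x l ∈ Set.Icc (0 : ℝ) 1} := by ext; simp
      rw [this]
      exact MeasurableSet.iInter fun l => measurable_pi_apply l measurableSet_Icc
    · filter_upwards [hQ.cube] with x hx l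
      exact hx l
  · have hS : MeasurableSet {x : {l : Fin p // l ≠ j} → ℝ | x l ∈ Set.Icc a b} :=
      measurable_pi_apply l measurableSet_Icc
    rw [Measure.map_apply hm hS]
    exact hQ.slab l a b

section GeneralPosition

variable {ι 𝒴 : Type*} [MeasurableSpace 𝒴] {Q : Measure ((ι → ℝ) × 𝒴)} [IsProbabilityMeasure Q]
  {C : ℝ}

lemma ae_cube (hQ : SlabBounded Q.fst C) {J : Type*} [Fintype J] :
    ∀ᵐ z ∂(Measure.pi fun _ : J => Q), ∀ i l, (z i).1 l ∈ Set.Icc (0 : ℝ) 1 := by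
  rw [ae_all_iff]
  intro i
  have h1 : ∀ᵐ q ∂Q, ∀ l, q.1 l ∈ Set.Icc (0 : ℝ) 1 :=
    ae_of_ae_map measurable_fst.aemeasurable hQ.cube
  exact (measurePreserving_eval (fun _ : J => Q) i).quasiMeasurePreserving.ae h1

/-- An i.i.d. sample is almost surely in general position. -/
lemma ae_generalPosition [Countable ι] (hQ : SlabBounded Q.fst C) {s : ℕ} :
    ∀ᵐ z ∂(Measure.pi fun _ : Fin s => Q), GeneralPosition fun i => (z i).1 := by
  have htie (l : ι) (i j : Fin s) (hij : i ≠ j) :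
      ∀ᵐ z ∂(Measure.pi fun _ : Fin s => Q), (z i).1 l ≠ (z j).1 l := by
    have hml : Measurable fun q : (ι → ℝ) × 𝒴 => q.1 l := by fun_prop
    have hind := ((iIndepFun_eval Q (J := Fin s)).indepFun hij).comp hml hml
    have hmi (i : Fin s) : Measurable ((fun q : (ι → ℝ) × 𝒴 => q.1 l) ∘ fun z : Fin s → _ => z i) :=
      hml.comp (measurable_pi_apply i)
    rw [indepFun_iff_map_prod_eq_prod_map_map (hmi i).aemeasurable (hmi j).aemeasurable] at hind
    have hlaw : (Measure.pi fun _ : Fin s => Q).map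
        ((fun q : (ι → ℝ) × 𝒴 => q.1 l) ∘ fun z : Fin s → _ => z j) = Q.map fun q => q.1 l := by
      rw [← Measure.map_map hml (measurable_pi_apply j), map_eval_pi_const]
    have hD : MeasurableSet {q : ℝ × ℝ | q.1 = q.2} :=
      measurableSet_eq_fun measurable_fst measurable_snd
    have h0 : (Measure.pi fun _ : Fin s => Q).map (fun z => ((z i).1 l, (z j).1 l))
        {q : ℝ × ℝ | q.1 = q.2} = 0 := by
      refine (congrArg (fun μ : Measure (ℝ × ℝ) => μ {q : ℝ × ℝ | q.1 = q.2}) hind).trans ?_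
      have := Measure.isProbabilityMeasure_map (μ := Measure.pi fun _ : Fin s => Q)
        (hmi j).aemeasurable
      rw [Measure.measure_prod_null hD]
      refine ae_of_all _ fun u => ?_
      beta_reduce
      rw [hlaw, Measure.map_apply hml (measurable_prodMk_left hD)]
      have h1 : (fun q : (ι → ℝ) × 𝒴 => q.1 l) ⁻¹' (Prod.mk u ⁻¹' {q : ℝ × ℝ | q.1 = q.2}) =
          Prod.fst ⁻¹' {x : ι → ℝ | x l ∈ Set.Icc u u} := by
        ext q; simp [eq_comm]
      have h2 := hQ.slab l u u
      have hS : MeasurableSet {x : ι → ℝ | x l ∈ Set.Icc u u} :=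
        measurable_pi_apply l measurableSet_Icc
      rw [Measure.fst_apply hS] at h2
      rw [h1]
      exact le_antisymm (h2.trans (by simp)) bot_le
    rw [Measure.map_apply (by fun_prop) hD] at h0
    exact measure_eq_zero_iff_ae_notMem.1 h0
  have h : ∀ᵐ z ∂(Measure.pi fun _ : Fin s => Q), ∀ l i j, i ≠ j → (z i).1 l ≠ (z j).1 l := by
    simp only [ae_all_iff]
    exact htie
  filter_upwards [h, ae_cube hQ] with z hz hz'
  exact ⟨hz', fun l i j hij => by_contra fun hne => hz l i j hne hij⟩

end GeneralPosition

lemma GeneralPosition.comp {ι : Type*} {s n : ℕ} {x : Fin n → ι → ℝ} (hx : GeneralPosition x)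
    (f : Fin s ↪ Fin n) : GeneralPosition fun i => x (f i) :=
  ⟨fun i l => hx.1 (f i) l, fun l => (hx.2 l).comp f.injective⟩

/-! ### The discrepancy between a law and a sample on a grid -/

/-- The index in `{0, …, G}` of the grid interval of width `1 / G` that contains `u ∈ [0, 1]`: the
index `k` stands for `((k - 1) / G, k / G]`, and `0` for the origin alone. -/
def gridIndex (G : ℕ) (u : ℝ) : Fin (G + 1) :=
  ⟨min G ⌈G * u⌉₊, Nat.lt_succ_of_le (min_le_left _ _)⟩

lemma monotone_gridIndex (G : ℕ) : Monotone (gridIndex G) := fun u v huv => by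
  refine Fin.mk_le_mk.2 (min_le_min le_rfl (Nat.ceil_mono ?_))
  exact mul_le_mul_of_nonneg_left huv (Nat.cast_nonneg G)

lemma SlabBounded.measure_gridIndex_le {ι : Type*} {Q : Measure (ι → ℝ)} {C : ℝ}
    (hQ : SlabBounded Q C) {G : ℕ} (hG : 0 < G) (l : ι) (k : Fin (G + 1)) :
    Q {x | gridIndex G (x l) = k} ≤ ENNReal.ofReal (C / G) := by
  have hG' : (0 : ℝ) < G := by exact_mod_cast hG
  have h := hQ.slab l ((k - 1) / G) (k / G)
  have e : (k / G - (k - 1) / G : ℝ) = 1 / G := by ring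
  rw [e, mul_one_div] at h
  refine le_trans (measure_mono_ae ?_) h
  filter_upwards [hQ.cube] with x hx hxk
  have hx0 : 0 ≤ G * x l := mul_nonneg hG'.le (hx l).1
  have hle : ⌈G * x l⌉₊ ≤ G := by
    rw [Nat.ceil_le]
    exact mul_le_of_le_one_right hG'.le (hx l).2
  have hk : ((k : ℕ) : ℝ) = ⌈G * x l⌉₊ := by
    have hxk' : gridIndex G (x l) = k := hxk
    rw [← hxk']
    simp [gridIndex, hle]
  change x l ∈ Set.Icc (((k : ℕ) - 1) / G : ℝ) ((k : ℕ) / G)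
  constructor
  · rw [div_le_iff₀ hG', hk]
    have := Nat.ceil_lt_add_one hx0
    linarith
  · rw [le_div_iff₀ hG', hk, mul_comm]
    exact Nat.le_ceil _

section Discrepancy

variable {ι : Type*} {s : ℕ}

open Classical in
/-- The fraction of the sample points `x i`, `i ∈ S`, that lie in `D`. -/
def empFreq (S : Finset (Fin s)) (x : Fin s → ι → ℝ) (D : Set (ι → ℝ)) : ℝ :=
  (S.card : ℝ)⁻¹ * (S.filter fun i => x i ∈ D).card

lemma empFreq_mono (S : Finset (Fin s)) (x : Fin s → ι → ℝ) {D D' : Set (ι → ℝ)} (h : D ⊆ D') :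
    empFreq S x D ≤ empFreq S x D' := by
  unfold empFreq
  gcongr

lemma empFreq_nonneg (S : Finset (Fin s)) (x : Fin s → ι → ℝ) (D : Set (ι → ℝ)) :
    0 ≤ empFreq S x D := by
  unfold empFreq; positivity

lemma empFreq_le_one (S : Finset (Fin s)) (x : Fin s → ι → ℝ) (D : Set (ι → ℝ)) :
    empFreq S x D ≤ 1 := by
  unfold empFreq
  rcases S.card.eq_zero_or_pos with h | h
  · simp [h]
  · classical
    rw [inv_mul_le_iff₀ (by exact_mod_cast h), mul_one]
    exact_mod_cast Finset.card_filter_le _ _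

lemma empFreq_eq_average (S : Finset (Fin s)) (x : Fin s → ι → ℝ) (D : Set (ι → ℝ)) :
    empFreq S x D = (S.card : ℝ)⁻¹ • ∑ i ∈ S, D.indicator (fun _ => (1 : ℝ)) (x i) := by
  classical
  simp [empFreq, Set.indicator_apply]

lemma measurable_empFreq (S : Finset (Fin s)) {D : Set (ι → ℝ)} (hD : MeasurableSet D) :
    Measurable fun x : Fin s → ι → ℝ => empFreq S x D := by
  simp only [empFreq_eq_average]
  have h (i : Fin s) : Measurable fun x : Fin s → ι → ℝ => D.indicator (fun _ => (1 : ℝ)) (x i) :=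
    (measurable_const.indicator hD).comp (measurable_pi_apply i)
  exact (Finset.measurable_fun_sum S fun i _ => h i).const_smul (S.card : ℝ)⁻¹

lemma measurable_gridIndex_comp (G : ℕ) :
    Measurable fun (x : ι → ℝ) (l : ι) => gridIndex G (x l) :=
  measurable_pi_lambda _ fun l => (monotone_gridIndex G).measurable.comp (measurable_pi_apply l)

lemma abs_measureReal_sub_empFreq_le_one (Q : Measure (ι → ℝ)) [IsProbabilityMeasure Q]
    (S : Finset (Fin s)) (x : Fin s → ι → ℝ) (D : Set (ι → ℝ)) :
    |Q.real D - empFreq S x D| ≤ 1 := by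
  rw [abs_le]
  constructor <;>
    linarith [empFreq_nonneg S x D, empFreq_le_one S x D, measureReal_nonneg (μ := Q) (s := D),
      measureReal_le_one (μ := Q) (s := D)]

section Empirical

variable {𝒴 : Type*} [MeasurableSpace 𝒴] (Q : Measure ((ι → ℝ) × 𝒴)) [IsProbabilityMeasure Q]

lemma integrable_abs_measureReal_sub_empFreq (S : Finset (Fin s)) {D : Set (ι → ℝ)}
    (hD : MeasurableSet D) :
    Integrable (fun z : Fin s → (ι → ℝ) × 𝒴 => |Q.fst.real D - empFreq S (fun i => (z i).1) D|)
      (Measure.pi fun _ : Fin s => Q) := by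
  have hm : Measurable fun z : Fin s → (ι → ℝ) × 𝒴 => fun i => (z i).1 := by fun_prop
  refine Integrable.of_bound ?_ 1 (ae_of_all _ fun z => ?_)
  · exact (measurable_const.sub ((measurable_empFreq S hD).comp hm)).abs.aestronglyMeasurable
  · rw [Real.norm_eq_abs, abs_abs]
    exact abs_measureReal_sub_empFreq_le_one _ _ _ _

lemma integral_abs_measureReal_sub_empFreq_le {S : Finset (Fin s)} (hS : S.Nonempty)
    {D : Set (ι → ℝ)} (hD : MeasurableSet D) :
    ∫ z, |Q.fst.real D - empFreq S (fun i => (z i).1) D| ∂(Measure.pi fun _ : Fin s => Q) ≤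
      2 / √S.card := by
  have hDm : Measurable fun q : (ι → ℝ) × 𝒴 => D.indicator (fun _ => (1 : ℝ)) q.1 :=
    (measurable_const.indicator hD).comp measurable_fst
  have h := integral_norm_average_sub_le (P := Measure.pi fun _ : Fin s => Q) (ν := Q) hS
    (ζ := fun i z => z i) (fun i => measurable_pi_apply i) (fun i => map_eval_pi_const Q i)
    (fun i _ j _ hij => (iIndepFun_eval Q).indepFun hij) hDm.stronglyMeasurable (B := 1)
    (fun q => by by_cases hq : q.1 ∈ D <;> simp [hq])
  have hmean : ∫ q, D.indicator (fun _ => (1 : ℝ)) q.1 ∂Q = Q.fst.real D := by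
    have hD' : MeasurableSet (Prod.fst ⁻¹' D : Set ((ι → ℝ) × 𝒴)) := measurable_fst hD
    have e : (fun q : (ι → ℝ) × 𝒴 => D.indicator (fun _ => (1 : ℝ)) q.1) =
        (Prod.fst ⁻¹' D).indicator 1 := by
      ext q; rfl
    rw [e, integral_indicator_one hD', measureReal_def, measureReal_def, Measure.fst_apply hD]
  rw [hmean, mul_one] at h
  refine (le_of_eq ?_).trans h
  refine integral_congr_ae (ae_of_all _ fun z => ?_)
  beta_reduce
  rw [empFreq_eq_average, Real.norm_eq_abs, abs_sub_comm]

end Empirical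

variable [Fintype ι] [DecidableEq ι]

/-- The total deviation between the masses that `Q` and the sample points `x i`, `i ∈ S`, give to
the cells of the grid of width `1 / G`. -/
def gridDiscrepancy (Q : Measure (ι → ℝ)) (G : ℕ) (S : Finset (Fin s)) (x : Fin s → ι → ℝ) : ℝ :=
  ∑ k : ι → Fin (G + 1), |Q.real ((fun x l => gridIndex G (x l)) ⁻¹' {k}) -
    empFreq S x ((fun x l => gridIndex G (x l)) ⁻¹' {k})|

lemma gridDiscrepancy_nonneg (Q : Measure (ι → ℝ)) (G : ℕ) (S : Finset (Fin s))
    (x : Fin s → ι → ℝ) : 0 ≤ gridDiscrepancy Q G S x :=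
  Finset.sum_nonneg fun _ _ => abs_nonneg _

lemma gridDiscrepancy_le (Q : Measure (ι → ℝ)) [IsProbabilityMeasure Q] (G : ℕ)
    (S : Finset (Fin s)) (x : Fin s → ι → ℝ) :
    gridDiscrepancy Q G S x ≤ Fintype.card (ι → Fin (G + 1)) := by
  exact (Finset.sum_le_card_nsmul _ _ 1 fun k _ =>
    abs_measureReal_sub_empFreq_le_one Q S x _).trans (by simp)

lemma measurable_gridDiscrepancy (Q : Measure (ι → ℝ)) (G : ℕ) (S : Finset (Fin s)) :
    Measurable fun x : Fin s → ι → ℝ => gridDiscrepancy Q G S x := by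
  unfold gridDiscrepancy
  refine Finset.measurable_fun_sum _ fun k _ => ?_
  exact (measurable_const.sub (measurable_empFreq S
    (measurable_gridIndex_comp G (MeasurableSet.singleton k)))).abs

/-- The deviation on any union of grid cells. -/
lemma abs_measure_sub_empFreq_le (Q : Measure (ι → ℝ)) [IsProbabilityMeasure Q] (G : ℕ)
    (S : Finset (Fin s)) (x : Fin s → ι → ℝ) (U : Set (ι → Fin (G + 1))) :
    |Q.real ((fun x l => gridIndex G (x l)) ⁻¹' U) -
      empFreq S x ((fun x l => gridIndex G (x l)) ⁻¹' U)| ≤ gridDiscrepancy Q G S x := by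
  classical
  set q : (ι → ℝ) → ι → Fin (G + 1) := fun x l => gridIndex G (x l)
  have h1 : Q.real (q ⁻¹' U) = ∑ k with k ∈ U, Q.real (q ⁻¹' {k}) := by
    rw [sum_measureReal_preimage_singleton _
      fun k _ => measurable_gridIndex_comp G (MeasurableSet.singleton k)]
    congr 1; ext; simp [q]
  have h2 : empFreq S x (q ⁻¹' U) = ∑ k with k ∈ U, empFreq S x (q ⁻¹' {k}) := by
    simp only [empFreq_eq_average, ← Finset.smul_sum]
    rw [Finset.sum_comm]
    refine congrArg _ (Finset.sum_congr rfl fun i _ => ?_)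
    simp [Set.indicator_apply]
  rw [h1, h2, ← Finset.sum_sub_distrib]
  refine (Finset.abs_sum_le_sum_abs _ _).trans ?_
  exact Finset.sum_le_sum_of_subset_of_nonneg (Finset.subset_univ _) fun _ _ _ => abs_nonneg _

/-- The deviation between the mass and the frequency of the points that pass through a given node
is controlled uniformly over all the trees, since only few grid cells are cut by the splits above
the node. -/
lemma abs_measure_reach_sub_empFreq_le {Q : Measure (ι → ℝ)} [IsProbabilityMeasure Q] {C : ℝ}
    (hQ : SlabBounded Q C) {G : ℕ} (hG : 0 < G) (S : Finset (Fin s)) (x : Fin s → ι → ℝ)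
    (T : SplitTree ι) (a : List Bool) :
    |Q.real {x | T.Reach a x} - empFreq S x {x | T.Reach a x}| ≤
      gridDiscrepancy Q G S x + a.length * (C / G) := by
  obtain ⟨U, V, hUV, hU, hV, h⟩ := SplitTree.exists_bracket (monotone_gridIndex G) Q
    (fun l k => hQ.measure_gridIndex_le hG l k) T a
  set q : (ι → ℝ) → ι → Fin (G + 1) := fun x l => gridIndex G (x l)
  have hU' : q ⁻¹' U ⊆ {x | T.Reach a x} := fun x hx => hU x hx
  have hV' : {x | T.Reach a x} ⊆ q ⁻¹' V := fun x hx => hV x hx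
  have hCG : 0 ≤ C / G := div_nonneg hQ.nonneg (Nat.cast_nonneg _)
  have h' : Q.real (q ⁻¹' (V \ U)) ≤ a.length * (C / G) := by
    refine ENNReal.toReal_le_of_le_ofReal (by positivity) (h.trans (le_of_eq ?_))
    rw [ENNReal.ofReal_mul (by positivity), ENNReal.ofReal_natCast]
  have hdiff : Q.real (q ⁻¹' V) = Q.real (q ⁻¹' U) + Q.real (q ⁻¹' (V \ U)) := by
    have := measureReal_sdiff_add_inter (μ := Q) (s := q ⁻¹' V) (t := q ⁻¹' U)
      (measurable_gridIndex_comp G (Set.toFinite U).measurableSet)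
    rw [← Set.preimage_sdiff, ← Set.preimage_inter, Set.inter_eq_right.2 hUV] at this
    linarith
  have e1 := abs_le.1 (abs_measure_sub_empFreq_le Q G S x U)
  have e2 := abs_le.1 (abs_measure_sub_empFreq_le Q G S x V)
  have m1 : Q.real (q ⁻¹' U) ≤ _ := measureReal_mono hU'
  have m2 : _ ≤ Q.real (q ⁻¹' V) := measureReal_mono hV'
  have m3 := empFreq_mono S x hU'
  have m4 := empFreq_mono S x hV'
  rw [abs_le]
  constructor <;> linarith

/-- For an i.i.d. sample, the discrepancy on a fixed grid vanishes as the size of the sample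
grows. -/
lemma integral_gridDiscrepancy_le {𝒴 : Type*} [MeasurableSpace 𝒴] (Q : Measure ((ι → ℝ) × 𝒴))
    [IsProbabilityMeasure Q] (G : ℕ) {S : Finset (Fin s)} (hS : S.Nonempty) :
    ∫ z, gridDiscrepancy Q.fst G S (fun i => (z i).1) ∂(Measure.pi fun _ : Fin s => Q) ≤
      Fintype.card (ι → Fin (G + 1)) * (2 / √S.card) := by
  have hcell (k : ι → Fin (G + 1)) :
      MeasurableSet ((fun (x : ι → ℝ) l => gridIndex G (x l)) ⁻¹' {k}) :=
    measurable_gridIndex_comp G (MeasurableSet.singleton k)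
  unfold gridDiscrepancy
  rw [integral_finsetSum _ fun k _ => integrable_abs_measureReal_sub_empFreq Q S (hcell k)]
  exact (Finset.sum_le_card_nsmul _ _ (2 / √S.card) fun k _ =>
    integral_abs_measureReal_sub_empFreq_le Q hS (hcell k)).trans (by simp)

end Discrepancy

/-! ### The widths of the cells at a fixed depth -/

namespace SplitTree

variable {ι : Type*} (l : ι)

/-- The width along the feature `l` of the cell of the node at the address `a`, within the unit
cube. -/
def width (a : List Bool) (T : SplitTree ι) : ℝ :=
  volume.real (Set.Icc (0 : ℝ) 1 ∩ {u | T.Admits l a u})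

lemma width_nonneg (a : List Bool) (T : SplitTree ι) : 0 ≤ T.width l a := measureReal_nonneg

lemma width_le_one (a : List Bool) (T : SplitTree ι) : T.width l a ≤ 1 := by
  have : volume.real (Set.Icc (0 : ℝ) 1 ∩ {u | T.Admits l a u}) ≤ volume.real (Set.Icc (0 : ℝ) 1) :=
    measureReal_mono Set.inter_subset_left (by simp)
  simpa [width] using this

lemma abs_sub_le_width {a : List Bool} {T : SplitTree ι} {x y : ι → ℝ}
    (hx : x l ∈ Set.Icc (0 : ℝ) 1) (hy : y l ∈ Set.Icc (0 : ℝ) 1)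
    (hxa : T.Reach a x) (hya : T.Reach a y) : |x l - y l| ≤ T.width l a := by
  wlog h : x l ≤ y l generalizing x y
  · rw [abs_sub_comm]
    exact this hy hx hya hxa (not_le.1 h).le
  have hsub : Set.Icc (x l) (y l) ⊆ Set.Icc (0 : ℝ) 1 ∩ {u | T.Admits l a u} := fun u hu =>
    ⟨⟨hx.1.trans hu.1, hu.2.trans hy.2⟩, (hxa.admits l).between (hya.admits l) hu.1 hu.2⟩
  have := measureReal_mono (μ := volume) hsub
    (measure_ne_top_of_subset Set.inter_subset_left (by simp))
  rw [Real.volume_real_Icc_of_le h] at this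
  rwa [abs_sub_comm, abs_of_nonneg (sub_nonneg.2 h)]

lemma measurable_width_history [Countable ι] (a : List Bool) :
    Measurable[history a] (width l a) := by
  have h1 : MeasurableSet[(history (ι := ι) a).prod Real.measurableSpace]
      {q : SplitTree ι × ℝ | q.2 ∈ Set.Icc (0 : ℝ) 1 ∧ q.1.Admits l a q.2} := by
    refine MeasurableSet.inter ?_ ?_
    · exact (@measurable_snd _ _ (history a) _) measurableSet_Icc
    · have := measurableSet_admits_history l a
      rwa [← BorelSpace.measurable_eq (α := ℝ)] at this
  exact (@measurable_measure_prodMk_left _ _ (history a) _ volume _ _ h1).ennreal_toReal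

lemma measurableSet_admits (a : List Bool) (T : SplitTree ι) :
    MeasurableSet {u | T.Admits l a u} :=
  Set.OrdConnected.measurableSet ⟨fun _ hu _ hv _ hw => hu.between hv hw.1 hw.2⟩

lemma measurableSet_setOf_reach [Countable ι] (a : List Bool) (T : SplitTree ι) :
    MeasurableSet {x | T.Reach a x} :=
  measurable_prodMk_left (measurableSet_reach a)

lemma measurable_measure_reach_history [Countable ι] (Q : Measure (ι → ℝ)) [SFinite Q]
    (a : List Bool) :
    Measurable[history a] fun T : SplitTree ι => Q.real {x | T.Reach a x} :=
  (@measurable_measure_prodMk_left _ _ (history a) _ Q _ _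
    (measurableSet_reach_history a)).ennreal_toReal

variable (Q : Measure (ι → ℝ))

/-- The contribution of the node at the address `a` to the mean width of the cells: the mass of its
cell times its width along the feature `l`. -/
def massWidth (a : List Bool) (T : SplitTree ι) : ℝ := Q.real {x | T.Reach a x} * T.width l a

lemma measurable_massWidth_history [Countable ι] [SFinite Q] (a : List Bool) :
    Measurable[history a] (massWidth l Q a) :=
  (measurable_measure_reach_history Q a).mul (measurable_width_history l a)

lemma measurable_massWidth [Countable ι] [SFinite Q] (a : List Bool) :
    Measurable (massWidth l Q a) :=
  (measurable_massWidth_history l Q a).mono (history_le a) le_rfl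

lemma massWidth_nonneg (a : List Bool) (T : SplitTree ι) : 0 ≤ massWidth l Q a T :=
  mul_nonneg measureReal_nonneg (width_nonneg l a T)

lemma massWidth_le_one [IsProbabilityMeasure Q] (a : List Bool) (T : SplitTree ι) :
    massWidth l Q a T ≤ 1 :=
  mul_le_one₀ measureReal_le_one (width_nonneg l a T) (width_le_one l a T)

lemma measure_reach_children [IsProbabilityMeasure Q] [Countable ι] {a : List Bool}
    {T : SplitTree ι} (ha : T.IsSplit a) :
    Q.real {x | T.Reach (a ++ [true]) x} + Q.real {x | T.Reach (a ++ [false]) x} =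
      Q.real {x | T.Reach a x} := by
  obtain ⟨l', t, hlt⟩ := ha
  rw [← measureReal_union _ (measurableSet_setOf_reach _ T)]
  · congr 1
    ext x
    simp only [reach_append_true_of_label hlt, reach_append_false_of_label hlt, Set.mem_union,
      Set.mem_ofPred_eq, ← and_or_left]
    exact and_iff_left (le_or_gt _ _)
  · rw [Set.disjoint_left]
    intro x hx hx'
    exact ((reach_append_true_of_label hlt x).1 hx).2.not_gt
      ((reach_append_false_of_label hlt x).1 hx').2

lemma width_children {a : List Bool} {T : SplitTree ι} (ha : T.SplitsAlong a l) :
    T.width l (a ++ [true]) + T.width l (a ++ [false]) = T.width l a := by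
  obtain ⟨t, hlt⟩ := ha
  unfold width
  rw [← measureReal_union _ (measurableSet_Icc.inter (measurableSet_admits l _ T))
    (measure_ne_top_of_subset Set.inter_subset_left (by simp))
    (measure_ne_top_of_subset Set.inter_subset_left (by simp)), ← Set.inter_union_distrib_left]
  · congr 2
    ext u
    simp only [admits_append_true_of_label hlt, admits_append_false_of_label hlt, Set.mem_union,
      Set.mem_ofPred_eq, ← and_or_left, true_imp_iff]
    exact and_iff_left (le_or_gt _ _)
  · rw [Set.disjoint_left]
    rintro u ⟨-, hu⟩ ⟨-, hu'⟩
    exact (((admits_append_true_of_label hlt l u).1 hu).2 rfl).not_gt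
      (((admits_append_false_of_label hlt l u).1 hu').2 rfl)

lemma width_child_le (a : List Bool) (c : Bool) (T : SplitTree ι) :
    T.width l (a ++ [c]) ≤ T.width l a := by
  refine measureReal_mono (Set.inter_subset_inter_right _ fun u hu => ?_)
    (measure_ne_top_of_subset Set.inter_subset_left (by simp))
  cases c
  · exact ((admits_append_false l T a u).1 hu).1
  · exact ((admits_append_true l T a u).1 hu).1

/-- A balanced split along the feature `l` reduces the mean width along `l` by a fixed factor, up
to an error `2 * δ`; a split along another feature does not increase it. -/
lemma massWidth_children_le [IsProbabilityMeasure Q] [Countable ι] {a : List Bool}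
    {T : SplitTree ι} (ha : T.IsSplit a) {α δ : ℝ} (hδ : 0 ≤ δ)
    (hbal : ∀ c, α * Q.real {x | T.Reach a x} - 2 * δ ≤ Q.real {x | T.Reach (a ++ [c]) x}) :
    massWidth l Q (a ++ [true]) T + massWidth l Q (a ++ [false]) T ≤
      massWidth l Q a T - α * {T | T.SplitsAlong a l}.indicator (massWidth l Q a) T + 2 * δ := by
  have hp := measure_reach_children Q ha
  have h1 := hbal true
  have h0 := hbal false
  have w1 := width_nonneg l (a ++ [true]) T
  have w0 := width_nonneg l (a ++ [false]) T
  have w1' := width_child_le l a true T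
  have w0' := width_child_le l a false T
  have hw := width_le_one l a T
  have hw0 := width_nonneg l a T
  have p1 := measureReal_nonneg (μ := Q) (s := {x | T.Reach (a ++ [true]) x})
  have p0 := measureReal_nonneg (μ := Q) (s := {x | T.Reach (a ++ [false]) x})
  have hmw : massWidth l Q a T = Q.real {x | T.Reach a x} * T.width l a := rfl
  have hcases : T.SplitsAlong a l ∨
      {T | T.SplitsAlong a l}.indicator (massWidth l Q a) T = 0 := by
    by_cases hl : T.SplitsAlong a l
    · exact Or.inl hl
    · exact Or.inr (Set.indicator_of_notMem (s := {T : SplitTree ι | T.SplitsAlong a l}) hl _)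
  have hgen : massWidth l Q (a ++ [true]) T + massWidth l Q (a ++ [false]) T =
    Q.real {x | T.Reach (a ++ [true]) x} * T.width l (a ++ [true]) +
      Q.real {x | T.Reach (a ++ [false]) x} * T.width l (a ++ [false]) := rfl
  rw [hgen]
  rcases hcases with hl | hl
  · have hi : {T | T.SplitsAlong a l}.indicator (massWidth l Q a) T = massWidth l Q a T :=
      Set.indicator_of_mem (s := {T : SplitTree ι | T.SplitsAlong a l}) hl _
    have hws := width_children l hl
    rw [hi, hmw]
    generalize Q.real {x | T.Reach (a ++ [true]) x} = q1 at *
    generalize Q.real {x | T.Reach (a ++ [false]) x} = q0 at *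
    generalize Q.real {x | T.Reach a x} = q at *
    generalize T.width l (a ++ [true]) = v1 at *
    generalize T.width l (a ++ [false]) = v0 at *
    generalize T.width l a = v at *
    subst hws hp
    -- the mass of each child is at most that of its parent minus the least mass of its sibling
    have e1 : q1 ≤ (q1 + q0) - α * (q1 + q0) + 2 * δ := by linarith
    have e0 : q0 ≤ (q1 + q0) - α * (q1 + q0) + 2 * δ := by linarith
    have e2 : 2 * δ * (v1 + v0) ≤ 2 * δ := mul_le_of_le_one_right (by linarith) hw
    linarith [mul_le_mul_of_nonneg_right e1 w1, mul_le_mul_of_nonneg_right e0 w0]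
  · rw [hl, hmw, ← hp, add_mul]
    linarith [mul_le_mul_of_nonneg_left w1' p1, mul_le_mul_of_nonneg_left w0' p0]

/-- The width along the feature `l` of the cell, `m` levels below the address `a`, that contains
`x` (and `0` if `x` does not pass through the address `a`). -/
def cellWidth : ℕ → List Bool → SplitTree ι → (ι → ℝ) → ℝ
  | 0, a, T, x => {x | T.Reach a x}.indicator (fun _ => T.width l a) x
  | m + 1, a, T, x => cellWidth m (a ++ [true]) T x + cellWidth m (a ++ [false]) T x

lemma cellWidth_nonneg (m : ℕ) (a : List Bool) (T : SplitTree ι) (x : ι → ℝ) :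
    0 ≤ cellWidth l m a T x := by
  induction m generalizing a with
  | zero => exact Set.indicator_nonneg (fun _ _ => width_nonneg l a T) x
  | succ m ih => exact add_nonneg (ih _) (ih _)

lemma cellWidth_le (m : ℕ) (a : List Bool) (T : SplitTree ι) (x : ι → ℝ) :
    cellWidth l m a T x ≤ 2 ^ m := by
  induction m generalizing a with
  | zero =>
    refine (Set.indicator_le_self' (fun _ _ => width_nonneg l a T) x).trans ?_
    simpa using width_le_one l a T
  | succ m ih =>
    have h1 := ih (a ++ [true])
    have h0 := ih (a ++ [false])
    simp only [cellWidth, pow_succ]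
    linarith

lemma measurable_cellWidth [Countable ι] (m : ℕ) (a : List Bool) :
    Measurable fun q : SplitTree ι × (ι → ℝ) => cellWidth l m a q.1 q.2 := by
  induction m generalizing a with
  | zero =>
    have h : (fun q : SplitTree ι × (ι → ℝ) => cellWidth l 0 a q.1 q.2) =
        {q : SplitTree ι × (ι → ℝ) | q.1.Reach a q.2}.indicator fun q => q.1.width l a := by
      ext q; rfl
    rw [h]
    exact (((measurable_width_history l a).mono (history_le a) le_rfl).comp
      measurable_fst).indicator (measurableSet_reach a)
  | succ m ih => exact (ih _).add (ih _)

lemma integrable_cellWidth [IsProbabilityMeasure Q] [Countable ι] (m : ℕ) (a : List Bool)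
    (T : SplitTree ι) :
    Integrable (cellWidth l m a T) Q :=
  Integrable.of_bound
    ((measurable_cellWidth l m a).comp measurable_prodMk_left).aestronglyMeasurable (2 ^ m)
    (ae_of_all _ fun x => by
      rw [Real.norm_of_nonneg (cellWidth_nonneg l m a T x)]
      exact cellWidth_le l m a T x)

lemma integral_cellWidth_zero [Countable ι] (a : List Bool) (T : SplitTree ι) :
    ∫ x, cellWidth l 0 a T x ∂Q = massWidth l Q a T := by
  simp only [cellWidth]
  rw [integral_indicator_const _ (measurableSet_setOf_reach a T)]
  rfl

/-- If all the nodes of depth less than `M` are split, then the points of a leaf are as close to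
each other as the width of their common cell at depth `M`. -/
lemma abs_sub_le_cellWidth {M m : ℕ} {a : List Bool} {T : SplitTree ι}
    (hT : ∀ b : List Bool, b.length < M → T.IsSplit b) (hm : a.length + m ≤ M) {x y : ι → ℝ}
    (hx : x l ∈ Set.Icc (0 : ℝ) 1) (hy : y l ∈ Set.Icc (0 : ℝ) 1) (hxy : y ∈ T.cell x)
    (hxa : T.Reach a x) : |x l - y l| ≤ cellWidth l m a T x := by
  induction m generalizing a with
  | zero =>
    have : cellWidth l 0 a T x = T.width l a := Set.indicator_of_mem (s := {x | T.Reach a x}) hxa _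
    rw [this]
    exact abs_sub_le_width l hx hy hxa (((mem_cell_iff T x y).1 hxy a).1 hxa)
  | succ m ih =>
    obtain ⟨l', t, hlt⟩ := hT a (by omega)
    simp only [cellWidth]
    rcases le_or_gt (x l') t with h | h
    · have := ih (a := a ++ [true]) (by simp; omega)
        ((reach_append_true T a x).2 ⟨hxa, l', t, hlt, h⟩)
      linarith [cellWidth_nonneg l m (a ++ [false]) T x]
    · have := ih (a := a ++ [false]) (by simp; omega)
        ((reach_append_false T a x).2 ⟨hxa, l', t, hlt, h⟩)
      linarith [cellWidth_nonneg l m (a ++ [true]) T x]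

end SplitTree

/-! ### The contraction of the cells of a random tree -/

section RandomTree

open SplitTree

variable {ι E : Type*} [MeasurableSpace E] {law : Measure E} [IsProbabilityMeasure law]
  {tree : E → SplitTree ι}

/-- The random split condition, for functions of the splits above the node instead of events. -/
lemma mul_integral_le_of_randomSplit (htree : Measurable tree) {a : List Bool} {l : ι} {r : ℝ}
    (hr : 0 ≤ r)
    (h : ∀ B, MeasurableSet[history a] B →
      ENNReal.ofReal r * law {e | tree e ∈ B ∧ (tree e).IsSplit a} ≤
        law {e | tree e ∈ B ∧ (tree e).SplitsAlong a l})
    (hsplit : ∀ᵐ e ∂law, (tree e).IsSplit a) {f : SplitTree ι → ℝ}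
    (hf : Measurable[history a] f) (hf0 : ∀ T, 0 ≤ f T) (hf1 : ∀ T, f T ≤ 1) :
    r * ∫ e, f (tree e) ∂law ≤
      ∫ e, {T | T.SplitsAlong a l}.indicator f (tree e) ∂law := by
  have hle := history_le (ι := ι) a
  have hfm : Measurable f := hf.mono hle le_rfl
  have hfs : StronglyMeasurable[history a] f := hf.stronglyMeasurable
  set ν := law.map tree
  have hν : IsProbabilityMeasure ν := Measure.isProbabilityMeasure_map htree.aemeasurable
  have hS : MeasurableSet {T : SplitTree ι | T.SplitsAlong a l} := measurableSet_splitsAlong a l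
  have hcomp : (ENNReal.ofReal r • ν).trim hle ≤
      (ν.restrict {T | T.SplitsAlong a l}).trim hle := by
    -- almost every tree splits the node, so the condition compares these measures on `B`
    refine Measure.le_iff.2 fun B hB => ?_
    rw [trim_measurableSet_eq hle hB, trim_measurableSet_eq hle hB,
      Measure.restrict_apply (hle _ hB), Measure.smul_apply, smul_eq_mul,
      Measure.map_apply htree (hle _ hB), Measure.map_apply htree ((hle _ hB).inter hS)]
    refine le_trans (le_of_eq ?_) (h B hB)
    congr 1
    refine measure_congr ?_
    filter_upwards [hsplit] with e he
    exact propext ⟨fun h => ⟨h, he⟩, fun h => h.1⟩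
  have hfin : IsFiniteMeasure (ν.restrict {T | T.SplitsAlong a l}) := inferInstance
  have hint : Integrable f (ν.restrict {T | T.SplitsAlong a l}) :=
    Integrable.of_bound hfm.aestronglyMeasurable 1 (ae_of_all _ fun T => by
      rw [Real.norm_of_nonneg (hf0 T)]; exact hf1 T)
  calc r * ∫ e, f (tree e) ∂law = ∫ T, f T ∂(ENNReal.ofReal r • ν) := by
        rw [integral_smul_measure, integral_map htree.aemeasurable hfm.aestronglyMeasurable,
          ENNReal.toReal_ofReal hr, smul_eq_mul]
    _ = ∫ T, f T ∂((ENNReal.ofReal r • ν).trim hle) :=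
        integral_trim hle hfs
    _ ≤ ∫ T, f T ∂((ν.restrict {T | T.SplitsAlong a l}).trim hle) :=
        integral_mono_measure hcomp (ae_of_all _ hf0) (hint.trim hle hfs)
    _ = ∫ T, f T ∂(ν.restrict {T | T.SplitsAlong a l}) :=
        (integral_trim hle (μ := ν.restrict {T | T.SplitsAlong a l}) (f := f) hfs).symm
    _ = ∫ e, {T | T.SplitsAlong a l}.indicator f (tree e) ∂law := by
        rw [← integral_indicator hS, integral_map htree.aemeasurable
          (hfm.indicator hS).aestronglyMeasurable]

/-- The mean width of the cells at depth `M` decays geometrically in `M`: this combines the random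
choice of the features with the balance of the splits, which holds up to an error `δ`. -/
lemma integral_cellWidth_le [Countable ι] {Q : Measure (ι → ℝ)} [IsProbabilityMeasure Q]
    (htree : Measurable tree) {l : ι} {r α : ℝ} (hr : 0 ≤ r) (hr1 : r ≤ 1) (hα : 0 ≤ α)
    (hα1 : α ≤ 1) (h : ∀ a B, MeasurableSet[history a] B →
      ENNReal.ofReal r * law {e | tree e ∈ B ∧ (tree e).IsSplit a} ≤
        law {e | tree e ∈ B ∧ (tree e).SplitsAlong a l})
    {δ : E → ℝ} (hδ0 : ∀ e, 0 ≤ δ e) (hδ : Integrable δ law) {M : ℕ}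
    (hbal : ∀ᵐ e ∂law, ∀ a : List Bool, a.length < M → (tree e).IsSplit a ∧
      ∀ c, α * Q.real {x | (tree e).Reach a x} - 2 * δ e ≤
        Q.real {x | (tree e).Reach (a ++ [c]) x})
    (m : ℕ) (a : List Bool) (hm : a.length + m ≤ M) :
    ∫ e, ∫ x, cellWidth l m a (tree e) x ∂Q ∂law ≤
      (1 - α * r) ^ m * ∫ e, massWidth l Q a (tree e) ∂law + 2 * (2 ^ m - 1) * ∫ e, δ e ∂law := by
  have hint (a : List Bool) : Integrable (fun e => massWidth l Q a (tree e)) law :=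
    Integrable.of_bound ((measurable_massWidth l Q a).comp htree).aestronglyMeasurable 1
      (ae_of_all _ fun e => by
        rw [Real.norm_of_nonneg (massWidth_nonneg l Q a _)]; exact massWidth_le_one l Q a _)
  have hintc (m : ℕ) (a : List Bool) :
      Integrable (fun e => ∫ x, cellWidth l m a (tree e) x ∂Q) law := by
    have hmeas : StronglyMeasurable fun q : E × (ι → ℝ) => cellWidth l m a (tree q.1) q.2 :=
      ((measurable_cellWidth l m a).comp
        ((htree.comp measurable_fst).prodMk measurable_snd)).stronglyMeasurable
    refine Integrable.of_bound hmeas.integral_prod_right'.aestronglyMeasurable (2 ^ m)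
      (ae_of_all _ fun e => ?_)
    have := norm_integral_le_of_norm_le_const (μ := Q) (f := cellWidth l m a (tree e)) (C := 2 ^ m)
      (ae_of_all _ fun x => by
        rw [Real.norm_of_nonneg (cellWidth_nonneg l m a _ x)]; exact cellWidth_le l m a _ x)
    simpa using this
  have hδi : 0 ≤ ∫ e, δ e ∂law := integral_nonneg hδ0
  have hq0 : 0 ≤ 1 - α * r := by nlinarith
  have hq1 : 1 - α * r ≤ 1 := by nlinarith
  induction m generalizing a with
  | zero => simp [integral_cellWidth_zero]
  | succ m ih =>
    have h1 := ih (a ++ [true]) (by simp; omega)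
    have h0 := ih (a ++ [false]) (by simp; omega)
    have hstep : ∫ e, massWidth l Q (a ++ [true]) (tree e) ∂law +
        ∫ e, massWidth l Q (a ++ [false]) (tree e) ∂law ≤
          (1 - α * r) * ∫ e, massWidth l Q a (tree e) ∂law + 2 * ∫ e, δ e ∂law := by
      have hind : Integrable
          (fun e => {T | T.SplitsAlong a l}.indicator (massWidth l Q a) (tree e)) law := by
        refine Integrable.of_bound (((measurable_massWidth l Q a).indicator
          (measurableSet_splitsAlong a l)).comp htree).aestronglyMeasurable 1
          (ae_of_all _ fun e => ?_)
        rw [Real.norm_of_nonneg (Set.indicator_nonneg (fun T _ => massWidth_nonneg l Q a T) _)]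
        exact (Set.indicator_le_self' (fun T _ => massWidth_nonneg l Q a T) _).trans
          (massWidth_le_one l Q a _)
      have hrs := mul_integral_le_of_randomSplit htree hr (h a)
        (by filter_upwards [hbal] with e he using (he a (by omega)).1)
        (measurable_massWidth_history l Q a) (massWidth_nonneg l Q a) (massWidth_le_one l Q a)
      calc _ = ∫ e, (massWidth l Q (a ++ [true]) (tree e) +
            massWidth l Q (a ++ [false]) (tree e)) ∂law := (integral_add (hint _) (hint _)).symm
        _ ≤ ∫ e, (massWidth l Q a (tree e) -
            α * {T | T.SplitsAlong a l}.indicator (massWidth l Q a) (tree e) + 2 * δ e) ∂law := by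
            refine integral_mono_ae ((hint _).add (hint _))
              (((hint a).sub (hind.const_mul α)).add (hδ.const_mul 2)) ?_
            filter_upwards [hbal] with e he
            have := massWidth_children_le l Q (he a (by omega)).1 (hδ0 e) (he a (by omega)).2
            exact this
        _ = ∫ e, massWidth l Q a (tree e) ∂law -
            α * ∫ e, {T | T.SplitsAlong a l}.indicator (massWidth l Q a) (tree e) ∂law +
              2 * ∫ e, δ e ∂law := by
            have hsub : Integrable (fun e => massWidth l Q a (tree e) -
              α * {T | T.SplitsAlong a l}.indicator (massWidth l Q a) (tree e)) law :=
              (hint a).sub (hind.const_mul α)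
            rw [integral_add hsub (hδ.const_mul 2), integral_sub (hint a) (hind.const_mul α),
              integral_const_mul, integral_const_mul]
        _ ≤ _ := by nlinarith
    have hsum : ∫ e, ∫ x, cellWidth l (m + 1) a (tree e) x ∂Q ∂law =
        ∫ e, ∫ x, cellWidth l m (a ++ [true]) (tree e) x ∂Q ∂law +
          ∫ e, ∫ x, cellWidth l m (a ++ [false]) (tree e) x ∂Q ∂law := by
      rw [← integral_add (hintc _ _) (hintc _ _)]
      refine integral_congr_ae (ae_of_all _ fun e => ?_)
      exact integral_add (integrable_cellWidth l Q _ _ _) (integrable_cellWidth l Q _ _ _)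
    have hpow0 : 0 ≤ (1 - α * r) ^ m := pow_nonneg hq0 m
    have hpow1 : (1 - α * r) ^ m ≤ 1 := pow_le_one₀ hq0 hq1
    have e1 := mul_le_mul_of_nonneg_left hstep hpow0
    have e2 := mul_le_mul_of_nonneg_right hpow1 hδi
    rw [hsum, pow_succ, pow_succ]
    nlinarith

end RandomTree

/-! ### Honesty -/

/-- `m` is a version, bounded by `B`, of the conditional mean `x ↦ E[φ(Y) ∣ X = x]` of a feature
`φ`, bounded by `B` as well, where `Q` is the law of `(X, Y)`. -/
structure IsCondMean {𝒳 𝒴 H : Type*} [MeasurableSpace 𝒳] [MeasurableSpace 𝒴]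
    [NormedAddCommGroup H] [NormedSpace ℝ H] (Q : Measure (𝒳 × 𝒴)) (φ : 𝒴 → H) (m : 𝒳 → H)
    (B : ℝ) : Prop where
  nonneg : 0 ≤ B
  feature_meas : StronglyMeasurable φ
  feature_le : ∀ y, ‖φ y‖ ≤ B
  mean_meas : StronglyMeasurable m
  mean_le : ∀ x, ‖m x‖ ≤ B
  integral_smul : ∀ g : 𝒳 → ℝ, Measurable g → (∀ x, |g x| ≤ 1) →
    ∫ q, g q.1 • φ q.2 ∂Q = ∫ q, g q.1 • m q.1 ∂Q

/-- In the mean, the feature of a response can be replaced by its conditional mean, against a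
weight that does not depend on this response. -/
lemma IsCondMean.integral_weight_smul {𝒳 𝒴 H : Type*} [MeasurableSpace 𝒳] [MeasurableSpace 𝒴]
    [NormedAddCommGroup H] [NormedSpace ℝ H] {Q : Measure (𝒳 × 𝒴)}
    [IsProbabilityMeasure Q] {φ : 𝒴 → H} {m : 𝒳 → H} {B : ℝ} (hm : IsCondMean Q φ m B) {s : ℕ}
    {W : (Fin s → 𝒳 × 𝒴) → ℝ} (hW : Measurable W) (hW1 : ∀ z, |W z| ≤ 1) (i : Fin s)
    (hWi : ∀ z z' : Fin s → 𝒳 × 𝒴, (∀ j, j ≠ i → z j = z' j) → (z i).1 = (z' i).1 → W z = W z') :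
    ∫ z, W z • φ (z i).2 ∂(Measure.pi fun _ : Fin s => Q) =
      ∫ z, W z • m (z i).1 ∂(Measure.pi fun _ : Fin s => Q) := by
  obtain _ | k := s
  · exact i.elim0
  -- a default response, to write the weight as a function of the input only
  obtain ⟨⟨-, y₀⟩⟩ := nonempty_of_isProbabilityMeasure Q
  set e := MeasurableEquiv.piFinSuccAbove (fun _ : Fin (k + 1) => 𝒳 × 𝒴) i
  have hmp : MeasurePreserving e.symm _ _ :=
    (measurePreserving_piFinSuccAbove (fun _ : Fin (k + 1) => Q) i).symm
  have hei (q : 𝒳 × 𝒴) (w : Fin k → 𝒳 × 𝒴) : e.symm (q, w) i = q :=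
    Fin.insertNth_apply_same (α := fun _ => 𝒳 × 𝒴) i q w
  have hej (q q' : 𝒳 × 𝒴) (w : Fin k → 𝒳 × 𝒴) (j : Fin (k + 1)) (hj : j ≠ i) :
      e.symm (q, w) j = e.symm (q', w) j := by
    obtain ⟨j, rfl⟩ := Fin.exists_succAbove_eq hj
    exact (Fin.insertNth_apply_succAbove (α := fun _ => 𝒳 × 𝒴) i q w j).trans
      (Fin.insertNth_apply_succAbove (α := fun _ => 𝒳 × 𝒴) i q' w j).symm
  have hbound {f : (Fin (k + 1) → 𝒳 × 𝒴) → H} (hf : ∀ z, ‖f z‖ ≤ B) (z : Fin (k + 1) → 𝒳 × 𝒴) :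
      ‖W z • f z‖ ≤ B := by
    rw [norm_smul]
    exact (mul_le_of_le_one_left (norm_nonneg _) (hW1 z)).trans (hf z)
  have hint {f : (Fin (k + 1) → 𝒳 × 𝒴) → H} (hf : ∀ z, ‖f z‖ ≤ B) (hfm : StronglyMeasurable f) :
      Integrable (fun p => W (e.symm p) • f (e.symm p))
        (Q.prod (Measure.pi fun _ : Fin k => Q)) := by
    refine Integrable.of_bound ?_ B (ae_of_all _ fun p => hbound hf (e.symm p))
    exact ((hW.stronglyMeasurable.smul hfm).comp_measurable e.symm.measurable).aestronglyMeasurable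
  have hf1 : StronglyMeasurable fun z : Fin (k + 1) → 𝒳 × 𝒴 => φ (z i).2 :=
    hm.feature_meas.comp_measurable (by fun_prop)
  have hf2 : StronglyMeasurable fun z : Fin (k + 1) → 𝒳 × 𝒴 => m (z i).1 :=
    hm.mean_meas.comp_measurable (by fun_prop)
  rw [← hmp.integral_comp' (fun z => W z • φ (z i).2),
    ← hmp.integral_comp' (fun z => W z • m (z i).1),
    integral_prod_symm _ (hint (fun z => hm.feature_le _) hf1),
    integral_prod_symm _ (hint (fun z => hm.mean_le _) hf2)]
  refine integral_congr_ae (ae_of_all _ fun w => ?_)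
  have hWg (q : 𝒳 × 𝒴) : W (e.symm (q, w)) = W (e.symm ((q.1, y₀), w)) :=
    hWi _ _ (hej _ _ w) (by rw [hei, hei])
  beta_reduce
  simp only [hei]
  simp only [fun q => hWg q]
  exact hm.integral_smul (fun x => W (e.symm ((x, y₀), w)))
    (hW.comp (e.symm.measurable.comp (by fun_prop))) fun x => hW1 _

namespace TreeProcedure

variable {E : Type*} [MeasurableSpace E] {ι : Type*} {d s : ℕ} {H : Type*} [NormedAddCommGroup H]
  [InnerProductSpace ℝ H] {A : TreeProcedure E ι d s} {m : (ι → ℝ) → H} {B : ℝ}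

/-- The tree estimate with the features replaced by their conditional means. -/
def smoothOutput (A : TreeProcedure E ι d s) (m : (ι → ℝ) → H) (x : ι → ℝ) (e : E)
    (z : Fin s → (ι → ℝ) × (Fin d → ℝ)) : H :=
  ∑ i, A.leafWeight x e z i • m (z i).1

lemma stronglyMeasurable_smoothOutput [Countable ι] (hm : StronglyMeasurable m) :
    StronglyMeasurable fun q : E × (Fin s → (ι → ℝ) × (Fin d → ℝ)) × (ι → ℝ) =>
      A.smoothOutput m q.2.2 q.1 q.2.1 :=
  Finset.stronglyMeasurable_fun_sum _ fun i _ =>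
    (A.measurable_leafWeight i).stronglyMeasurable.smul (hm.comp_measurable (by fun_prop))

lemma norm_smoothOutput_le (hB : 0 ≤ B) (hm : ∀ x, ‖m x‖ ≤ B) (x : ι → ℝ) (e : E)
    (z : Fin s → (ι → ℝ) × (Fin d → ℝ)) : ‖A.smoothOutput m x e z‖ ≤ B :=
  A.norm_sum_leafWeight_smul_le x e z hB fun _ _ => hm _

variable [CompleteSpace H] [RKHS ℝ H (Fin d → ℝ) ℝ] {Q : Measure ((ι → ℝ) × (Fin d → ℝ))}
  [IsProbabilityMeasure Q]

/-- By honesty, the tree estimate has the same mean as the average over the leaf of the conditional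
means. -/
lemma Honest.integral_output [Countable ι] (hA : A.Honest)
    (hm : IsCondMean Q (kernelFeature H) m B) (e : E) (x : ι → ℝ) :
    ∫ z, A.output H x e z ∂(Measure.pi fun _ : Fin s => Q) =
      ∫ z, A.smoothOutput m x e z ∂(Measure.pi fun _ : Fin s => Q) := by
  have hWm (i : Fin s) : Measurable fun z => A.leafWeight x e z i :=
    (A.measurable_leafWeight i).comp
      (g := fun q : E × (Fin s → (ι → ℝ) × (Fin d → ℝ)) × (ι → ℝ) => _)
      (f := fun z => (e, z, x)) (by fun_prop)
  have hW1 (i : Fin s) (z : Fin s → (ι → ℝ) × (Fin d → ℝ)) : |A.leafWeight x e z i| ≤ 1 := by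
    rw [abs_of_nonneg (A.leafWeight_nonneg x e z i)]
    exact A.leafWeight_le_one x e z i
  have hint (i : Fin s) {f : (Fin s → (ι → ℝ) × (Fin d → ℝ)) → H} (hf : ∀ z, ‖f z‖ ≤ B)
      (hfm : StronglyMeasurable f) : Integrable (fun z => A.leafWeight x e z i • f z)
        (Measure.pi fun _ : Fin s => Q) := by
    refine Integrable.of_bound ((hWm i).stronglyMeasurable.smul hfm).aestronglyMeasurable B
      (ae_of_all _ fun z => ?_)
    rw [norm_smul]
    exact (mul_le_of_le_one_left (norm_nonneg _) (hW1 i z)).trans (hf z)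
  simp only [output_eq_sum, smoothOutput]
  rw [integral_finsetSum _ fun i _ => hint i (fun z => hm.feature_le (z i).2)
      (hm.feature_meas.comp_measurable (by fun_prop)),
    integral_finsetSum _ fun i _ => hint i (fun z => hm.mean_le (z i).1)
      (hm.mean_meas.comp_measurable (by fun_prop))]
  refine Finset.sum_congr rfl fun i _ => ?_
  by_cases hi : i ∈ A.est e
  · -- the weight of an observation that populates the leaves ignores its response
    refine hm.integral_weight_smul (hWm i) (hW1 i) i fun z z' hz hzi => ?_
    have hx (j : Fin s) : (z j).1 = (z' j).1 := by
      by_cases hj : j = i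
      · rw [hj, hzi]
      · rw [hz j hj]
    have hgrow : A.grow e z = A.grow e z' :=
      (hA e).2 z z' hx fun j hj => by rw [hz j (fun h => hj (h ▸ hi))]
    have hlp : A.leafPoints x e z = A.leafPoints x e z' := by
      ext j
      simp only [leafPoints, Finset.mem_filter, hgrow, hx]
    simp only [leafWeight, hlp]
  · have h0 (z : Fin s → (ι → ℝ) × (Fin d → ℝ)) : A.leafWeight x e z i = 0 :=
      by_contra fun h => hi (A.mem_est_of_leafWeight_ne_zero h).1
    simp [h0]

/-- The tree estimate at `x` is biased by at most the mean distance between `x` and the points of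
its leaf, which is bounded by the widths of the cell that contains `x` at depth `M`. -/
lemma norm_integral_treeMean_sub_le [Fintype ι] (hA : A.Honest) {α : ℝ} {κ : ℕ} (hα0 : 0 ≤ α)
    (hα1 : α ≤ 1) (hκ : 1 ≤ κ) (hreg : A.AlphaRegular α κ) {C : ℝ} (hQ : SlabBounded Q.fst C)
    (hm : IsCondMean Q (kernelFeature H) m B) {L : NNReal} {g : (ι → ℝ) → H}
    (hg : LipschitzOnWith L g (Set.Icc 0 1)) (hmg : ∀ᵐ x ∂Q.fst, m x = g x) {M : ℕ}
    (hs : 2 * κ ≤ α ^ M * (s / 2 : ℕ)) {x : ι → ℝ} (hx : ∀ l, x l ∈ Set.Icc (0 : ℝ) 1)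
    (hmx : m x = g x) :
    ‖∫ z, A.treeMean H x z ∂(Measure.pi fun _ : Fin s => Q) - m x‖ ≤
      ∫ z, ∫ e, L * ∑ l, SplitTree.cellWidth l M [] (A.grow e z) x ∂A.law
        ∂(Measure.pi fun _ : Fin s => Q) := by
  have hmeas1 : StronglyMeasurable fun q : (Fin s → (ι → ℝ) × (Fin d → ℝ)) × E =>
      A.output H x q.2 q.1 := (A.stronglyMeasurable_output hm.feature_meas).comp_measurable
    (g := fun q : (Fin s → (ι → ℝ) × (Fin d → ℝ)) × E => (q.2, q.1, x)) (by fun_prop)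
  have hmeas2 : StronglyMeasurable fun q : (Fin s → (ι → ℝ) × (Fin d → ℝ)) × E =>
      A.smoothOutput m x q.2 q.1 := (stronglyMeasurable_smoothOutput hm.mean_meas).comp_measurable
    (g := fun q : (Fin s → (ι → ℝ) × (Fin d → ℝ)) × E => (q.2, q.1, x)) (by fun_prop)
  have hmean : ∫ z, A.treeMean H x z ∂(Measure.pi fun _ : Fin s => Q) =
      ∫ z, ∫ e, A.smoothOutput m x e z ∂A.law ∂(Measure.pi fun _ : Fin s => Q) := by
    unfold treeMean
    rw [integral_integral_swap (f := fun z e => A.output H x e z)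
        (Integrable.of_bound hmeas1.aestronglyMeasurable B (ae_of_all _ fun q =>
          A.norm_output_le hm.nonneg hm.feature_le x q.2 q.1)),
      integral_integral_swap (f := fun z e => A.smoothOutput m x e z)
        (Integrable.of_bound hmeas2.aestronglyMeasurable B (ae_of_all _ fun q =>
          norm_smoothOutput_le hm.nonneg hm.mean_le x q.2 q.1))]
    exact integral_congr_ae (ae_of_all _ fun e => hA.integral_output hm e x)
  have hmeas3 : Measurable fun q : (Fin s → (ι → ℝ) × (Fin d → ℝ)) × E =>
      L * ∑ l, SplitTree.cellWidth l M [] (A.grow q.2 q.1) x := by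
    refine (Finset.measurable_fun_sum _ fun l _ => ?_).const_mul (L : ℝ)
    exact (SplitTree.measurable_cellWidth l M []).comp
      ((A.measurable_grow.comp measurable_swap).prodMk measurable_const)
  have hb3 (q : (Fin s → (ι → ℝ) × (Fin d → ℝ)) × E) :
      ‖L * ∑ l, SplitTree.cellWidth l M [] (A.grow q.2 q.1) x‖ ≤
        L * (Fintype.card ι * 2 ^ M) := by
    rw [Real.norm_of_nonneg (mul_nonneg L.coe_nonneg
      (Finset.sum_nonneg fun l _ => SplitTree.cellWidth_nonneg l M [] (A.grow q.2 q.1) x))]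
    refine mul_le_mul_of_nonneg_left ?_ L.coe_nonneg
    refine (Finset.sum_le_card_nsmul _ _ (2 ^ M) fun l _ =>
      SplitTree.cellWidth_le l M [] _ x).trans ?_
    simp
  have hint3 := Integrable.of_bound (μ := (Measure.pi fun _ : Fin s => Q).prod A.law)
    hmeas3.aestronglyMeasurable _ (ae_of_all _ hb3)
  have hz2 (z : Fin s → (ι → ℝ) × (Fin d → ℝ)) :
      Integrable (fun e => A.smoothOutput m x e z) A.law :=
    Integrable.of_bound (hmeas2.comp_measurable measurable_prodMk_left).aestronglyMeasurable B
      (ae_of_all _ fun e => norm_smoothOutput_le hm.nonneg hm.mean_le x e z)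
  have hi2 : Integrable (fun z => ∫ e, A.smoothOutput m x e z ∂A.law)
      (Measure.pi fun _ : Fin s => Q) :=
    (Integrable.of_bound (μ := (Measure.pi fun _ : Fin s => Q).prod A.law)
      hmeas2.aestronglyMeasurable B (ae_of_all _ fun q =>
        norm_smoothOutput_le hm.nonneg hm.mean_le x q.2 q.1)).integral_prod_left
  have hconst : m x = ∫ _, m x ∂(Measure.pi fun _ : Fin s => Q) := by simp
  rw [hmean, hconst, ← integral_sub hi2 (integrable_const _)]
  have hmg' : ∀ᵐ z ∂(Measure.pi fun _ : Fin s => Q), ∀ i, m (z i).1 = g (z i).1 := by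
    rw [ae_all_iff]
    intro i
    exact (measurePreserving_eval (fun _ : Fin s => Q) i).quasiMeasurePreserving.ae
      (ae_of_ae_map measurable_fst.aemeasurable hmg)
  refine norm_integral_le_of_norm_le hint3.integral_prod_left ?_
  filter_upwards [ae_generalPosition hQ, hmg'] with z hz hzg
  have hconst : m x = ∫ _, m x ∂A.law := by simp
  rw [hconst, ← integral_sub (hz2 z) (integrable_const _)]
  have hi3 : Integrable (fun e => L * ∑ l, SplitTree.cellWidth l M [] (A.grow e z) x) A.law :=
    Integrable.of_bound (hmeas3.comp measurable_prodMk_left).aestronglyMeasurable _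
      (ae_of_all _ fun e => hb3 (z, e))
  refine norm_integral_le_of_norm_le hi3 ?_
  have hpow : α ^ M * (s / 2 : ℕ) ≤ (s / 2 : ℕ) :=
    mul_le_of_le_one_left (Nat.cast_nonneg _) (pow_le_one₀ hα0 hα1)
  filter_upwards [hreg z hz] with e he
  have hcard : ((s / 2 : ℕ) : ℝ) ≤ (A.est e).card := by exact_mod_cast (hA e).1.1
  have hκcard : κ ≤ (A.est e).card := by
    have : (κ : ℝ) ≤ (A.est e).card := by
      have : (0 : ℝ) ≤ κ := Nat.cast_nonneg κ
      linarith
    exact_mod_cast this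
  have hR := he hκcard
  have hne : (A.leafPoints x e z).Nonempty := by
    rw [← Finset.card_pos]
    exact lt_of_lt_of_le (by omega) (hR.le_card_cell x)
  have hsum : A.smoothOutput m x e z - m x =
      ∑ i, A.leafWeight x e z i • (m (z i).1 - m x) := by
    simp only [smul_sub, Finset.sum_sub_distrib, ← Finset.sum_smul, A.sum_leafWeight hne, one_smul]
    rfl
  rw [hsum]
  refine A.norm_sum_leafWeight_smul_le x e z (mul_nonneg L.coe_nonneg
    (Finset.sum_nonneg fun l _ => SplitTree.cellWidth_nonneg l M [] _ x)) fun i hi => ?_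
  obtain ⟨-, hcell⟩ := A.mem_est_of_leafWeight_ne_zero hi
  rw [hzg i, hmx]
  have hxc : x ∈ Set.Icc (0 : ι → ℝ) 1 := ⟨fun l => (hx l).1, fun l => (hx l).2⟩
  have hzc : (z i).1 ∈ Set.Icc (0 : ι → ℝ) 1 := ⟨fun l => (hz.1 i l).1, fun l => (hz.1 i l).2⟩
  refine (hg.norm_sub_le hzc hxc).trans (mul_le_mul_of_nonneg_left ?_ L.coe_nonneg)
  have hcoord (l : ι) : |x l - (z i).1 l| ≤ SplitTree.cellWidth l M [] (A.grow e z) x := by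
    have : Nonempty ι := ⟨l⟩
    refine SplitTree.abs_sub_le_cellWidth l (M := M) (fun b hb => ?_) (by simp) (hx l) (hz.1 i l)
      hcell (SplitTree.reach_nil _ _)
    refine hR.isSplit hα0 hα1 hκ (hs.trans ?_)
    exact mul_le_mul (pow_le_pow_of_le_one hα0 hα1 hb.le) hcard (Nat.cast_nonneg _)
      (pow_nonneg hα0 _)
  rw [norm_sub_rev]
  refine (pi_norm_le_iff_of_nonneg (Finset.sum_nonneg fun l _ =>
    SplitTree.cellWidth_nonneg l M [] _ x)).2 fun l => ?_
  exact (hcoord l).trans (Finset.single_le_sum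
    (f := fun l => SplitTree.cellWidth l M [] (A.grow e z) x)
    (fun l _ => SplitTree.cellWidth_nonneg l M [] _ x) (Finset.mem_univ l))

end TreeProcedure

/-! ### Consistency of an infinite forest -/

namespace TreeProcedure

variable {E : Type*} [MeasurableSpace E] {ι : Type*} {d s : ℕ}
  {H : Type*} [NormedAddCommGroup H] [InnerProductSpace ℝ H] [CompleteSpace H]
  [RKHS ℝ H (Fin d → ℝ) ℝ] {A : TreeProcedure E ι d s}
  {Q : Measure ((ι → ℝ) × (Fin d → ℝ))} [IsProbabilityMeasure Q] {m : (ι → ℝ) → H} {B : ℝ}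
  {α π : ℝ} {κ : ℕ} {C : ℝ}

section Width

variable [Fintype ι] [DecidableEq ι]

lemma measurable_gridDiscrepancy_est (A : TreeProcedure E ι d s) (P : Measure (ι → ℝ)) (G : ℕ) :
    Measurable fun q : (Fin s → (ι → ℝ) × (Fin d → ℝ)) × E =>
      gridDiscrepancy P G (A.est q.2) (fun i => (q.1 i).1) := by
  let _ : MeasurableSpace (Finset (Fin s)) := ⊤
  have hest : Measurable A.est := measurable_to_countable' A.measurable_est
  have h : Measurable fun q : Finset (Fin s) × (Fin s → ι → ℝ) => gridDiscrepancy P G q.1 q.2 :=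
    measurable_from_prod_countable_right fun S => measurable_gridDiscrepancy P G S
  exact h.comp (g := fun q : Finset (Fin s) × (Fin s → ι → ℝ) => gridDiscrepancy P G q.1 q.2)
    (f := fun q : (Fin s → (ι → ℝ) × (Fin d → ℝ)) × E => (A.est q.2, fun i => (q.1 i).1))
    ((hest.comp measurable_snd).prodMk (by fun_prop))

lemma integrable_gridDiscrepancy_est (A : TreeProcedure E ι d s) (P : Measure (ι → ℝ))
    [IsProbabilityMeasure P] (G : ℕ) {ν : Measure ((Fin s → (ι → ℝ) × (Fin d → ℝ)) × E)}
    [IsFiniteMeasure ν] :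
    Integrable (fun q : (Fin s → (ι → ℝ) × (Fin d → ℝ)) × E =>
      gridDiscrepancy P G (A.est q.2) (fun i => (q.1 i).1)) ν :=
  Integrable.of_bound (measurable_gridDiscrepancy_est A P G).aestronglyMeasurable
    (Fintype.card (ι → Fin (G + 1)) : ℝ)
    (ae_of_all _ fun q => by
      rw [Real.norm_of_nonneg (gridDiscrepancy_nonneg P G (A.est q.2) fun i => (q.1 i).1)]
      exact gridDiscrepancy_le P G (A.est q.2) fun i => (q.1 i).1)

lemma integral_gridDiscrepancy_est_le (hA : A.Honest) (G : ℕ) (hs0 : (0 : ℝ) < (s / 2 : ℕ)) :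
    ∫ z, ∫ e, gridDiscrepancy Q.fst G (A.est e) (fun i => (z i).1) ∂A.law
      ∂(Measure.pi fun _ : Fin s => Q) ≤ Fintype.card (ι → Fin (G + 1)) * (2 / √(s / 2 : ℕ)) := by
  rw [integral_integral_swap
    (f := fun (z : Fin s → (ι → ℝ) × (Fin d → ℝ)) e =>
      gridDiscrepancy Q.fst G (A.est e) (fun i => (z i).1))
    (integrable_gridDiscrepancy_est A Q.fst G)]
  have hle (e : E) : ∫ z, gridDiscrepancy Q.fst G (A.est e) (fun i => (z i).1)
      ∂(Measure.pi fun _ : Fin s => Q) ≤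
        Fintype.card (ι → Fin (G + 1)) * (2 / √(s / 2 : ℕ)) := by
    have hcard : ((s / 2 : ℕ) : ℝ) ≤ (A.est e).card := by exact_mod_cast (hA e).1.1
    have hce : (0 : ℝ) < (A.est e).card := hs0.trans_le hcard
    refine (integral_gridDiscrepancy_le Q G
      (Finset.card_pos.1 (by exact_mod_cast hce))).trans ?_
    gcongr
  have hc : Integrable (fun _ : E =>
      (Fintype.card (ι → Fin (G + 1)) : ℝ) * (2 / √(s / 2 : ℕ))) A.law := integrable_const _
  refine (integral_mono_of_nonneg (ae_of_all _ fun e => ?_) hc (ae_of_all _ hle)).trans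
    (le_of_eq (by simp))
  exact integral_nonneg fun z => gridDiscrepancy_nonneg Q.fst G (A.est e) fun i => (z i).1

/-- The nodes of small depth of a regular tree are split, and these splits are balanced for the law
of the inputs as well, up to the discrepancy between this law and the sample. -/
lemma isSplit_and_balanced_of_isRegular {P : Measure (ι → ℝ)} [IsProbabilityMeasure P]
    [Nonempty ι] (hP : SlabBounded P C) {G : ℕ} (hG : 0 < G) (hα0 : 0 ≤ α) (hα1 : α ≤ 1)
    (hκ : 1 ≤ κ) {x : Fin s → ι → ℝ} {S : Finset (Fin s)} {T : SplitTree ι}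
    (hT : T.IsRegular α κ x S) {M : ℕ} (hS : 2 * κ ≤ α ^ M * S.card) {a : List Bool}
    (ha : a.length < M) :
    T.IsSplit a ∧ ∀ c, α * P.real {x | T.Reach a x} -
      2 * (gridDiscrepancy P G S x + M * (C / G)) ≤ P.real {x | T.Reach (a ++ [c]) x} := by
  have hsplit : T.IsSplit a := hT.isSplit hα0 hα1 hκ (hS.trans
    (mul_le_mul_of_nonneg_right (pow_le_pow_of_le_one hα0 hα1 ha.le) (Nat.cast_nonneg _)))
  refine ⟨hsplit, fun c => ?_⟩
  have hCG : 0 ≤ C / G := div_nonneg hP.nonneg (Nat.cast_nonneg _)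
  have hlen (b : List Bool) (hb : b.length ≤ M) : (b.length : ℝ) * (C / G) ≤ M * (C / G) :=
    mul_le_mul_of_nonneg_right (by exact_mod_cast hb) hCG
  have h1 := abs_le.1 (abs_measure_reach_sub_empFreq_le hP hG S x T a)
  have h2 := abs_le.1 (abs_measure_reach_sub_empFreq_le hP hG S x T (a ++ [c]))
  have l1 := hlen a ha.le
  have l2 := hlen (a ++ [c]) (by simp; omega)
  have hemp : α * empFreq S x {x | T.Reach a x} ≤ empFreq S x {x | T.Reach (a ++ [c]) x} := by
    have := mul_le_mul_of_nonneg_left (hT.children hsplit c)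
      (inv_nonneg.2 (Nat.cast_nonneg (α := ℝ) S.card))
    unfold empFreq
    refine (le_of_eq ?_).trans this
    rw [mul_left_comm]
    rfl
  have h3 := mul_le_mul_of_nonneg_left
    (show P.real {x | T.Reach a x} ≤ empFreq S x {x | T.Reach a x} +
      (gridDiscrepancy P G S x + M * (C / G)) by linarith) hα0
  have h4 : α * (gridDiscrepancy P G S x + M * (C / G)) ≤
      gridDiscrepancy P G S x + M * (C / G) :=
    mul_le_of_le_one_left (add_nonneg (gridDiscrepancy_nonneg P G S x) (by positivity)) hα1
  linarith

/-- The mean width along `l` of the cell, at depth `M`, of an independent point. -/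
lemma integral_cellWidth_grow_le (l : ι) (hA : A.Honest) (hrs : A.RandomSplit π)
    (hreg : A.AlphaRegular α κ) (hα0 : 0 ≤ α) (hα1 : α ≤ 1) (hκ : 1 ≤ κ) {r : ℝ} (hr0 : 0 ≤ r)
    (hr1 : r ≤ 1) (hrπ : r ≤ π / Fintype.card ι) (hQ : SlabBounded Q.fst C) {G : ℕ} (hG : 0 < G)
    {M : ℕ} (hs : 2 * κ ≤ α ^ M * (s / 2 : ℕ)) :
    ∫ z, ∫ e, ∫ x, SplitTree.cellWidth l M [] (A.grow e z) x ∂Q.fst ∂A.law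
        ∂(Measure.pi fun _ : Fin s => Q) ≤
      (1 - α * r) ^ M + 2 * (2 ^ M - 1) *
        (Fintype.card (ι → Fin (G + 1)) * (2 / √(s / 2 : ℕ)) + M * (C / G)) := by
  have hne : Nonempty ι := ⟨l⟩
  have hCG : 0 ≤ C / G := div_nonneg hQ.nonneg (Nat.cast_nonneg _)
  have h2M : (0 : ℝ) ≤ 2 * (2 ^ M - 1) := by
    have : (1 : ℝ) ≤ 2 ^ M := one_le_pow₀ (by norm_num)
    linarith
  have hpow : α ^ M * (s / 2 : ℕ) ≤ (s / 2 : ℕ) :=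
    mul_le_of_le_one_left (Nat.cast_nonneg _) (pow_le_one₀ hα0 hα1)
  have hκ' : (1 : ℝ) ≤ κ := by exact_mod_cast hκ
  have hs0 : (0 : ℝ) < (s / 2 : ℕ) := by linarith
  have hcard (e : E) : ((s / 2 : ℕ) : ℝ) ≤ (A.est e).card := by exact_mod_cast (hA e).1.1
  let δ (z : Fin s → (ι → ℝ) × (Fin d → ℝ)) (e : E) : ℝ :=
    gridDiscrepancy Q.fst G (A.est e) (fun i => (z i).1) + M * (C / G)
  have hδ0 (z : Fin s → (ι → ℝ) × (Fin d → ℝ)) (e : E) : 0 ≤ δ z e :=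
    add_nonneg (gridDiscrepancy_nonneg _ _ _ _) (by positivity)
  have hdint := integrable_gridDiscrepancy_est A Q.fst G
    (ν := (Measure.pi fun _ : Fin s => Q).prod A.law)
  have hδint (z : Fin s → (ι → ℝ) × (Fin d → ℝ)) : Integrable (fun e =>
      gridDiscrepancy Q.fst G (A.est e) (fun i => (z i).1)) A.law :=
    Integrable.of_bound ((measurable_gridDiscrepancy_est A Q.fst G).comp
      measurable_prodMk_left).aestronglyMeasurable
      (Fintype.card (ι → Fin (G + 1)))
      (ae_of_all _ fun q => by
        rw [Real.norm_of_nonneg (gridDiscrepancy_nonneg _ _ _ _)]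
        exact gridDiscrepancy_le _ _ _ _)
  have hmain : ∀ᵐ z ∂(Measure.pi fun _ : Fin s => Q),
      ∫ e, ∫ x, SplitTree.cellWidth l M [] (A.grow e z) x ∂Q.fst ∂A.law ≤
        (1 - α * r) ^ M + 2 * (2 ^ M - 1) *
          (∫ e, gridDiscrepancy Q.fst G (A.est e) (fun i => (z i).1) ∂A.law + M * (C / G)) := by
    filter_upwards [ae_generalPosition hQ] with z hz
    have htree : Measurable fun e => A.grow e z := A.measurable_grow.comp measurable_prodMk_right
    have hbal : ∀ᵐ e ∂A.law, ∀ a : List Bool, a.length < M → (A.grow e z).IsSplit a ∧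
        ∀ c, α * Q.fst.real {x | (A.grow e z).Reach a x} - 2 * δ z e ≤
          Q.fst.real {x | (A.grow e z).Reach (a ++ [c]) x} := by
      filter_upwards [hreg z hz] with e he a ha
      have hce := hcard e
      have hκe : κ ≤ (A.est e).card := by
        have : (κ : ℝ) ≤ (A.est e).card := by linarith
        exact_mod_cast this
      refine isSplit_and_balanced_of_isRegular hQ hG hα0 hα1 hκ (he hκe) (hs.trans ?_) ha
      exact mul_le_mul_of_nonneg_left hce (pow_nonneg hα0 _)
    have h := integral_cellWidth_le (law := A.law) (Q := Q.fst) htree (l := l) hr0 hr1 hα0 hα1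
      (fun a B hB => (mul_le_mul_left (ENNReal.ofReal_le_ofReal hrπ) _).trans (hrs z hz a l B hB))
      (hδ0 z) ((hδint z).add (integrable_const _)) hbal M [] (by simp)
    have h1 : ∫ e, SplitTree.massWidth l Q.fst [] (A.grow e z) ∂A.law ≤ 1 := by
      have := integral_mono_of_nonneg (μ := A.law)
        (ae_of_all _ fun e => SplitTree.massWidth_nonneg l Q.fst [] (A.grow e z))
        (integrable_const (1 : ℝ))
        (ae_of_all _ fun e => SplitTree.massWidth_le_one l Q.fst [] (A.grow e z))
      simpa using this
    have h2 : ∫ e, δ z e ∂A.law =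
        ∫ e, gridDiscrepancy Q.fst G (A.est e) (fun i => (z i).1) ∂A.law + M * (C / G) := by
      simp only [δ]
      rw [integral_add (hδint z) (integrable_const _)]
      simp
    have hq0 : 0 ≤ (1 - α * r) ^ M := pow_nonneg (by nlinarith) M
    rw [h2] at h
    refine h.trans ?_
    gcongr
    exact mul_le_of_le_one_right hq0 h1
  have hdisc := integral_gridDiscrepancy_est_le (Q := Q) hA G hs0
  have hdint' := hdint.integral_prod_left
  calc ∫ z, ∫ e, ∫ x, SplitTree.cellWidth l M [] (A.grow e z) x ∂Q.fst ∂A.law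
        ∂(Measure.pi fun _ : Fin s => Q)
      ≤ ∫ z, ((1 - α * r) ^ M + 2 * (2 ^ M - 1) *
          (∫ e, gridDiscrepancy Q.fst G (A.est e) (fun i => (z i).1) ∂A.law + M * (C / G)))
          ∂(Measure.pi fun _ : Fin s => Q) := by
        refine integral_mono_of_nonneg (ae_of_all _ fun z => ?_)
          ((integrable_const _).add ((hdint'.add (integrable_const _)).const_mul _)) hmain
        exact integral_nonneg fun e => integral_nonneg fun x =>
          SplitTree.cellWidth_nonneg l M [] _ x
    _ = (1 - α * r) ^ M + 2 * (2 ^ M - 1) *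
          (∫ z, ∫ e, gridDiscrepancy Q.fst G (A.est e) (fun i => (z i).1) ∂A.law
            ∂(Measure.pi fun _ : Fin s => Q) + M * (C / G)) := by
        have haff (D : (Fin s → (ι → ℝ) × (Fin d → ℝ)) → ℝ)
            (hD : Integrable D (Measure.pi fun _ : Fin s => Q)) (a b c : ℝ) :
            ∫ z, (a + b * (D z + c)) ∂(Measure.pi fun _ : Fin s => Q) =
              a + b * (∫ z, D z ∂(Measure.pi fun _ : Fin s => Q) + c) := by
          have h1 : Integrable (fun z => D z + c) (Measure.pi fun _ : Fin s => Q) :=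
            hD.add (integrable_const c)
          rw [integral_add (integrable_const a) (h1.const_mul b), integral_const_mul,
            integral_add hD (integrable_const c)]
          simp
        exact haff _ hdint' _ _ _
    _ ≤ _ := by gcongr

end Width

/-- The random fluctuation of an infinite forest at a given point. -/
lemma integral_norm_forest_sub_integral_treeMean_le [Fintype ι] (hA : A.Symmetric H)
    (hQ : SlabBounded Q.fst C) (hm : IsCondMean Q (kernelFeature H) m B) {n : ℕ} (hn : 0 < n / s)
    (x : ι → ℝ) :
    ∫ z, ‖A.forest H z x - ∫ z', A.treeMean H x z' ∂(Measure.pi fun _ : Fin s => Q)‖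
      ∂(Measure.pi fun _ : Fin n => Q) ≤ 2 * B / √(n / s : ℕ) := by
  have hsymm : ∀ᵐ z ∂(Measure.pi fun _ : Fin n => Q), ∀ (f : Fin s ↪ Fin n)
      (σ : Equiv.Perm (Fin s)),
        A.treeMean H x (fun i => z (f (σ i))) = A.treeMean H x (fun i => z (f i)) := by
    filter_upwards [ae_generalPosition hQ] with z hz f σ
    have hzf : GeneralPosition fun i => (z (f i)).1 := hz.comp f
    exact hA.treeMean_comp A hm.feature_meas hzf σ x
  have hmeas : StronglyMeasurable (A.treeMean H x) :=
    (A.stronglyMeasurable_treeMean hm.feature_meas).comp_measurable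
      (g := fun z : Fin s → (ι → ℝ) × (Fin d → ℝ) => (z, x)) (by fun_prop)
  exact integral_norm_ustat_sub_le Q hmeas
    (fun z => A.norm_treeMean_le hm.nonneg hm.feature_le x z) hsymm hn

/-- The `L¹` error of an infinite forest: its random fluctuation as a U-statistic, and the bias of
one tree. -/
lemma integral_norm_forest_sub_le [Fintype ι] [DecidableEq ι] (hA : A.ForestConditions H α π κ)
    (hα0 : 0 ≤ α) (hα1 : α ≤ 1) (hκ : 1 ≤ κ) {r : ℝ} (hr0 : 0 ≤ r)
    (hr1 : r ≤ 1) (hrπ : r ≤ π / Fintype.card ι) (hQ : SlabBounded Q.fst C)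
    (hm : IsCondMean Q (kernelFeature H) m B) {L : NNReal} {g : (ι → ℝ) → H}
    (hg : LipschitzOnWith L g (Set.Icc 0 1)) (hmg : ∀ᵐ x ∂Q.fst, m x = g x) {G : ℕ} (hG : 0 < G)
    {M : ℕ} (hs : 2 * κ ≤ α ^ M * (s / 2 : ℕ)) {n : ℕ} (hn : 0 < n / s) :
    ∫ q, ‖A.forest H q.1 q.2 - m q.2‖ ∂((Measure.pi fun _ : Fin n => Q).prod Q.fst) ≤
      2 * B / √(n / s : ℕ) + L * (Fintype.card ι * ((1 - α * r) ^ M + 2 * (2 ^ M - 1) *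
        (Fintype.card (ι → Fin (G + 1)) * (2 / √(s / 2 : ℕ)) + M * (C / G)))) := by
  have hmf := A.stronglyMeasurable_forest (n := n) hm.feature_meas
  have hmm : StronglyMeasurable fun q : (Fin n → (ι → ℝ) × (Fin d → ℝ)) × (ι → ℝ) => m q.2 :=
    hm.mean_meas.comp_measurable measurable_snd
  have hb (q : (Fin n → (ι → ℝ) × (Fin d → ℝ)) × (ι → ℝ)) : ‖A.forest H q.1 q.2‖ ≤ B :=
    A.norm_forest_le hm.nonneg hm.feature_le q.1 q.2
  have hint : Integrable (fun q => ‖A.forest H q.1 q.2 - m q.2‖)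
      ((Measure.pi fun _ : Fin n => Q).prod Q.fst) :=
    ((Integrable.of_bound hmf.aestronglyMeasurable B (ae_of_all _ hb)).sub
      (Integrable.of_bound hmm.aestronglyMeasurable B
        (ae_of_all _ fun q => hm.mean_le q.2))).norm
  rw [integral_prod_symm _ hint]
  -- the integrand that bounds the bias
  set F : (ι → ℝ) → (Fin s → (ι → ℝ) × (Fin d → ℝ)) → E → ℝ := fun x z e =>
    ∑ l, SplitTree.cellWidth l M [] (A.grow e z) x
  have hcw (l : ι) : Measurable
      fun q : ((ι → ℝ) × (Fin s → (ι → ℝ) × (Fin d → ℝ))) × E =>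
        SplitTree.cellWidth l M [] (A.grow q.2 q.1.2) q.1.1 :=
    (SplitTree.measurable_cellWidth l M []).comp
      ((A.measurable_grow.comp (measurable_snd.prodMk (measurable_snd.comp measurable_fst))).prodMk
        (measurable_fst.comp measurable_fst))
  have hcw' (l : ι) (T : SplitTree ι) (x : ι → ℝ) : ‖SplitTree.cellWidth l M [] T x‖ ≤ 2 ^ M := by
    rw [Real.norm_of_nonneg (SplitTree.cellWidth_nonneg l M [] _ _)]
    exact SplitTree.cellWidth_le l M [] _ _
  have hcwint (l : ι) : Integrable
      (fun q : ((ι → ℝ) × (Fin s → (ι → ℝ) × (Fin d → ℝ))) × E =>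
        SplitTree.cellWidth l M [] (A.grow q.2 q.1.2) q.1.1)
      ((Q.fst.prod (Measure.pi fun _ : Fin s => Q)).prod A.law) :=
    Integrable.of_bound (hcw l).aestronglyMeasurable (2 ^ M) (ae_of_all _ fun q => hcw' l _ _)
  have hFint : Integrable (fun q : ((ι → ℝ) × (Fin s → (ι → ℝ) × (Fin d → ℝ))) × E =>
      F q.1.1 q.1.2 q.2) ((Q.fst.prod (Measure.pi fun _ : Fin s => Q)).prod A.law) :=
    integrable_finsetSum _ fun l _ => hcwint l
  have hFint2 := hFint.integral_prod_left
  have hFint3 := hFint2.integral_prod_left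
  have hpoint : ∀ᵐ x ∂Q.fst, ∫ z, ‖A.forest H z x - m x‖ ∂(Measure.pi fun _ : Fin n => Q) ≤
      2 * B / √(n / s : ℕ) +
        L * ∫ z, ∫ e, F x z e ∂A.law ∂(Measure.pi fun _ : Fin s => Q) := by
    filter_upwards [hQ.cube, hmg] with x hx hmx
    have hbias := norm_integral_treeMean_sub_le hA.honest hα0 hα1 hκ hA.regular hQ hm hg hmg hs
      hx hmx
    simp only [integral_const_mul] at hbias
    have hU := integral_norm_forest_sub_integral_treeMean_le hA.symm hQ hm hn x
    set c := ∫ z, A.treeMean H x z ∂(Measure.pi fun _ : Fin s => Q)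
    have hi : Integrable (fun z => ‖A.forest H z x - c‖) (Measure.pi fun _ : Fin n => Q) :=
      ((Integrable.of_bound (hmf.comp_measurable measurable_prodMk_right).aestronglyMeasurable B
        (ae_of_all _ fun z => hb (z, x))).sub (integrable_const c)).norm
    calc ∫ z, ‖A.forest H z x - m x‖ ∂(Measure.pi fun _ : Fin n => Q)
        ≤ ∫ z, (‖A.forest H z x - c‖ + ‖c - m x‖) ∂(Measure.pi fun _ : Fin n => Q) :=
          integral_mono_of_nonneg (ae_of_all _ fun z => norm_nonneg _)
            (hi.add (integrable_const _))
            (ae_of_all _ fun z => norm_sub_le_norm_sub_add_norm_sub _ _ _)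
      _ = ∫ z, ‖A.forest H z x - c‖ ∂(Measure.pi fun _ : Fin n => Q) + ‖c - m x‖ := by
          rw [integral_add hi (integrable_const _)]; simp
      _ ≤ _ := add_le_add hU hbias
  have hF : ∫ x, ∫ z, ∫ e, F x z e ∂A.law ∂(Measure.pi fun _ : Fin s => Q) ∂Q.fst ≤
      Fintype.card ι * ((1 - α * r) ^ M + 2 * (2 ^ M - 1) *
        (Fintype.card (ι → Fin (G + 1)) * (2 / √(s / 2 : ℕ)) + M * (C / G))) := by
    have hswap : ∫ x, ∫ z, ∫ e, F x z e ∂A.law ∂(Measure.pi fun _ : Fin s => Q) ∂Q.fst =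
        ∑ l, ∫ z, ∫ e, ∫ x, SplitTree.cellWidth l M [] (A.grow e z) x ∂Q.fst ∂A.law
          ∂(Measure.pi fun _ : Fin s => Q) := by
      have h1 := integral_prod _ hFint2
      have h2 := integral_prod _ hFint
      rw [← h1, ← h2, integral_finsetSum _ fun l _ => hcwint l]
      refine Finset.sum_congr rfl fun l _ => ?_
      rw [integral_prod _ (hcwint l), integral_prod_symm _ (hcwint l).integral_prod_left]
      refine integral_congr_ae (ae_of_all _ fun z => ?_)
      refine integral_integral_swap (f := fun x e => SplitTree.cellWidth l M [] (A.grow e z) x) ?_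
      refine Integrable.of_bound (Measurable.aestronglyMeasurable ?_) (2 ^ M)
        (ae_of_all _ fun q => hcw' l _ _)
      exact (hcw l).comp (f := fun q : (ι → ℝ) × E => ((q.1, z), q.2)) (by fun_prop)
    rw [hswap]
    refine (Finset.sum_le_card_nsmul _ _ _ fun l _ => integral_cellWidth_grow_le l hA.honest
      hA.randomSplit hA.regular hα0 hα1 hκ hr0 hr1 hrπ hQ hG hs).trans (le_of_eq ?_)
    rw [nsmul_eq_mul, Finset.card_univ]
  calc ∫ x, ∫ z, ‖A.forest H z x - m x‖ ∂(Measure.pi fun _ : Fin n => Q) ∂Q.fst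
      ≤ ∫ x, (2 * B / √(n / s : ℕ) +
        L * ∫ z, ∫ e, F x z e ∂A.law ∂(Measure.pi fun _ : Fin s => Q)) ∂Q.fst :=
        integral_mono_of_nonneg (ae_of_all _ fun x => integral_nonneg fun z => norm_nonneg _)
          ((integrable_const _).add (hFint3.const_mul _)) hpoint
    _ = 2 * B / √(n / s : ℕ) +
        L * ∫ x, ∫ z, ∫ e, F x z e ∂A.law ∂(Measure.pi fun _ : Fin s => Q) ∂Q.fst := by
        rw [integral_add (integrable_const _) (hFint3.const_mul _), integral_const_mul]
        simp
    _ ≤ _ := by gcongr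

end TreeProcedure

/-! ### Subsample sizes and the limit of the error -/

lemma tendsto_subsample_size {β : ℝ} (hβ0 : 0 < β) {s : ℕ → ℕ}
    (hs : ∀ n : ℕ, |(s n : ℝ) - (n : ℝ) ^ β| < 1) : Tendsto s atTop atTop := by
  rw [← tendsto_natCast_atTop_iff (R := ℝ)]
  have h : Tendsto (fun n : ℕ => (n : ℝ) ^ β - 1) atTop atTop :=
    tendsto_atTop_add_const_right _ _ ((tendsto_rpow_atTop hβ0).comp tendsto_natCast_atTop_atTop)
  refine tendsto_atTop_mono (fun n => ?_) h
  have := (abs_lt.1 (hs n)).1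
  linarith

/-- The number of disjoint subsamples tends to infinity. -/
lemma tendsto_div_subsample_size {β : ℝ} (hβ0 : 0 < β) (hβ1 : β < 1) {s : ℕ → ℕ}
    (hs : ∀ n : ℕ, |(s n : ℝ) - (n : ℝ) ^ β| < 1) : Tendsto (fun n => n / s n) atTop atTop := by
  have h1 : Tendsto (fun n : ℕ => (n : ℝ) ^ (1 - β) / 2) atTop atTop :=
    ((tendsto_rpow_atTop (by linarith)).comp tendsto_natCast_atTop_atTop).atTop_div_const
      (by norm_num)
  have hfloor : Tendsto (fun n : ℕ => ⌊(n : ℝ) ^ (1 - β) / 2⌋₊) atTop atTop :=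
    tendsto_nat_floor_atTop.comp h1
  refine tendsto_atTop_mono' _ ?_ hfloor
  filter_upwards [eventually_ge_atTop 1, (tendsto_subsample_size hβ0 hs).eventually_ge_atTop 1]
    with n hn hsn
  have hn' : (1 : ℝ) ≤ n := by exact_mod_cast hn
  have hn0 : (0 : ℝ) < n := by linarith
  rw [Nat.le_div_iff_mul_le (by omega)]
  have h2 : (s n : ℝ) ≤ 2 * (n : ℝ) ^ β := by
    have := (abs_lt.1 (hs n)).2
    have := Real.one_le_rpow hn' hβ0.le
    linarith
  have h3 : (⌊(n : ℝ) ^ (1 - β) / 2⌋₊ : ℝ) ≤ (n : ℝ) ^ (1 - β) / 2 :=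
    Nat.floor_le (by positivity)
  have h4 : (n : ℝ) ^ (1 - β) * (n : ℝ) ^ β = n := by
    rw [← Real.rpow_add hn0]; simp
  have : ((⌊(n : ℝ) ^ (1 - β) / 2⌋₊ * s n : ℕ) : ℝ) ≤ n := by
    push_cast
    calc _ ≤ (n : ℝ) ^ (1 - β) / 2 * (2 * (n : ℝ) ^ β) := by gcongr
      _ = (n : ℝ) ^ (1 - β) * (n : ℝ) ^ β := by ring
      _ = n := h4
  exact_mod_cast this

/-- An infinite forest is a consistent estimator, in `L¹`, of the conditional mean embedding. -/
theorem tendsto_integral_norm_forest_sub {ι : Type*} [Fintype ι] {d : ℕ} {H : Type*}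
    [NormedAddCommGroup H] [InnerProductSpace ℝ H] [CompleteSpace H] [RKHS ℝ H (Fin d → ℝ) ℝ]
    {Q : Measure ((ι → ℝ) × (Fin d → ℝ))} [IsProbabilityMeasure Q] {m : (ι → ℝ) → H} {B C : ℝ}
    (hQ : SlabBounded Q.fst C) (hm : IsCondMean Q (kernelFeature H) m B) {L : NNReal}
    {g : (ι → ℝ) → H} (hg : LipschitzOnWith L g (Set.Icc 0 1)) (hmg : ∀ᵐ x ∂Q.fst, m x = g x)
    {β : ℝ} (hβ0 : 0 < β) (hβ1 : β < 1) {s : ℕ → ℕ}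
    (hs : ∀ n : ℕ, |(s n : ℝ) - (n : ℝ) ^ β| < 1) {α π : ℝ} {κ : ℕ} (hα0 : 0 < α) (hα1 : α ≤ 1)
    (hπ : 0 < π) (hκ : 1 ≤ κ) {E : Type*} [MeasurableSpace E]
    {A : ∀ n, TreeProcedure E ι d (s n)} (hA : ∀ n, (A n).ForestConditions H α π κ) :
    Tendsto (fun n => ∫ q, ‖(A n).forest H q.1 q.2 - m q.2‖
      ∂((Measure.pi fun _ : Fin n => Q).prod Q.fst)) atTop (𝓝 0) := by
  classical
  set r : ℝ := min (π / Fintype.card ι) 1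
  have hr0 : 0 ≤ r := le_min (by positivity) zero_le_one
  have hr1 : r ≤ 1 := min_le_right _ _
  have hsN := tendsto_subsample_size hβ0 hs
  have hs2 : Tendsto (fun n => ((s n / 2 : ℕ) : ℝ)) atTop atTop :=
    tendsto_natCast_atTop_atTop.comp
      ((Nat.tendsto_div_const_atTop (n := 2) (by norm_num)).comp hsN)
  have hns := tendsto_div_subsample_size hβ0 hβ1 hs
  have hns' : Tendsto (fun n => ((n / s n : ℕ) : ℝ)) atTop atTop :=
    tendsto_natCast_atTop_atTop.comp hns
  -- the part of the bound that only depends on the depth and on the grid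
  have hsmall (ε : ℝ) (hε : 0 < ε) : ∃ M G : ℕ, 0 < G ∧
      L * (Fintype.card ι * ((1 - α * r) ^ M + 2 * (2 ^ M - 1) * (M * (C / G)))) < ε := by
    have hM : ∃ M : ℕ, L * (Fintype.card ι * (1 - α * r) ^ M) < ε := by
      rcases isEmpty_or_nonempty ι with h | h
      · exact ⟨0, by simpa using hε⟩
      · have hr : 0 < r := lt_min (by positivity) one_pos
        have hαr : 0 < α * r := mul_pos hα0 hr
        have ht : Tendsto (fun M : ℕ => L * (Fintype.card ι * (1 - α * r) ^ M)) atTop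
            (𝓝 (L * (Fintype.card ι * 0))) :=
          ((tendsto_pow_atTop_nhds_zero_of_lt_one (by nlinarith) (by linarith)).const_mul
            _).const_mul _
        rw [mul_zero, mul_zero] at ht
        exact (ht.eventually_lt_const hε).exists
    obtain ⟨M, hM⟩ := hM
    have ht : Tendsto (fun G : ℕ => L * (Fintype.card ι * ((1 - α * r) ^ M +
        2 * (2 ^ M - 1) * (M * (C / G))))) atTop
        (𝓝 (L * (Fintype.card ι * ((1 - α * r) ^ M + 2 * (2 ^ M - 1) * (M * 0))))) :=
      ((((tendsto_const_div_atTop_nhds_zero_nat C).const_mul _).const_mul _).const_add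
        _ |>.const_mul _).const_mul _
    rw [mul_zero, mul_zero, add_zero] at ht
    obtain ⟨G, hG, hG'⟩ := ((ht.eventually_lt_const hM).and (eventually_gt_atTop 0)).exists
    exact ⟨M, G, hG', hG⟩
  refine tendsto_order.2 ⟨fun ε hε => Eventually.of_forall fun n =>
    hε.trans_le (integral_nonneg fun q => norm_nonneg _), fun ε hε => ?_⟩
  obtain ⟨M, G, hG, hMG⟩ := hsmall ε hε
  have hlim : Tendsto (fun n => 2 * B / √(n / s n : ℕ) +
      L * (Fintype.card ι * ((1 - α * r) ^ M + 2 * (2 ^ M - 1) *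
        (Fintype.card (ι → Fin (G + 1)) * (2 / √(s n / 2 : ℕ)) + M * (C / G))))) atTop
      (𝓝 (0 + L * (Fintype.card ι * ((1 - α * r) ^ M + 2 * (2 ^ M - 1) *
        (Fintype.card (ι → Fin (G + 1)) * 0 + M * (C / G)))))) := by
    refine Tendsto.add ((Real.tendsto_sqrt_atTop.comp hns').const_div_atTop _) ?_
    exact ((((((Real.tendsto_sqrt_atTop.comp hs2).const_div_atTop _).const_mul _).add_const
      _).const_mul _).const_add _ |>.const_mul _).const_mul _
  rw [zero_add, mul_zero, zero_add] at hlim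
  filter_upwards [hlim.eventually_lt_const hMG, hns.eventually_gt_atTop 0,
    hs2.eventually_ge_atTop (2 * κ / α ^ M)] with n h1 h2 h3
  refine lt_of_le_of_lt (TreeProcedure.integral_norm_forest_sub_le (hA n) hα0.le hα1 hκ hr0 hr1
    (min_le_left _ _) hQ hm hg hmg hG ?_ h2) h1
  rwa [div_le_iff₀' (by positivity)] at h3

/-! ### The conditional mean embedding -/

section Embedding

variable {𝒴 H : Type*} [NormedAddCommGroup H] [InnerProductSpace ℝ H] [CompleteSpace H]

lemma inner_kernelFeature [RKHS ℝ H 𝒴 ℝ] {k : 𝒴 → 𝒴 → ℝ} (hk : IsRKHSOf H k) (y y' : 𝒴) :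
    inner ℝ (kernelFeature H y) (kernelFeature H y') = k y' y := by
  have h := RKHS.kernel_inner (H := H) y' y (1 : ℝ) (1 : ℝ)
  rw [hk] at h
  simpa [kernelFeature] using h.symm

lemma norm_kernelFeature_le [RKHS ℝ H 𝒴 ℝ] {k : 𝒴 → 𝒴 → ℝ} (hk : IsRKHSOf H k) {C : ℝ}
    (hC : ∀ y y', |k y y'| ≤ C) (y : 𝒴) : ‖kernelFeature H y‖ ≤ √C := by
  refine Real.le_sqrt_of_sq_le ?_
  rw [← real_inner_self_eq_norm_sq, inner_kernelFeature hk]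
  exact (le_abs_self _).trans (hC y y)

lemma continuous_kernelFeature [TopologicalSpace 𝒴] [RKHS ℝ H 𝒴 ℝ] {k : 𝒴 → 𝒴 → ℝ}
    (hk : IsRKHSOf H k) (hc : Continuous fun q : 𝒴 × 𝒴 => k q.1 q.2) :
    Continuous (kernelFeature H : 𝒴 → H) := by
  refine continuous_iff_continuousAt.2 fun y₀ => tendsto_iff_norm_sub_tendsto_zero.2 ?_
  have hsq (y : 𝒴) :
      ‖kernelFeature H y - kernelFeature H y₀‖ = √(k y y - 2 * k y₀ y + k y₀ y₀) := by
    rw [← Real.sqrt_sq (norm_nonneg _), norm_sub_sq_real, ← real_inner_self_eq_norm_sq,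
      ← real_inner_self_eq_norm_sq, inner_kernelFeature hk, inner_kernelFeature hk,
      inner_kernelFeature hk]
  have h (f g : 𝒴 → 𝒴) (hf : Continuous f) (hg : Continuous g) :
      Continuous fun y => k (f y) (g y) :=
    hc.comp (hf.prodMk hg)
  have hcont : Continuous fun y => √(k y y - 2 * k y₀ y + k y₀ y₀) :=
    Real.continuous_sqrt.comp (((h _ _ continuous_id continuous_id).sub
      (continuous_const.mul (h _ _ continuous_const continuous_id))).add continuous_const)
  have := hcont.tendsto y₀
  simp only [hsq]
  convert this using 2
  ring_nf
  simp

variable {Ω : Type*} [MeasurableSpace Ω] {P : Measure Ω} [IsProbabilityMeasure P]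
  {𝒳 : Type*} [MeasurableSpace 𝒳] {d : ℕ} [RKHS ℝ H (Fin d → ℝ) ℝ] {X : Ω → 𝒳}
  {Y : Ω → Fin d → ℝ} {B : ℝ}

lemma norm_condEmbedding_le (hB : ∀ y, ‖kernelFeature H (𝒴 := Fin d → ℝ) y‖ ≤ B) (x : 𝒳) :
    ‖condEmbedding H P X Y x‖ ≤ B := by
  simpa [condEmbedding, kernelEmbedding] using
    norm_integral_le_of_norm_le_const (μ := condDistrib Y X P x) (ae_of_all _ hB)

lemma stronglyMeasurable_condEmbedding
    (hφ : StronglyMeasurable (kernelFeature H : (Fin d → ℝ) → H)) :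
    StronglyMeasurable (condEmbedding H P X Y) :=
  (hφ.comp_measurable (measurable_snd (α := 𝒳))).integral_condDistrib

lemma isCondMean_condEmbedding (hX : Measurable X) (hY : Measurable Y) (hB0 : 0 ≤ B)
    (hφ : StronglyMeasurable (kernelFeature H : (Fin d → ℝ) → H))
    (hB : ∀ y, ‖kernelFeature H (𝒴 := Fin d → ℝ) y‖ ≤ B) :
    IsCondMean (P.map fun ω => (X ω, Y ω)) (kernelFeature H) (condEmbedding H P X Y) B where
  nonneg := hB0
  feature_meas := hφ
  feature_le := hB
  mean_meas := stronglyMeasurable_condEmbedding hφ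
  mean_le := norm_condEmbedding_le hB
  integral_smul g hg hg1 := by
    have hPX : IsProbabilityMeasure (P.map X) := Measure.isProbabilityMeasure_map hX.aemeasurable
    have hbd (q : 𝒳 × (Fin d → ℝ)) {h : H} (hh : ‖h‖ ≤ B) : ‖g q.1 • h‖ ≤ B := by
      rw [norm_smul]
      exact (mul_le_of_le_one_left (norm_nonneg _) (hg1 _)).trans hh
    rw [← compProd_map_condDistrib hY.aemeasurable]
    have h1 : Integrable (fun q : 𝒳 × (Fin d → ℝ) => g q.1 • kernelFeature H q.2)
        (P.map X ⊗ₘ condDistrib Y X P) :=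
      Integrable.of_bound ((hg.comp measurable_fst).stronglyMeasurable.smul
        (hφ.comp_measurable measurable_snd)).aestronglyMeasurable B
        (ae_of_all _ fun q => hbd q (hB _))
    have h2 : Integrable (fun q : 𝒳 × (Fin d → ℝ) => g q.1 • condEmbedding H P X Y q.1)
        (P.map X ⊗ₘ condDistrib Y X P) :=
      Integrable.of_bound ((hg.comp measurable_fst).stronglyMeasurable.smul
        ((stronglyMeasurable_condEmbedding hφ).comp_measurable measurable_fst)).aestronglyMeasurable
        B (ae_of_all _ fun q => hbd q (norm_condEmbedding_le hB _))
    rw [Measure.integral_compProd h1, Measure.integral_compProd h2]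
    refine integral_congr_ae (ae_of_all _ fun x => ?_)
    simp only [integral_smul, integral_const, probReal_univ, one_smul]
    rfl

/-- The conditional mean embedding is the conditional expectation of the feature of the
response. -/
lemma condExp_kernelFeature_ae_eq (hX : Measurable X) (hY : Measurable Y)
    (hφ : StronglyMeasurable (kernelFeature H : (Fin d → ℝ) → H))
    (hB : ∀ y, ‖kernelFeature H (𝒴 := Fin d → ℝ) y‖ ≤ B) :
    P[fun ω => kernelFeature H (Y ω) | MeasurableSpace.comap X inferInstance] =ᵐ[P]
      fun ω => condEmbedding H P X Y (X ω) :=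
  condExp_ae_eq_integral_condDistrib hX hY.aemeasurable hφ
    (Integrable.of_bound (hφ.comp_measurable hY).aestronglyMeasurable B (ae_of_all _ fun _ => hB _))

/-- By the tower property, the conditional mean embedding given `f (X)` is the conditional
expectation of the one given `X`. -/
lemma condExp_condEmbedding_ae_eq {𝒳' : Type*} [MeasurableSpace 𝒳'] {f : 𝒳 → 𝒳'}
    (hf : Measurable f) (hX : Measurable X) (hY : Measurable Y)
    (hφ : StronglyMeasurable (kernelFeature H : (Fin d → ℝ) → H))
    (hB : ∀ y, ‖kernelFeature H (𝒴 := Fin d → ℝ) y‖ ≤ B) :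
    P[fun ω => condEmbedding H P X Y (X ω) |
        MeasurableSpace.comap (fun ω => f (X ω)) inferInstance] =ᵐ[P]
      fun ω => condEmbedding H P (fun ω => f (X ω)) Y (f (X ω)) := by
  have hle : MeasurableSpace.comap (fun ω => f (X ω)) inferInstance ≤
      MeasurableSpace.comap X inferInstance := by
    rintro _ ⟨S, hS, rfl⟩
    exact ⟨f ⁻¹' S, hf hS, rfl⟩
  calc _ =ᵐ[P] P[P[fun ω => kernelFeature H (Y ω) | MeasurableSpace.comap X inferInstance] |
        MeasurableSpace.comap (fun ω => f (X ω)) inferInstance] :=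
        condExp_congr_ae (condExp_kernelFeature_ae_eq hX hY hφ hB).symm
    _ =ᵐ[P] P[fun ω => kernelFeature H (Y ω) |
        MeasurableSpace.comap (fun ω => f (X ω)) inferInstance] :=
        condExp_condExp_of_le hle hX.comap_le
    _ =ᵐ[P] _ := condExp_kernelFeature_ae_eq (hf.comp hX) hY hφ hB

lemma hVar_eq {ξ : Ω → H} (hξ : AEStronglyMeasurable ξ P) (hB : ∀ ω, ‖ξ ω‖ ≤ B) :
    hVar P ξ = ∫ ω, ‖ξ ω‖ ^ 2 ∂P - ‖∫ ω, ξ ω ∂P‖ ^ 2 := by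
  set c := ∫ ω, ξ ω ∂P
  have hi : Integrable ξ P := Integrable.of_bound hξ B (ae_of_all _ hB)
  have hi2 : Integrable (fun ω => ‖ξ ω‖ ^ 2) P :=
    Integrable.of_bound (hξ.norm.pow 2) (B ^ 2) (ae_of_all _ fun ω => by
      rw [Real.norm_of_nonneg (by positivity)]
      exact pow_le_pow_left₀ (norm_nonneg _) (hB ω) 2)
  have hi3 : Integrable (fun ω => 2 * inner ℝ c (ξ ω)) P := (hi.const_inner c).const_mul 2
  unfold hVar
  calc ∫ ω, ‖ξ ω - c‖ ^ 2 ∂P = ∫ ω, (‖ξ ω‖ ^ 2 - 2 * inner ℝ c (ξ ω) + ‖c‖ ^ 2) ∂P := by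
        refine integral_congr_ae (ae_of_all _ fun ω => ?_)
        simp only [norm_sub_sq_real, real_inner_comm]
    _ = ∫ ω, ‖ξ ω‖ ^ 2 ∂P - 2 * inner ℝ c c + ‖c‖ ^ 2 := by
        have hi4 : Integrable (fun ω => ‖ξ ω‖ ^ 2 - 2 * inner ℝ c (ξ ω)) P := hi2.sub hi3
        rw [integral_add hi4 (integrable_const _), integral_sub hi2 hi3,
          integral_const_mul, integral_inner hi]
        simp [c]
    _ = _ := by rw [real_inner_self_eq_norm_sq]; ring

end Embedding

/-! ### The empirical index -/

lemma abs_norm_sq_sub_norm_sq_le {H : Type*} [SeminormedAddCommGroup H] {B : ℝ} {a b : H}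
    (ha : ‖a‖ ≤ B) (hb : ‖b‖ ≤ B) :
    |‖a‖ ^ 2 - ‖b‖ ^ 2| ≤ 2 * B * ‖a - b‖ := by
  rw [sq_sub_sq, abs_mul, abs_of_nonneg (by positivity)]
  exact mul_le_mul (by linarith) (abs_norm_sub_norm_le a b) (abs_nonneg _)
    (by linarith [norm_nonneg a])

lemma abs_average_sub_average_le {n : ℕ} {f g h : Fin n → ℝ} (hfg : ∀ i, |f i - g i| ≤ h i) :
    |(n : ℝ)⁻¹ * ∑ i, f i - (n : ℝ)⁻¹ * ∑ i, g i| ≤ (n : ℝ)⁻¹ * ∑ i, h i := by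
  rw [← mul_sub, ← Finset.sum_sub_distrib, abs_mul, abs_of_nonneg (by positivity)]
  gcongr
  exact (Finset.abs_sum_le_sum_abs _ _).trans (Finset.sum_le_sum fun i _ => hfg i)

/-- Stability of the numerator of the index. -/
lemma abs_average_norm_sub_sq_sub_le {H : Type*} [SeminormedAddCommGroup H] {n : ℕ} {B : ℝ}
    {a b u v : Fin n → H} (ha : ∀ i, ‖a i‖ ≤ B)
    (hb : ∀ i, ‖b i‖ ≤ B) (hu : ∀ i, ‖u i‖ ≤ B) (hv : ∀ i, ‖v i‖ ≤ B) :
    |(n : ℝ)⁻¹ * ∑ i, ‖a i - b i‖ ^ 2 - (n : ℝ)⁻¹ * ∑ i, ‖u i - v i‖ ^ 2| ≤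
      (n : ℝ)⁻¹ * ∑ i, 4 * B * (‖a i - u i‖ + ‖b i - v i‖) := by
  refine abs_average_sub_average_le fun i => ?_
  have hB0 : 0 ≤ B := (norm_nonneg _).trans (ha i)
  have h1 : ‖a i - b i‖ ≤ 2 * B := (norm_sub_le _ _).trans (by linarith [ha i, hb i])
  have h2 : ‖u i - v i‖ ≤ 2 * B := (norm_sub_le _ _).trans (by linarith [hu i, hv i])
  have h3 : ‖(a i - b i) - (u i - v i)‖ ≤ ‖a i - u i‖ + ‖b i - v i‖ := by
    rw [sub_sub_sub_comm]
    exact norm_sub_le _ _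
  refine (abs_norm_sq_sub_norm_sq_le h1 h2).trans ?_
  nlinarith

section Empirical

variable {H : Type*} [NormedAddCommGroup H] [InnerProductSpace ℝ H] {n : ℕ} {B : ℝ}

lemma inv_mul_sum_norm_sub_average_sq (f : Fin n → H) :
    (n : ℝ)⁻¹ * ∑ i, ‖f i - (n : ℝ)⁻¹ • ∑ i', f i'‖ ^ 2 =
      (n : ℝ)⁻¹ * ∑ i, ‖f i‖ ^ 2 - ‖(n : ℝ)⁻¹ • ∑ i, f i‖ ^ 2 := by
  rcases eq_or_ne n 0 with rfl | hn
  · simp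
  have hn' : (n : ℝ) ≠ 0 := by exact_mod_cast hn
  set c := (n : ℝ)⁻¹ • ∑ i, f i
  have hc : ∑ i, f i = (n : ℝ) • c := (smul_inv_smul₀ hn' _).symm
  simp only [norm_sub_sq_real]
  rw [Finset.sum_add_distrib, Finset.sum_sub_distrib, ← Finset.mul_sum, ← sum_inner, hc,
    real_inner_smul_left, real_inner_self_eq_norm_sq]
  simp only [Finset.sum_const, Finset.card_univ, Fintype.card_fin, nsmul_eq_mul]
  field_simp
  ring

/-- The ratio of sums as a ratio of the corresponding empirical means. For `n = 0`, both sides are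
`0 / 0 = 0`. -/
lemma relativeDiscrepancy_eq (f g : Fin n → H) :
    relativeDiscrepancy f g = ((n : ℝ)⁻¹ * ∑ i, ‖f i - g i‖ ^ 2) /
      ((n : ℝ)⁻¹ * ∑ i, ‖f i‖ ^ 2 - ‖(n : ℝ)⁻¹ • ∑ i, f i‖ ^ 2) := by
  rw [← inv_mul_sum_norm_sub_average_sq]
  rcases eq_or_ne n 0 with rfl | hn
  · simp [relativeDiscrepancy]
  · rw [mul_div_mul_left _ _ (inv_ne_zero (by exact_mod_cast hn))]
    rfl

lemma relativeDiscrepancy_self (f : Fin n → H) : relativeDiscrepancy f f = 0 := by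
  simp [relativeDiscrepancy]

lemma norm_average_le (hB0 : 0 ≤ B) {f : Fin n → H} (hf : ∀ i, ‖f i‖ ≤ B) :
    ‖(n : ℝ)⁻¹ • ∑ i, f i‖ ≤ B := by
  rw [norm_smul, norm_inv, Real.norm_natCast]
  refine inv_mul_le_of_le_mul₀ (Nat.cast_nonneg n) hB0 ?_
  simpa using norm_sum_le_of_le Finset.univ fun i _ => hf i

lemma norm_average_sub_average_le (f g : Fin n → H) :
    ‖(n : ℝ)⁻¹ • ∑ i, f i - (n : ℝ)⁻¹ • ∑ i, g i‖ ≤ (n : ℝ)⁻¹ * ∑ i, ‖f i - g i‖ := by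
  rw [← smul_sub, ← Finset.sum_sub_distrib, norm_smul, norm_inv, Real.norm_natCast]
  gcongr
  exact norm_sum_le _ _

/-- Stability of the denominator of the index. -/
lemma abs_empirical_variance_sub_le {a u : Fin n → H} (hB0 : 0 ≤ B) (ha : ∀ i, ‖a i‖ ≤ B)
    (hu : ∀ i, ‖u i‖ ≤ B) :
    |((n : ℝ)⁻¹ * ∑ i, ‖a i‖ ^ 2 - ‖(n : ℝ)⁻¹ • ∑ i, a i‖ ^ 2) -
        ((n : ℝ)⁻¹ * ∑ i, ‖u i‖ ^ 2 - ‖(n : ℝ)⁻¹ • ∑ i, u i‖ ^ 2)| ≤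
      (n : ℝ)⁻¹ * ∑ i, 4 * B * ‖a i - u i‖ := by
  have h1 := abs_average_sub_average_le fun i => abs_norm_sq_sub_norm_sq_le (ha i) (hu i)
  have h2 := abs_norm_sq_sub_norm_sq_le (norm_average_le hB0 ha) (norm_average_le hB0 hu)
  have h3 := mul_le_mul_of_nonneg_left (norm_average_sub_average_le a u)
    (mul_nonneg zero_le_two hB0)
  rw [sub_sub_sub_comm]
  refine (abs_sub _ _).trans ?_
  rw [← Finset.mul_sum] at h1 ⊢
  linarith

end Empirical

/-! ### Convergence in probability -/

/-- A perturbation that is small in `L¹` does not affect a limit in probability. -/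
lemma tendstoInMeasure_of_tendsto_integral {Ω : Type*} [MeasurableSpace Ω] {P : Measure Ω}
    [IsFiniteMeasure P] {f g h : ℕ → Ω → ℝ} {c : ℝ} (hg : ∀ n, AEStronglyMeasurable (g n) P)
    (hgc : ∀ᵐ ω ∂P, Tendsto (fun n => g n ω) atTop (𝓝 c)) (hh : ∀ n, Integrable (h n) P)
    (hfg : ∀ n ω, |f n ω - g n ω| ≤ h n ω)
    (hlim : Tendsto (fun n => ∫ ω, h n ω ∂P) atTop (𝓝 0)) :
    TendstoInMeasure P f atTop fun _ => c := by
  rw [tendstoInMeasure_iff_measureReal_norm]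
  intro ε hε
  have hgm := tendstoInMeasure_iff_measureReal_norm.1
    (tendstoInMeasure_of_tendsto_ae hg hgc) (ε / 2) (half_pos hε)
  have hsum := hgm.add (hlim.const_mul (ε / 2)⁻¹)
  rw [mul_zero, add_zero] at hsum
  refine squeeze_zero (fun n => measureReal_nonneg) (fun n => ?_) hsum
  have hmarkov : P.real {ω | ε / 2 ≤ h n ω} ≤ (ε / 2)⁻¹ * ∫ ω, h n ω ∂P := by
    rw [← div_eq_inv_mul, le_div_iff₀' (half_pos hε)]
    exact mul_meas_ge_le_integral_of_nonneg
      (ae_of_all _ fun ω => (abs_nonneg _).trans (hfg n ω)) (hh n) _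
  refine (measureReal_mono (fun ω hω => ?_)).trans ((measureReal_union_le _ _).trans
    (add_le_add_right hmarkov _))
  by_contra hcon
  simp only [Set.mem_union, Set.mem_ofPred_eq, not_or, not_le, Real.norm_eq_abs] at hcon hω
  have := abs_sub_le (f n ω) (g n ω) c
  have := hfg n ω
  linarith [hcon.1, hcon.2]

lemma tendstoInMeasure_div {Ω : Type*} [MeasurableSpace Ω] {P : Measure Ω}
    {f g : ℕ → Ω → ℝ} {a b : ℝ} (hf : TendstoInMeasure P f atTop fun _ => a)
    (hg : TendstoInMeasure P g atTop fun _ => b) (hb : b ≠ 0) :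
    TendstoInMeasure P (fun n ω => f n ω / g n ω) atTop fun _ => a / b := by
  rw [tendstoInMeasure_iff_dist] at hf hg ⊢
  intro ε hε
  have hc : ContinuousAt (fun q : ℝ × ℝ => q.1 / q.2) (a, b) :=
    continuousAt_fst.div continuousAt_snd hb
  obtain ⟨δ, hδ, hδε⟩ := Metric.continuousAt_iff.1 hc ε hε
  have hsum := (hf δ hδ).add (hg δ hδ)
  rw [add_zero] at hsum
  refine tendsto_of_tendsto_of_tendsto_of_le_of_le tendsto_const_nhds hsum
    (fun n => zero_le) fun n => ?_
  refine (measure_mono fun ω hω => ?_).trans (measure_union_le _ _)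
  by_contra hcon
  simp only [Set.mem_union, Set.mem_ofPred_eq, not_or, not_le] at hcon hω
  exact absurd (hδε (x := (f n ω, g n ω)) (max_lt hcon.1 hcon.2)) (not_lt.2 hω)

/-! ### Samples on a probability space -/

section Sample

variable {Ω : Type*} [MeasurableSpace Ω] {P : Measure Ω} [IsProbabilityMeasure P]
  {𝒳 𝒴 : Type*} [MeasurableSpace 𝒳] [MeasurableSpace 𝒴]

/-- The strong law of large numbers for a bounded function of i.i.d. variables. -/
lemma tendsto_average_comp {F : Type*} [NormedAddCommGroup F] [NormedSpace ℝ F] [CompleteSpace F]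
    {X : Ω → 𝒳} {X' : ℕ → Ω → 𝒳} (hX' : ∀ i, Measurable (X' i)) (hind : iIndepFun X' P)
    (hlaw : ∀ i, IdentDistrib (X' i) X P P) {g : 𝒳 → F} (hg : StronglyMeasurable g) {B : ℝ}
    (hB : ∀ x, ‖g x‖ ≤ B) :
    ∀ᵐ ω ∂P, Tendsto (fun n : ℕ => (n : ℝ)⁻¹ • ∑ i : Fin n, g (X' i ω)) atTop
      (𝓝 (∫ ω, g (X ω) ∂P)) := by
  borelize F
  have hgm := hg.measurable
  have hint : Integrable (fun ω => g (X' 0 ω)) P :=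
    Integrable.of_bound (hg.comp_measurable (hX' 0)).aestronglyMeasurable B
      (ae_of_all _ fun _ => hB _)
  have h := strong_law_ae (μ := P) (fun i ω => g (X' i ω)) hint
    (fun i k hik => (hind.indepFun hik).comp hgm hgm)
    (fun i => ((hlaw i).trans (hlaw 0).symm).comp hgm)
  have hmean : ∫ ω, g (X' 0 ω) ∂P = ∫ ω, g (X ω) ∂P := ((hlaw 0).comp hgm).integral_eq
  rw [hmean] at h
  simpa only [Finset.sum_range] using h

/-- The joint law of the training sample and of one of the independent inputs. -/
lemma map_sample_prodMk {X : Ω → 𝒳} {Y : Ω → 𝒴} (hY : Measurable Y) {Z : ℕ → Ω → 𝒳 × 𝒴}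
    {X' : ℕ → Ω → 𝒳} (hZ : ∀ i, Measurable (Z i)) (hX' : ∀ i, Measurable (X' i))
    (hZ_indep : iIndepFun Z P) (hZ_law : ∀ i, IdentDistrib (Z i) (fun ω => (X ω, Y ω)) P P)
    (hX'_law : ∀ i, IdentDistrib (X' i) X P P)
    (hZX' : IndepFun (fun ω i => Z i ω) (fun ω i => X' i ω) P) (n i : ℕ) :
    P.map (fun ω => ((fun r : Fin n => Z r ω), X' i ω)) =
      (Measure.pi fun _ : Fin n => P.map fun ω => (X ω, Y ω)).prod
        (P.map fun ω => (X ω, Y ω)).fst := by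
  have h1 : IndepFun (fun ω (r : Fin n) => Z r ω) (X' i) P :=
    hZX'.comp (φ := fun (z : ℕ → 𝒳 × 𝒴) (r : Fin n) => z r) (ψ := fun x : ℕ → 𝒳 => x i)
      (by fun_prop) (by fun_prop)
  have h2 : iIndepFun (fun r : Fin n => Z r) P := hZ_indep.precomp Fin.val_injective
  rw [(indepFun_iff_map_prod_eq_prod_map_map (by fun_prop) (by fun_prop)).1 h1,
    h2.map_fun_eq_pi_map (fun r : Fin n => (hZ r).aemeasurable), (hX'_law i).map_eq,
    Measure.fst_map_prodMk hY]
  simp only [(hZ_law _).map_eq]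

/-- The consistency of an infinite forest, for random variables: the mean error at a new input
tends to zero, and does not depend on the index of this input. -/
lemma exists_tendsto_integral_norm_forest_sub {ι : Type*} [Fintype ι] {d : ℕ} {H : Type*}
    [NormedAddCommGroup H] [InnerProductSpace ℝ H] [CompleteSpace H] [RKHS ℝ H (Fin d → ℝ) ℝ]
    {X : Ω → ι → ℝ} {Y : Ω → Fin d → ℝ} (hX : Measurable X) (hY : Measurable Y)
    {Z : ℕ → Ω → (ι → ℝ) × (Fin d → ℝ)} {X' : ℕ → Ω → ι → ℝ} (hZ : ∀ i, Measurable (Z i))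
    (hX' : ∀ i, Measurable (X' i)) (hZ_indep : iIndepFun Z P)
    (hZ_law : ∀ i, IdentDistrib (Z i) (fun ω => (X ω, Y ω)) P P)
    (hX'_law : ∀ i, IdentDistrib (X' i) X P P)
    (hZX' : IndepFun (fun ω i => Z i ω) (fun ω i => X' i ω) P)
    {B C : ℝ} (hφ : StronglyMeasurable (kernelFeature H : (Fin d → ℝ) → H)) (hB0 : 0 ≤ B)
    (hB : ∀ y, ‖kernelFeature H (𝒴 := Fin d → ℝ) y‖ ≤ B) (hQ : SlabBounded (P.map X) C)
    (hL : LipschitzCondEmbedding H P X Y) {β : ℝ} (hβ0 : 0 < β) (hβ1 : β < 1) {s : ℕ → ℕ}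
    (hs : ∀ n : ℕ, |(s n : ℝ) - (n : ℝ) ^ β| < 1) {α π : ℝ} {κ : ℕ} (hα0 : 0 < α) (hα1 : α ≤ 1)
    (hπ : 0 < π) (hκ : 1 ≤ κ) {E : Type*} [MeasurableSpace E]
    {A : ∀ n, TreeProcedure E ι d (s n)} (hA : ∀ n, (A n).ForestConditions H α π κ) :
    (∀ n i : ℕ, Integrable (fun ω => ‖(A n).forest H (fun r : Fin n => Z r ω) (X' i ω) -
      condEmbedding H P X Y (X' i ω)‖) P) ∧
    ∃ δ : ℕ → ℝ, Tendsto δ atTop (𝓝 0) ∧ ∀ n i : ℕ,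
      ∫ ω, ‖(A n).forest H (fun r : Fin n => Z r ω) (X' i ω) -
        condEmbedding H P X Y (X' i ω)‖ ∂P = δ n := by
  obtain ⟨L, g, hg, hmg⟩ := hL
  have hfst : (P.map fun ω => (X ω, Y ω)).fst = P.map X := Measure.fst_map_prodMk hY
  have hprob : IsProbabilityMeasure (P.map fun ω => (X ω, Y ω)) :=
    Measure.isProbabilityMeasure_map (hX.prodMk hY).aemeasurable
  have hm := isCondMean_condEmbedding (P := P) hX hY hB0 hφ hB
  have hsm (n : ℕ) : StronglyMeasurable
      fun q : (Fin n → (ι → ℝ) × (Fin d → ℝ)) × (ι → ℝ) =>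
        ‖(A n).forest H q.1 q.2 - condEmbedding H P X Y q.2‖ :=
    (((A n).stronglyMeasurable_forest hφ).sub
      (hm.mean_meas.comp_measurable measurable_snd)).norm
  have hmeas (n i : ℕ) : Measurable fun ω => ((fun r : Fin n => Z r ω), X' i ω) := by fun_prop
  refine ⟨fun n i => ?_, _, tendsto_integral_norm_forest_sub (hfst ▸ hQ) hm hg (hfst ▸ hmg) hβ0 hβ1
    hs hα0 hα1 hπ hκ hA, fun n i => ?_⟩
  · refine Integrable.of_bound ((hsm n).comp_measurable (hmeas n i)).aestronglyMeasurable (B + B)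
      (ae_of_all _ fun ω => ?_)
    rw [norm_norm]
    exact (norm_sub_le _ _).trans
      (add_le_add ((A n).norm_forest_le hB0 hB _ _) (norm_condEmbedding_le hB _))
  · rw [← map_sample_prodMk hY hZ hX' hZ_indep hZ_law hX'_law hZX' n i,
      integral_map (hmeas n i).aemeasurable (hsm n).aestronglyMeasurable]

end Sample

/-! ### The importance estimator -/

/-- The numerator and the denominator of the index, as functions of the conditional mean
embeddings. -/
lemma totalSobolMMD_eq {Ω : Type*} [MeasurableSpace Ω] {P : Measure Ω} [IsProbabilityMeasure P]
    {p d : ℕ} {H : Type*} [NormedAddCommGroup H] [InnerProductSpace ℝ H] [CompleteSpace H]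
    [RKHS ℝ H (Fin d → ℝ) ℝ] {X : Ω → Fin p → ℝ} {Y : Ω → Fin d → ℝ} (hX : Measurable X)
    (hY : Measurable Y) {B : ℝ} (hφ : StronglyMeasurable (kernelFeature H : (Fin d → ℝ) → H))
    (hB : ∀ y, ‖kernelFeature H (𝒴 := Fin d → ℝ) y‖ ≤ B) (j : Fin p) :
    totalSobolMMD H P X Y j =
      (∫ ω, ‖condEmbedding H P X Y (X ω) -
        condEmbedding H P (fun ω => dropVar j (X ω)) Y (dropVar j (X ω))‖ ^ 2 ∂P) /
          hVar P (fun ω => condEmbedding H P X Y (X ω)) := by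
  have hdrop : Measurable (dropVar j) := measurable_pi_lambda _ fun l => measurable_pi_apply _
  unfold totalSobolMMD hCondVar
  congr 1
  refine (integral_condExp (hdrop.comp hX).comap_le).trans (integral_congr_ae ?_)
  filter_upwards [condExp_condEmbedding_ae_eq (P := P) (Y := Y) hdrop hX hY hφ hB] with ω hω
  rw [hω]

lemma tendsto_integral_average {Ω : Type*} [MeasurableSpace Ω] {P : Measure Ω}
    {f : ℕ → ℕ → Ω → ℝ} (hf : ∀ n i, Integrable (f n i) P) {δ : ℕ → ℝ}
    (hδ : Tendsto δ atTop (𝓝 0)) (hfδ : ∀ n i, ∫ ω, f n i ω ∂P = δ n) :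
    Tendsto (fun n : ℕ => ∫ ω, (n : ℝ)⁻¹ * ∑ i : Fin n, f n i ω ∂P) atTop (𝓝 0) := by
  refine hδ.congr' ?_
  filter_upwards [eventually_ne_atTop 0] with n hn
  have hn' : (n : ℝ) ≠ 0 := by exact_mod_cast hn
  rw [integral_const_mul, integral_finsetSum _ fun (i : Fin n) _ => hf n i]
  simp [hfδ, hn']

end

theorem theorem1
    {p d : ℕ} (j : Fin p)
    -- the kernel and its reproducing kernel Hilbert space; the kernel is bounded and continuous
    (k : (Fin d → ℝ) → (Fin d → ℝ) → ℝ)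
    {H : Type*} [NormedAddCommGroup H] [InnerProductSpace ℝ H] [CompleteSpace H]
    [RKHS ℝ H (Fin d → ℝ) ℝ] (hkH : IsRKHSOf H k)
    (hk_bdd : ∃ C : ℝ, ∀ y y', |k y y'| ≤ C)
    (hk_cont : Continuous fun q : (Fin d → ℝ) × (Fin d → ℝ) => k q.1 q.2)
    -- the pair `(X, Y)`, the training sample and the independent sample of inputs
    {Ω : Type*} [MeasurableSpace Ω] (P : Measure Ω) [IsProbabilityMeasure P]
    (X : Ω → Fin p → ℝ) (Y : Ω → Fin d → ℝ) (hX : Measurable X) (hY : Measurable Y)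
    (Xs : ℕ → Ω → Fin p → ℝ) (Ys : ℕ → Ω → Fin d → ℝ) (X' : ℕ → Ω → Fin p → ℝ)
    (hXs : ∀ i, Measurable (Xs i)) (hYs : ∀ i, Measurable (Ys i)) (hX' : ∀ i, Measurable (X' i))
    (hZ_indep : iIndepFun (fun i ω => (Xs i ω, Ys i ω)) P)
    (hZ_law : ∀ i, IdentDistrib (fun ω => (Xs i ω, Ys i ω)) (fun ω => (X ω, Y ω)) P P)
    (hX'_indep : iIndepFun X' P)
    (hX'_law : ∀ i, IdentDistrib (X' i) X P P)
    (hZX' : IndepFun (fun ω (i : ℕ) => (Xs i ω, Ys i ω)) (fun ω (i : ℕ) => X' i ω) P)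
    -- the assumptions on the distribution of the data
    (hD1 : HasBoundedDensityOnCube (P.map X))
    (hD2 : LipschitzCondEmbedding H P X Y)
    (hD3 : LipschitzCondEmbedding H P (fun ω => dropVar j (X ω)) Y)
    -- the denominator of the index does not vanish
    (hvar : 0 < hVar P (fun ω => condEmbedding H P X Y (X ω)))
    -- the subsample size is `n ^ β`, up to rounding
    (β : ℝ) (hβ0 : 0 < β) (hβ1 : β < 1)
    (s : ℕ → ℕ) (hs : ∀ n : ℕ, |(s n : ℝ) - (n : ℝ) ^ β| < 1)
    -- the forest with all the inputs, and the forest retrained without the `j`-th input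
    (α π : ℝ) (κ : ℕ) (hα0 : 0 < α) (hα1 : α ≤ 0.2) (hπ : 0 < π) (hκ : 1 ≤ κ)
    {E E' : Type*} [MeasurableSpace E] [MeasurableSpace E']
    (A : ∀ n, TreeProcedure E (Fin p) d (s n))
    (A' : ∀ n, TreeProcedure E' {l : Fin p // l ≠ j} d (s n))
    (hA : ∀ n, (A n).ForestConditions H α π κ)
    (hA' : ∀ n, (A' n).ForestConditions H α π κ) :
    TendstoInMeasure P
      (fun n ω => dropRelearnImportance H j (A n) (A' n)
        (fun i : Fin n => (Xs i ω, Ys i ω)) (fun i : Fin n => X' i ω))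
      atTop (fun _ => totalSobolMMD H P X Y j) := by
  obtain ⟨K, hK⟩ := hk_bdd
  have hφ : StronglyMeasurable (kernelFeature H : (Fin d → ℝ) → H) :=
    (continuous_kernelFeature hkH hk_cont).stronglyMeasurable
  have hB0 : 0 ≤ √K := Real.sqrt_nonneg K
  have hB (y : Fin d → ℝ) : ‖kernelFeature H y‖ ≤ √K := norm_kernelFeature_le hkH hK y
  set B := √K
  obtain ⟨C, hC⟩ := hD1.exists_slabBounded
  have hdrop : Measurable (dropVar j) := measurable_pi_lambda _ fun l => measurable_pi_apply _
  have hdrop' : Measurable fun q : (Fin p → ℝ) × (Fin d → ℝ) => (dropVar j q.1, q.2) :=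
    (hdrop.comp measurable_fst).prodMk measurable_snd
  have hC' : SlabBounded (P.map fun ω => dropVar j (X ω)) C := by
    have := hC.map_dropVar j
    rwa [Measure.map_map hdrop hX] at this
  have hα1' : α ≤ 1 := hα1.trans (by norm_num)
  -- the two forests are consistent
  obtain ⟨hint, δ, hδ, hδ'⟩ := exists_tendsto_integral_norm_forest_sub hX hY
    (Z := fun i ω => (Xs i ω, Ys i ω)) (fun i => (hXs i).prodMk (hYs i)) hX' hZ_indep hZ_law
    hX'_law hZX' hφ hB0 hB hC hD2 hβ0 hβ1 hs hα0 hα1' hπ hκ hA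
  obtain ⟨hint2, δ2, hδ2, hδ2'⟩ := exists_tendsto_integral_norm_forest_sub
    (X := fun ω => dropVar j (X ω)) (hdrop.comp hX) hY
    (Z := fun i ω => (dropVar j (Xs i ω), Ys i ω)) (X' := fun i ω => dropVar j (X' i ω))
    (fun i => (hdrop.comp (hXs i)).prodMk (hYs i)) (fun i => hdrop.comp (hX' i))
    (hZ_indep.comp (fun _ q => (dropVar j q.1, q.2)) fun _ => hdrop')
    (fun i => (hZ_law i).comp hdrop') (fun i => (hX'_law i).comp hdrop)
    (hZX'.comp
      (φ := fun (z : ℕ → (Fin p → ℝ) × (Fin d → ℝ)) i => (dropVar j (z i).1, (z i).2))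
      (ψ := fun (x : ℕ → Fin p → ℝ) i => dropVar j (x i))
      (measurable_pi_lambda _ fun i => hdrop'.comp (measurable_pi_apply i))
      (measurable_pi_lambda _ fun i => hdrop.comp (measurable_pi_apply i)))
    hφ hB0 hB hC' hD3 hβ0 hβ1 hs hα0 hα1' hπ hκ hA'
  set u : (Fin p → ℝ) → H := condEmbedding H P X Y
  set v : ({l : Fin p // l ≠ j} → ℝ) → H := condEmbedding H P (fun ω => dropVar j (X ω)) Y
  have hum : StronglyMeasurable u := stronglyMeasurable_condEmbedding hφ
  have hvm : StronglyMeasurable v := stronglyMeasurable_condEmbedding hφ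
  have hu (x : Fin p → ℝ) : ‖u x‖ ≤ B := norm_condEmbedding_le hB x
  have hv (x : {l : Fin p // l ≠ j} → ℝ) : ‖v x‖ ≤ B := norm_condEmbedding_le hB x
  let a (n i : ℕ) (ω : Ω) : H := (A n).forest H (fun r : Fin n => (Xs r ω, Ys r ω)) (X' i ω)
  let b (n i : ℕ) (ω : Ω) : H :=
    (A' n).forest H (fun r : Fin n => (dropVar j (Xs r ω), Ys r ω)) (dropVar j (X' i ω))
  have ha (n i : ℕ) (ω : Ω) : ‖a n i ω‖ ≤ B := (A n).norm_forest_le hB0 hB _ _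
  have hb (n i : ℕ) (ω : Ω) : ‖b n i ω‖ ≤ B := (A' n).norm_forest_le hB0 hB _ _
  -- the common bound on the errors of the numerator and of the denominator
  let e (n i : ℕ) (ω : Ω) : ℝ :=
    4 * B * (‖a n i ω - u (X' i ω)‖ + ‖b n i ω - v (dropVar j (X' i ω))‖)
  have heint (n i : ℕ) : Integrable (e n i) P := ((hint n i).add (hint2 n i)).const_mul _
  have heδ (n i : ℕ) : ∫ ω, e n i ω ∂P = 4 * B * (δ n + δ2 n) := by
    rw [← hδ' n i, ← hδ2' n i, ← integral_add (hint n i) (hint2 n i), ← integral_const_mul]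
  have hlim : Tendsto (fun n => 4 * B * (δ n + δ2 n)) atTop (𝓝 0) := by
    simpa using (hδ.add hδ2).const_mul (4 * B)
  have hemean := tendsto_integral_average heint hlim heδ
  have hEint (n : ℕ) : Integrable (fun ω => (n : ℝ)⁻¹ * ∑ i : Fin n, e n i ω) P :=
    (integrable_finsetSum _ fun (i : Fin n) _ => heint n i).const_mul _
  have huX (i : ℕ) : AEStronglyMeasurable (fun ω => u (X' i ω)) P :=
    (hum.comp_measurable (hX' i)).aestronglyMeasurable
  have hvX (i : ℕ) : AEStronglyMeasurable (fun ω => v (dropVar j (X' i ω))) P :=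
    (hvm.comp_measurable (hdrop.comp (hX' i))).aestronglyMeasurable
  have hsq {w : H} {r : ℝ} (hw : ‖w‖ ≤ r) : ‖‖w‖ ^ 2‖ ≤ r ^ 2 := by
    rw [norm_pow, norm_norm]
    exact pow_le_pow_left₀ (norm_nonneg _) hw 2
  have hnum : TendstoInMeasure P (fun (n : ℕ) ω => (n : ℝ)⁻¹ * ∑ i : Fin n, ‖a n i ω - b n i ω‖ ^ 2)
      atTop fun _ => ∫ ω, ‖u (X ω) - v (dropVar j (X ω))‖ ^ 2 ∂P := by
    refine tendstoInMeasure_of_tendsto_integral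
      (g := fun (n : ℕ) ω => (n : ℝ)⁻¹ * ∑ i : Fin n, ‖u (X' i ω) - v (dropVar j (X' i ω))‖ ^ 2)
      (fun n => ?_) ?_ hEint (fun n ω => ?_) hemean
    · exact (Finset.aestronglyMeasurable_fun_sum _ fun (i : Fin n) _ =>
        ((huX i).sub (hvX i)).norm.pow 2).const_mul _
    · exact tendsto_average_comp hX' hX'_indep hX'_law
        (g := fun x => ‖u x - v (dropVar j x)‖ ^ 2)
        ((hum.sub (hvm.comp_measurable hdrop)).norm.pow 2)
        (fun x => hsq ((norm_sub_le _ _).trans (add_le_add (hu x) (hv _))))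
    · exact abs_average_norm_sub_sq_sub_le (fun i => ha n i ω) (fun i => hb n i ω)
        (fun i => hu _) (fun i => hv _)
  have hden : TendstoInMeasure P (fun (n : ℕ) ω =>
      (n : ℝ)⁻¹ * ∑ i : Fin n, ‖a n i ω‖ ^ 2 - ‖(n : ℝ)⁻¹ • ∑ i : Fin n, a n i ω‖ ^ 2)
      atTop fun _ => hVar P fun ω => u (X ω) := by
    rw [hVar_eq (ξ := fun ω => u (X ω)) (hum.comp_measurable hX).aestronglyMeasurable
      fun ω => hu (X ω)]
    refine tendstoInMeasure_of_tendsto_integral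
      (g := fun (n : ℕ) ω => (n : ℝ)⁻¹ * ∑ i : Fin n, ‖u (X' i ω)‖ ^ 2 -
        ‖(n : ℝ)⁻¹ • ∑ i : Fin n, u (X' i ω)‖ ^ 2)
      (fun n => ?_) ?_ hEint (fun n ω => ?_) hemean
    · exact ((Finset.aestronglyMeasurable_fun_sum _ fun (i : Fin n) _ =>
        (huX i).norm.pow 2).const_mul _).sub (((Finset.aestronglyMeasurable_fun_sum _
          fun (i : Fin n) _ => huX i).const_smul _).norm.pow 2)
    · filter_upwards [tendsto_average_comp hX' hX'_indep hX'_law (g := fun x => ‖u x‖ ^ 2)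
        (hum.norm.pow 2) (fun x => hsq (hu x)),
        tendsto_average_comp hX' hX'_indep hX'_law hum hu] with ω h1 h2
      exact h1.sub (h2.norm.pow 2)
    · refine (abs_empirical_variance_sub_le hB0 (fun i => ha n i ω) fun i => hu _).trans ?_
      simp only [e]
      gcongr
      exact le_add_of_nonneg_right (norm_nonneg _)
  rw [totalSobolMMD_eq hX hY hφ hB j]
  refine (tendstoInMeasure_div hnum hden hvar.ne').congr_left fun n => ae_of_all _ fun ω => ?_
  simp only [dropRelearnImportance, relativeDiscrepancy_self, sub_zero, relativeDiscrepancy_eq]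
  rfl
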